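/- **Spin systems.** A spin system on $\mathbb R^2$ is given by a countable set $\Lambda$ of sites with a (not necessarily injective) map to $\mathbb R^2$ that is uniformly locally finite (the number of sites in any unit ball is less than some fixed $l$), and by finite-dimensional $\mathbb Z/2$-graded on-site Hilbert spaces $\mathcal V_j$ of bounded dimension: in a *fermionic* system $\mathcal V_j\cong\mathbb C^{2^{n_j-1}|2^{n_j-1}}$ with $n_j\ge 1$ (the Fock space of $n_j$ fermionic modes), in a *bosonic* system $\mathcal V_j\cong\mathbb C^{2^{m_j}|0}$ with $m_j\ge0$. For a set $J$ of sites, $\mathcal A_J$ is the norm closure of the algebra generated by $B(\mathcal V_j)$, $j\in J$, inside the infinite graded tensor product; $\mathcal A=\mathcal A_\Lambda$, and for $X\subset\mathbb R^2$, $\mathcal A_X$ is the algebra of the sites in $X$. Let $\eta$ be the grading automorphism. A state or an automorphism is graded if it is invariant under, respectively commutes with, $\eta$. $\Psi|_X$ is the restriction of a state $\Psi$ to $\mathcal A_X$. Tensor products are graded: $\Phi=\Psi_1\otimes\Psi_2$ means that $\Phi$ is a state with $\Phi(xy)=\Psi_1(x)\Psi_2(y)$ for $x$, $y$ in the two factors.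 The stack of two systems (both fermionic or both bosonic) has the disjoint union of the lattices as its lattice. A trivial state is a tensor product over the sites of vector states of even unit vectors in $\mathcal V_j$. A trivial extension of $\Psi$ is a state $\Psi\otimes\tau$ of a stack, with $\tau$ a trivial state. **Cones.** A cone is the open region spanned by the half-lines from a point (the apex) with directions in an open interval of angles of length in $(0,2\pi)$. It is generic if no site lies on its boundary. A good conical partition consists of generic cones $A_0,\dots,A_n,B_{01},B_{12},\dots,B_{n0}$, $n\ge1$, with a common apex such that the $A_a$ are disjoint, in counterclockwise order, with the closure of their union equal to $\mathbb R^2$; the closures of any two of the cones $B_{a(a+1)}$ meet only at the apex; and $B_{a(a+1)}$ contains the half-line (without apex) separating $A_a$ from $A_{a+1}$ (indices are cyclic). An automorphism $\alpha$ of $\mathcal A$ is associated with the partition if $\alpha=\prod_a\beta_a\prod_a\beta_{a(a+1)}$, where $\beta_a$, $\beta_{a(a+1)}$ are automorphisms of $\mathcal A$ which preserve $\mathcal A_X$ and act as the identity on $\mathcal A_{X^c}$ for $X=A_a$, respectively $X=B_{a(a+1)}$. **Invertible states.** Two states $\Psi_0,\Psi_1$ over a spin system are in the same phase if for any good conical partition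 there are trivial extensions $\tilde\Psi_0,\tilde\Psi_1$ over the same stack, and a graded automorphism $\alpha$ associated with the partition, such that the GNS representations of $\tilde\Psi_0\circ\alpha$ and $\tilde\Psi_1$ are unitarily equivalent. A state is in the trivial phase if it is in the same phase as a trivial state. A state $\Psi$ is invertible if there are a spin system (of the same kind) and a state $\Psi'$ over it such that the state $\Psi\otimes\Psi'$ exists and is in the trivial phase. **Quasi-equivalence.** Let $J$ be a set of sites. A state $\varphi$ over $\mathcal A_J$ is factorial if for any $\varepsilon>0$ and any finite $X\subset J$ there is a finite $Y$ with $X\subset Y\subset J$ and $|\varphi(xy)-\varphi(x)\varphi(y)|\le\varepsilon\|x\|\|y\|$ for all $x\in\mathcal A_X$, $y\in\mathcal A_{J\setminus Y}$. Two states $\varphi_1,\varphi_2$ over $\mathcal A_J$ are quasi-equivalent if both are factorial and for any $\varepsilon>0$ there is a finite $X\subset J$ with $|\varphi_1(x)-\varphi_2(x)|\le\varepsilon\|x\|$ for all $x\in\mathcal A_{J\setminus X}$. **Lemma.** Every invertible state $\Psi$ over a (fermionic or bosonic) spin system on $\mathbb R^2$ has the split property: for any two disjoint generic cones $B_L,B_R$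 with the same apex whose boundaries intersect only at the apex, and such that $\Psi|_{B_L}$ or $\Psi|_{B_R}$ is graded (which is automatic if $\Psi$ is graded, in particular for bosonic systems), the product state $\Psi|_{B_L}\otimes\Psi|_{B_R}$ over $\mathcal A_{B_L\cup B_R}$ exists and $\Psi|_{B_L\cup B_R}$ is quasi-equivalent to it. -/

import Mathlib

noncomputable section

namespace SpinLattice

open scoped ComplexOrder

/-! ### Spin systems on the plane -/

/-- The Euclidean plane. -/
abbrev Plane : Type := EuclideanSpace ℝ (Fin 2)

/-- The two kinds of spin systems. -/
inductive Statistics : Type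
  | bosonic
  | fermionic

/-- A spin system on the plane: a countable, uniformly locally finite lattice of sites (the map `pos`
need not be injective) with a finite-dimensional on-site Hilbert space `V_j` of dimension
`2 ^ modes j`, where `modes` is bounded.
* fermionic: `V_j` is the Fock space of `modes j = n ≥ 1` fermionic modes (`2n` Majorana modes), i.e.
  the super vector space `ℂ^(2^(n-1) | 2^(n-1))`;
* bosonic: `V_j = ℂ^(2^m | 0)`, `m = modes j`, is the space of `m ≥ 0` qubits.

The number of modes may depend on the site, so that spin systems are closed under stacking. -/
structure SpinSystem (k : Statistics) where
  Site : Type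
  countable_site : Countable Site
  pos : Site → Plane
  uniformlyLocallyFinite : ∃ l : ℕ, ∀ x : Plane, {j | pos j ∈ Metric.ball x 1}.encard < l
  modes : Site → ℕ
  modes_bounded : ∃ N : ℕ, ∀ j, modes j ≤ N
  modes_pos : k = Statistics.fermionic → ∀ j, 1 ≤ modes j

namespace SpinSystem

variable {k : Statistics} (S : SpinSystem k)

instance : DecidableEq S.Site := Classical.decEq _

/-- Labels of the standard basis of the on-site Hilbert space `V_j` (occupation numbers). -/
abbrev Label (j : S.Site) : Type := Fin (S.modes j) → ZMod 2

/-- The `ℤ/2`-degree of a basis vector of `V_j`: the number of fermions mod 2 in a fermionic system,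
zero in a bosonic one. -/
def parity (j : S.Site) : S.Label j →+ ZMod 2 :=
  match k with
  | Statistics.bosonic => 0
  | Statistics.fermionic => ∑ i, Pi.evalAddMonoidHom (fun _ : Fin (S.modes j) => ZMod 2) i

/-- Configurations: a label at each site, zero at all but finitely many sites. -/
abbrev Config : Type := Π₀ j : S.Site, S.Label j

/-- The Hilbert space with orthonormal basis the configurations, on which the algebra of quasi-local
observables is represented (faithfully). -/
abbrev Fock : Type := lp (fun _ : S.Config => ℂ) 2

/-- The sign `(-1)^z`. -/
def sgn (z : ZMod 2) : ℂ := (-1) ^ z.val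

lemma sgn_add (a b : ZMod 2) : sgn (a + b) = sgn a * sgn b := by
  simp only [sgn, ZMod.val_add, ← pow_add]
  exact (neg_one_pow_eq_pow_mod_two _).symm

lemma sgn_mul_self (a : ZMod 2) : sgn a * sgn a = 1 := by
  rw [sgn, ← mul_pow]; simp

lemma norm_sgn (a : ZMod 2) : ‖sgn a‖ = 1 := by simp [sgn]

lemma star_sgn (a : ZMod 2) : star (sgn a) = sgn a := by simp [sgn]

section WeightedShift

variable {ι : Type}

lemma sum_weighted_le (c : ι → ℂ) (C : ℝ) (hC : ∀ s, ‖c s‖ ≤ C) (e : Equiv.Perm ι)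
    (ψ : lp (fun _ : ι => ℂ) 2) (F : Finset ι) :
    ∑ s ∈ F, ‖c s * ψ (e s)‖ ^ (2 : ENNReal).toReal ≤ (C * ‖ψ‖) ^ (2 : ENNReal).toReal := by
  have h2 : (2 : ENNReal).toReal = ((2 : ℕ) : ℝ) := by simp
  have key := lp.sum_rpow_le_norm_rpow (p := 2) (by simp) ψ (F.map e.toEmbedding)
  rw [Finset.sum_map] at key
  simp only [h2, Real.rpow_natCast] at key ⊢
  calc ∑ s ∈ F, ‖c s * ψ (e s)‖ ^ 2 ≤ ∑ s ∈ F, C ^ 2 * ‖ψ (e s)‖ ^ 2 := by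
        refine Finset.sum_le_sum fun s _ => ?_
        rw [norm_mul, mul_pow]
        gcongr
        exact hC s
    _ = C ^ 2 * ∑ s ∈ F, ‖ψ (e s)‖ ^ 2 := by rw [Finset.mul_sum]
    _ ≤ C ^ 2 * ‖ψ‖ ^ 2 := by gcongr; exact key
    _ = (C * ‖ψ‖) ^ 2 := by ring

/-- The bounded operator `(T ψ)(s) = c(s) ψ(e s)` for a bounded function `c` and a bijection `e`. -/
def weightedShift (c : ι → ℂ) (C : ℝ) (hC : ∀ s, ‖c s‖ ≤ C) (e : Equiv.Perm ι) :
    lp (fun _ : ι => ℂ) 2 →L[ℂ] lp (fun _ : ι => ℂ) 2 :=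
  LinearMap.mkContinuous
    { toFun := fun ψ => ⟨fun s => c s * ψ (e s), memℓp_gen' (sum_weighted_le c C hC e ψ)⟩
      map_add' := fun ψ φ => by ext s; exact mul_add _ _ _
      map_smul' := fun a ψ => by ext s; exact mul_left_comm _ _ _ }
    C (fun ψ => by
      rcases isEmpty_or_nonempty ι with h | ⟨⟨s₀⟩⟩
      · have h0 : ∀ φ : lp (fun _ : ι => ℂ) 2, ‖φ‖ = 0 := fun φ => by
          rw [norm_eq_zero]; ext s; exact h.elim s
        simp only [h0, mul_zero, le_refl]
      · exact lp.norm_le_of_forall_sum_le (by simp)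
          (mul_nonneg ((norm_nonneg _).trans (hC s₀)) (norm_nonneg _))
          (sum_weighted_le c C hC e ψ))

@[simp] lemma weightedShift_apply (c : ι → ℂ) (C : ℝ) (hC : ∀ s, ‖c s‖ ≤ C) (e : Equiv.Perm ι)
    (ψ : lp (fun _ : ι => ℂ) 2) (s : ι) :
    weightedShift c C hC e ψ s = c s * ψ (e s) := rfl

end WeightedShift

/-- The fermion number mod 2 of a configuration on the sites before `j`, for a fixed well-ordering of
the sites (any other linear order gives an isomorphic algebra). -/
def parityBefore (j : S.Site) : S.Config →+ ZMod 2 :=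
  open Classical in
  DFinsupp.sumAddHom fun i => if WellOrderingRel i j then S.parity i else 0

/-- The total fermion number mod 2 of a configuration. -/
def totalParity : S.Config →+ ZMod 2 := DFinsupp.sumAddHom S.parity

/-- The operators on the on-site Hilbert space `V_j`. -/
abbrev OnSite (j : S.Site) : Type := Matrix (S.Label j) (S.Label j) ℂ

lemma norm_entry_le (j : S.Site) (M : S.OnSite j) (z : ZMod 2) (a b : S.Label j) :
    ‖sgn z * M a b‖ ≤ ∑ a, ∑ b, ‖M a b‖ := by
  rw [norm_mul, norm_sgn, one_mul]
  exact (Finset.single_le_sum (f := fun b => ‖M a b‖) (fun _ _ => norm_nonneg _)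
    (Finset.mem_univ b)).trans (Finset.single_le_sum (f := fun a => ∑ b, ‖M a b‖)
      (fun _ _ => Finset.sum_nonneg fun _ _ => norm_nonneg _) (Finset.mem_univ a))

/-- The operator `M ∈ B(V_j)` acting on the site `j`. Its matrix element from the label `s_j + v` to the
label `s_j` comes with the Koszul sign of moving an operator of degree `|v|` past the sites before
`j`; hence on-site operators on distinct sites commute in the graded sense, and together they
generate the graded tensor product of the algebras `B(V_j)` (the ordinary one in the bosonic case). -/
def onSite (j : S.Site) (M : S.OnSite j) : S.Fock →L[ℂ] S.Fock :=
  ∑ v : S.Label j, weightedShift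
    (fun s : S.Config => sgn (S.parity j v * S.parityBefore j s) * M (s j) (s j + v))
    (∑ a, ∑ b, ‖M a b‖) (fun _ => S.norm_entry_le j M _ _ _)
    (Equiv.addRight (DFinsupp.single j v))

/-- The algebra `A_J` of quasi-local observables on the set `J` of sites: the norm closure of the
`*`-algebra generated by the on-site operators. -/
def algebra (J : Set S.Site) : StarSubalgebra ℂ (S.Fock →L[ℂ] S.Fock) :=
  (StarAlgebra.adjoin ℂ {x | ∃ j ∈ J, ∃ M : S.OnSite j, x = S.onSite j M}).topologicalClosure

lemma onSite_mem {J : Set S.Site} {j : S.Site} (hj : j ∈ J) (M : S.OnSite j) :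
    S.onSite j M ∈ S.algebra J :=
  StarSubalgebra.le_topologicalClosure _ (StarAlgebra.subset_adjoin ℂ _ ⟨j, hj, M, rfl⟩)

lemma algebra_mono {I J : Set S.Site} (h : I ⊆ J) : S.algebra I ≤ S.algebra J :=
  StarSubalgebra.topologicalClosure_mono
    (StarAlgebra.adjoin_mono fun _ ⟨j, hj, M, hx⟩ => ⟨j, h hj, M, hx⟩)

/-- `A_J` as a C*-algebra. -/
def Obs (J : Set S.Site) : Type := S.algebra J

/-- The C*-algebra structure of `A_J`, inherited from the bounded operators. -/
def obsCStarAlgebra (J : Set S.Site) : CStarAlgebra (S.Obs J) :=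
  haveI : IsClosed (S.algebra J : Set (S.Fock →L[ℂ] S.Fock)) :=
    StarSubalgebra.isClosed_topologicalClosure _
  StarSubalgebra.cstarAlgebra (S.algebra J)

instance (J : Set S.Site) : CStarAlgebra (S.Obs J) := S.obsCStarAlgebra J

instance (J : Set S.Site) : PartialOrder (S.Obs J) := CStarAlgebra.spectralOrder _

instance (J : Set S.Site) : StarOrderedRing (S.Obs J) := CStarAlgebra.spectralOrderedRing _

variable {S}

/-- The inclusion `A_I ⊆ A_J` for `I ⊆ J`. -/
def incl {I J : Set S.Site} (h : I ⊆ J) : S.Obs I →⋆ₐ[ℂ] S.Obs J :=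
  StarSubalgebra.inclusion (S.algebra_mono h)

/-- `x ∈ A_J` lies in the subalgebra `A_I`. -/
def InAlgebra {J : Set S.Site} (x : S.Obs J) (I : Set S.Site) : Prop := x.1 ∈ S.algebra I

variable (S)

/-! ### The grading automorphism -/

/-- The fermion parity operator (the identity in a bosonic system). -/
def parityOp : S.Fock →L[ℂ] S.Fock :=
  weightedShift (fun s => sgn (S.totalParity s)) 1 (fun _ => (norm_sgn _).le) (Equiv.refl _)

lemma parityOp_mul_self : S.parityOp * S.parityOp = 1 := by
  ext ψ s
  simp only [parityOp, mul_apply_eq_comp, weightedShift_apply, Equiv.refl_apply,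
    one_apply_eq_self]
  rw [← mul_assoc, sgn_mul_self, one_mul]

lemma star_parityOp : star S.parityOp = S.parityOp := by
  rw [ContinuousLinearMap.star_eq_adjoint]
  refine ((ContinuousLinearMap.eq_adjoint_iff _ _).mpr fun ψ φ => ?_).symm
  rw [lp.inner_eq_tsum, lp.inner_eq_tsum]
  refine tsum_congr fun s => ?_
  have h := star_sgn (S.totalParity s)
  simp only [parityOp, weightedShift_apply, Equiv.refl_apply, RCLike.inner_apply, map_mul]
  rw [starRingEnd_apply, h]
  ring

/-- The fermion parity operator as a unitary. -/
def parityUnitary : unitary (S.Fock →L[ℂ] S.Fock) :=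
  ⟨S.parityOp, by
    rw [Unitary.mem_iff, star_parityOp, parityOp_mul_self]; exact ⟨rfl, rfl⟩⟩

lemma parityOp_conj_onSite (j : S.Site) (M : S.OnSite j) :
    S.parityOp * S.onSite j M * S.parityOp =
      S.onSite j (Matrix.of fun a b => sgn (S.parity j (b - a)) * M a b) := by
  ext ψ s
  simp only [parityOp, onSite, mul_apply_eq_comp, weightedShift_apply, Equiv.refl_apply,
    sum_apply, Finset.sum_apply, lp.coeFn_sum,
    Finset.mul_sum, Equiv.coe_addRight, Matrix.of_apply, add_sub_cancel_left]
  refine Finset.sum_congr rfl fun v _ => ?_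
  have : S.totalParity (DFinsupp.single j v) = S.parity j v := by
    simp [totalParity]
  rw [map_add, sgn_add, this]
  linear_combination (sgn (S.parity j v * S.parityBefore j s) * M (s j) (s j + v) *
    sgn (S.parity j v) * ψ (s + DFinsupp.single j v)) * sgn_mul_self (S.totalParity s)

lemma parityOp_conj_mem (J : Set S.Site) {x : S.Fock →L[ℂ] S.Fock} (hx : x ∈ S.algebra J) :
    Unitary.conjStarAlgAut ℂ _ S.parityUnitary x ∈ S.algebra J := by
  set η : (S.Fock →L[ℂ] S.Fock) →⋆ₐ[ℂ] (S.Fock →L[ℂ] S.Fock) :=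
    ↑(Unitary.conjStarAlgAut ℂ (S.Fock →L[ℂ] S.Fock) S.parityUnitary) with hη
  have hη' : ∀ y, η y = S.parityOp * y * S.parityOp := fun y => by
    change S.parityOp * y * star S.parityOp = _
    rw [star_parityOp]
  have hcont : Continuous η := by
    have : (η : (S.Fock →L[ℂ] S.Fock) → _) = fun y => S.parityOp * y * S.parityOp := funext hη'
    rw [this]
    fun_prop
  have hle : S.algebra J ≤ (S.algebra J).comap η := by
    refine StarSubalgebra.topologicalClosure_minimal (StarAlgebra.adjoin_le ?_) ?_
    · rintro _ ⟨j, hj, M, rfl⟩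
      change η (S.onSite j M) ∈ S.algebra J
      rw [hη', parityOp_conj_onSite]
      exact S.onSite_mem hj _
    · exact (StarSubalgebra.isClosed_topologicalClosure _).preimage hcont
  exact hle hx

/-- The grading automorphism `η` of `A_J`. -/
def grading (J : Set S.Site) : S.Obs J →⋆ₐ[ℂ] S.Obs J :=
  StarAlgHom.codRestrict
    (((Unitary.conjStarAlgAut ℂ _ S.parityUnitary : _ ≃⋆ₐ[ℂ] _) :
      (S.Fock →L[ℂ] S.Fock) →⋆ₐ[ℂ] (S.Fock →L[ℂ] S.Fock)).comp (S.algebra J).subtype)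
    (S.algebra J) (fun x => S.parityOp_conj_mem J x.2)

/-! ### States -/

/-- A state over `A_J`: a positive normalized linear functional. -/
structure State (J : Set S.Site) where
  toFun : S.Obs J →ₗ[ℂ] ℂ
  nonneg : ∀ a, 0 ≤ toFun (star a * a)
  map_one : toFun 1 = 1

variable {S}

namespace State

instance (J : Set S.Site) : CoeFun (S.State J) (fun _ => S.Obs J → ℂ) := ⟨fun φ => φ.toFun⟩

/-- A state as a positive linear functional. -/
def toPositive {J : Set S.Site} (φ : S.State J) : S.Obs J →ₚ[ℂ] ℂ :=
  PositiveLinearMap.mk₀ φ.toFun fun x hx => by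
    obtain ⟨b, rfl⟩ := CStarAlgebra.nonneg_iff_eq_star_mul_self.mp hx
    exact φ.nonneg b

/-- The state `x ↦ φ (α x)`. -/
def comp {I J : Set S.Site} (φ : S.State J) (α : S.Obs I →⋆ₐ[ℂ] S.Obs J) : S.State I where
  toFun := φ.toFun.comp (α : S.Obs I →ₐ[ℂ] S.Obs J).toLinearMap
  nonneg a := by
    have h : (α : S.Obs I →ₐ[ℂ] S.Obs J).toLinearMap (star a * a) = star (α a) * α a := by
      change α (star a * a) = _
      rw [map_mul, map_star]
    rw [LinearMap.comp_apply, h]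
    exact φ.nonneg _
  map_one := by
    have h : (α : S.Obs I →ₐ[ℂ] S.Obs J).toLinearMap 1 = 1 := _root_.map_one α
    rw [LinearMap.comp_apply, h, φ.map_one]

/-- The restriction of a state over `A_J` to `A_I`, `I ⊆ J`. -/
def restrict {I J : Set S.Site} (φ : S.State J) (h : I ⊆ J) : S.State I := φ.comp (incl h)

/-- A state is graded if it is invariant under the grading automorphism. -/
def IsGraded {J : Set S.Site} (φ : S.State J) : Prop := ∀ x, φ (S.grading J x) = φ x

/-- Unitary equivalence of the GNS representations of two states. -/
def UnitarilyEquivalent {J : Set S.Site} (φ ψ : S.State J) : Prop :=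
  ∃ U : φ.toPositive.GNS ≃ₗᵢ[ℂ] ψ.toPositive.GNS, ∀ (a : S.Obs J) (v : φ.toPositive.GNS),
    U (φ.toPositive.gnsStarAlgHom a v) = ψ.toPositive.gnsStarAlgHom a (U v)

/-- Factorial states: the correlations with a finite set of sites decay at infinity. -/
def IsFactorial {J : Set S.Site} (φ : S.State J) : Prop :=
  ∀ ε : ℝ, 0 < ε → ∀ X : Finset S.Site, (X : Set S.Site) ⊆ J →
    ∃ Y : Finset S.Site, X ⊆ Y ∧ (Y : Set S.Site) ⊆ J ∧
      ∀ x y : S.Obs J, InAlgebra x X → InAlgebra y (J \ Y) →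
        ‖φ (x * y) - φ x * φ y‖ ≤ ε * ‖x‖ * ‖y‖

/-- Quasi-equivalence: two factorial states which coincide at infinity. -/
def QuasiEquivalent {J : Set S.Site} (φ ψ : S.State J) : Prop :=
  φ.IsFactorial ∧ ψ.IsFactorial ∧
    ∀ ε : ℝ, 0 < ε → ∃ X : Finset S.Site, (X : Set S.Site) ⊆ J ∧
      ∀ x : S.Obs J, InAlgebra x (J \ X) → ‖φ x - ψ x‖ ≤ ε * ‖x‖

/-- `Φ` is the (graded) tensor product of the state `φ` over `A_I` and the state `ψ` over `A_J`, for
disjoint `I` and `J`. -/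
def IsTensor {I J : Set S.Site} (Φ : S.State (I ∪ J)) (φ : S.State I) (ψ : S.State J) : Prop :=
  ∀ (x : S.Obs I) (y : S.Obs J),
    Φ (incl Set.subset_union_left x * incl Set.subset_union_right y) = φ x * ψ y

end State

variable (S)

/-- The on-site operator `M` at `j` as an element of the algebra of quasi-local observables. -/
def site (j : S.Site) (M : S.OnSite j) : S.Obs Set.univ := ⟨S.onSite j M, S.onSite_mem (Set.mem_univ j) M⟩

variable {S}

/-- A trivial state: the tensor product of vector states of even unit vectors `v_j ∈ V_j`. -/
def State.IsTrivial (φ : S.State Set.univ) : Prop :=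
  ∃ v : ∀ j : S.Site, S.Label j → ℂ,
    (∀ j, ∑ a, ‖v j a‖ ^ 2 = 1) ∧ (∀ j a, S.parity j a ≠ 0 → v j a = 0) ∧
    ∀ (l : List S.Site) (M : ∀ j, S.OnSite j), l.Nodup →
      φ (l.map fun j => S.site j (M j)).prod =
        (l.map fun j => ∑ a, ∑ b, star (v j a) * M j a b * v j b).prod

/-! ### Stacking -/

/-- The stack of two spin systems. -/
def stack (S T : SpinSystem k) : SpinSystem k where
  Site := S.Site ⊕ T.Site
  countable_site := haveI := S.countable_site; haveI := T.countable_site; inferInstance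
  pos := Sum.elim S.pos T.pos
  uniformlyLocallyFinite := by
    obtain ⟨l, hl⟩ := S.uniformlyLocallyFinite
    obtain ⟨m, hm⟩ := T.uniformlyLocallyFinite
    refine ⟨l + m, fun x => ?_⟩
    have h : {j | Sum.elim S.pos T.pos j ∈ Metric.ball x 1} =
        Sum.inl '' {j | S.pos j ∈ Metric.ball x 1} ∪ Sum.inr '' {j | T.pos j ∈ Metric.ball x 1} := by
      ext (j | j) <;> simp
    rw [h]
    refine (Set.encard_union_le _ _).trans_lt ?_
    rw [Sum.inl_injective.encard_image, Sum.inr_injective.encard_image]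
    push_cast
    exact ENat.add_lt_add (hl x) (hm x)
  modes := Sum.elim S.modes T.modes
  modes_bounded := by
    obtain ⟨N, hN⟩ := S.modes_bounded
    obtain ⟨M, hM⟩ := T.modes_bounded
    exact ⟨max N M, by rintro (j | j) <;> simp [hN, hM]⟩
  modes_pos := fun h => by
    rintro (j | j)
    · exact S.modes_pos h j
    · exact T.modes_pos h j

variable (S) in
/-- The product of a list of on-site operators. Such products span a dense subspace. -/
def word (w : List (Σ j, S.OnSite j)) : S.Obs Set.univ := (w.map fun p => S.site p.1 p.2).prod

/-- A list of on-site operators of `S`, regarded as operators of the stack of `S` and `T`. -/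
def inlWord {S : SpinSystem k} (T : SpinSystem k) (w : List (Σ j, S.OnSite j)) :
    List (Σ j, (stack S T).OnSite j) := w.map fun p => ⟨Sum.inl p.1, p.2⟩

/-- A list of on-site operators of `T`, regarded as operators of the stack of `S` and `T`. -/
def inrWord (S : SpinSystem k) {T : SpinSystem k} (w : List (Σ j, T.OnSite j)) :
    List (Σ j, (stack S T).OnSite j) := w.map fun p => ⟨Sum.inr p.1, p.2⟩

/-- `Φ` is the stack `φ ⊗ ψ` of the states `φ` and `ψ`. -/
def IsStack {S T : SpinSystem k} (Φ : (stack S T).State Set.univ) (φ : S.State Set.univ)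
    (ψ : T.State Set.univ) : Prop :=
  ∀ (w : List (Σ j, S.OnSite j)) (w' : List (Σ j, T.OnSite j)),
    Φ ((stack S T).word (inlWord T w) * (stack S T).word (inrWord S w')) =
      φ (S.word w) * ψ (T.word w')

end SpinSystem

/-! ### Cones -/

/-- The unit vector of angle `t`. -/
def dir (t : ℝ) : Plane := !₂[Real.cos t, Real.sin t]

/-- A cone, given by its apex and the interval `(lo, hi)` of directions. -/
structure Cone where
  apex : Plane
  lo : ℝ
  hi : ℝ
  lo_lt_hi : lo < hi
  hi_lt : hi < lo + 2 * Real.pi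

namespace Cone

/-- The half-line from `p` (excluded) in the direction of angle `t`. -/
def ray (p : Plane) (t : ℝ) : Set Plane := {x | ∃ r : ℝ, 0 < r ∧ x = p + r • dir t}

/-- The open region of the plane spanned by the half-lines of the cone. -/
def region (C : Cone) : Set Plane := ⋃ t ∈ Set.Ioo C.lo C.hi, ray C.apex t

/-- The boundary of a cone is the boundary of its closure. -/
def boundary (C : Cone) : Set Plane := frontier (closure C.region)

/-- A cone is generic if there are no sites on its boundary. -/
def IsGeneric {k : Statistics} (C : Cone) (S : SpinSystem k) : Prop := ∀ j, S.pos j ∉ C.boundary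

end Cone

/-- A good conical partition `{A_0, …, A_n, B_{01}, …, B_{n0}}`, `n = m + 1 ≥ 1`. Here `B a` is
`B_{a(a+1)}`, and `a + 1` is taken cyclically. -/
structure GoodConicalPartition {k : Statistics} (S : SpinSystem k) where
  m : ℕ
  apex : Plane
  A : Fin (m + 2) → Cone
  B : Fin (m + 2) → Cone
  A_generic : ∀ a, (A a).IsGeneric S
  B_generic : ∀ a, (B a).IsGeneric S
  A_apex : ∀ a, (A a).apex = apex
  B_apex : ∀ a, (B a).apex = apex
  A_disjoint : Pairwise fun a b => Disjoint (A a).region (A b).region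
  A_cover : closure (⋃ a, (A a).region) = Set.univ
  /-- `A_{a+1}` follows `A_a` counterclockwise. -/
  A_order : ∀ a, dir (A (a + 1)).lo = dir (A a).hi
  B_closure : ∀ a b, a ≠ b → closure (B a).region ∩ closure (B b).region = {apex}
  /-- `B_{a(a+1)}` contains the half-line separating `A_a` and `A_{a+1}`. -/
  B_contains : ∀ a, Cone.ray apex (A a).hi ⊆ (B a).region

namespace SpinSystem

variable {k : Statistics}

/-- The sites in a region of the plane. -/
def sitesIn (S : SpinSystem k) (X : Set Plane) : Set S.Site := S.pos ⁻¹' X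

/-- Automorphisms of the algebra of quasi-local observables. -/
abbrev Aut (S : SpinSystem k) : Type := S.Obs Set.univ ≃⋆ₐ[ℂ] S.Obs Set.univ

/-- `β` is (the extension by the identity of) an automorphism of `A_X`. -/
def IsAutOf {S : SpinSystem k} (β : S.Aut) (X : Set Plane) : Prop :=
  (∀ x, InAlgebra (β x) (S.sitesIn X) ↔ InAlgebra x (S.sitesIn X)) ∧
    ∀ x, InAlgebra x (S.sitesIn Xᶜ) → β x = x

/-- An automorphism is graded if it commutes with the grading automorphism. -/
def IsGradedAut {S : SpinSystem k} (α : S.Aut) : Prop :=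
  ∀ x, α (S.grading Set.univ x) = S.grading Set.univ (α x)

/-- An automorphism of the algebra of the system `R` (an extension of `S`) is associated with a good
conical partition if it is a product `∏ β_a ∏ β_{a(a+1)}` of automorphisms of the algebras of
the cones `A_a` and `B_{a(a+1)}`. -/
def IsAssociated {S R : SpinSystem k} (α : R.Aut) (P : GoodConicalPartition S) : Prop :=
  ∃ βA βB : Fin (P.m + 2) → R.Aut,
    (∀ a, IsAutOf (βA a) (P.A a).region) ∧ (∀ a, IsAutOf (βB a) (P.B a).region) ∧
      α = (List.ofFn βA).prod * (List.ofFn βB).prod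

/-- Two states over a spin system are in the same phase if for any good conical partition they have
trivial extensions which are related, up to unitary equivalence, by a graded automorphism associated
with the partition. -/
def SamePhase {S : SpinSystem k} (φ₀ φ₁ : S.State Set.univ) : Prop :=
  ∀ P : GoodConicalPartition S, ∃ (T : SpinSystem k) (τ₀ τ₁ : T.State Set.univ)
    (Φ₀ Φ₁ : (stack S T).State Set.univ) (α : (stack S T).Aut),
    τ₀.IsTrivial ∧ τ₁.IsTrivial ∧ IsStack Φ₀ φ₀ τ₀ ∧ IsStack Φ₁ φ₁ τ₁ ∧
      IsGradedAut α ∧ IsAssociated α P ∧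
      (Φ₀.comp (α : (stack S T).Obs Set.univ →⋆ₐ[ℂ] (stack S T).Obs Set.univ)).UnitarilyEquivalent Φ₁

/-- A state is in the trivial phase if it is in the same phase as a trivial state. -/
def InTrivialPhase {S : SpinSystem k} (φ : S.State Set.univ) : Prop :=
  ∃ τ : S.State Set.univ, τ.IsTrivial ∧ SamePhase τ φ

/-- A state `Ψ` is invertible if there is a spin system with a state `Ψ'` such that `Ψ ⊗ Ψ'` is in the
trivial phase. -/
def IsInvertible {S : SpinSystem k} (Ψ : S.State Set.univ) : Prop :=
  ∃ (S' : SpinSystem k) (Ψ' : S'.State Set.univ) (Φ : (stack S S').State Set.univ),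
    IsStack Φ Ψ Ψ' ∧ InTrivialPhase Φ

/-- The restriction of a state to a region of the plane. -/
def State.onRegion {S : SpinSystem k} (Ψ : S.State Set.univ) (X : Set Plane) :
    S.State (S.sitesIn X) := Ψ.restrict (Set.subset_univ _)

/-- The split property. The condition that one of the two restrictions is graded holds for all graded
states, hence for all states of bosonic systems; without it the graded tensor product of the two
restrictions is not a state. -/
def HasSplitProperty {S : SpinSystem k} (Ψ : S.State Set.univ) : Prop :=
  ∀ L R : Cone, L.IsGeneric S → R.IsGeneric S → L.apex = R.apex →
    Disjoint L.region R.region → L.boundary ∩ R.boundary = {L.apex} →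
    ((Ψ.onRegion L.region).IsGraded ∨ (Ψ.onRegion R.region).IsGraded) →
    ∃ Φ : S.State (S.sitesIn L.region ∪ S.sitesIn R.region),
      Φ.IsTensor (Ψ.onRegion L.region) (Ψ.onRegion R.region) ∧
      (Ψ.restrict (Set.subset_univ (S.sitesIn L.region ∪ S.sitesIn R.region))).QuasiEquivalent Φ

end SpinSystem

end SpinLattice

end

noncomputable section

open scoped ComplexOrder

namespace SpinLattice

namespace SpinSystem

variable {k : Statistics} {S : SpinSystem k}

/-! ### Observables and the operators underlying them -/

section Basics

variable {J : Set S.Site}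

/-! The state `Ψ` and the product of its two restrictions are compared through a third state `ω`.
For any partition of the stack of `Ψ` with its inverse, invertibility gives a product vector state
`Φ₀` on a larger stack, a graded automorphism `α` associated with the partition, and an extension
`Φ₁` of `Ψ` whose GNS representation is unitarily equivalent to that of `Ω = Φ₀ ∘ α`. The state `ω`
is the pull-back of `Ω` to the system of `Ψ`.

The partition is chosen so that, outside a bounded region, `L` and `R` lie in two different cones
`A_a`, `A_b` and miss all the cones `B` (`exists_goodConicalPartition`). On observables of `L` or
`R` supported away from finitely many sites the `B` automorphisms then do nothing, and the `A`
automorphisms preserve `A_a` and `A_b` (`IsAssociated.apply_mem`). Since `Φ₀` is a product, `ω`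
factorizes between the far parts of `L` and `R`.

The notion that carries the estimates is `State.AsympFactor φ ω K b`: `φ (b z)` is close to `φ b * ω
z` for `z` far away in `K`. It is linear and norm-closed in `b`, hence can be checked on products of
local observables. The case `b = 1` says that `φ` and `ω` agree at infinity, and all `b` together
give decay of correlations, so two states that factorize asymptotically against the same `ω` are
quasi-equivalent (`quasiEquivalent_of_asympFactor`). For `Ψ` this holds because `Ω` is clustering
(`asympFactor_comp`: the preimage under `α` of a local minimal projection is almost local and even)
and because GNS equivalence makes `Φ₁` norm-close to `Ω (a* · a)` with local `a`, which far
observables commute with in the graded sense (`UnitarilyEquivalent.asympFactor`).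

For the product of the restrictions the tool is the slice map, a positive map that evaluates a
graded state on a finite set of sites and leaves the other sites alone (`exists_isSlice`). Composing
`Ψ` with slice maps and passing to a limit gives the product state (`exists_product`). Two slice
maps, one for `Ψ` and one for `ω`, reduce its asymptotic factorization to that of `Ψ` and to the
factorization of `ω` at infinity (`product_asympFactor`).

Everything finite-dimensional is done with frames: homogeneous matrix units of the algebra of a
finite set of sites, built site by site. Pulling states back needs an embedding of the algebra of a
system into that of a stack (`embL`), where the signs depend on well-orderings of the sites that are
unrelated to each other. -/

lemma obs_ext {x y : S.Obs J} (h : x.1 = y.1) : x = y := Subtype.ext h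

lemma obs_norm (x : S.Obs J) : ‖x‖ = ‖x.1‖ := rfl

lemma obs_isometry_val : Isometry (fun x : S.Obs J => x.1) := isometry_subtype_coe

lemma val_codRestrict {f : S.algebra J →⋆ₐ[ℂ] (S.Fock →L[ℂ] S.Fock)} (hf : ∀ x, f x ∈ S.algebra J)
    (x : S.algebra J) : (StarAlgHom.codRestrict f (S.algebra J) hf x).1 = f x := rfl

lemma comp_subtype_apply (f : (S.Fock →L[ℂ] S.Fock) →⋆ₐ[ℂ] (S.Fock →L[ℂ] S.Fock))
    (x : S.algebra J) : (f.comp (S.algebra J).subtype) x = f x.1 := rfl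

lemma starAlgEquiv_coe_apply (f : (S.Fock →L[ℂ] S.Fock) ≃⋆ₐ[ℂ] (S.Fock →L[ℂ] S.Fock))
    (x : S.Fock →L[ℂ] S.Fock) :
    (f : (S.Fock →L[ℂ] S.Fock) →⋆ₐ[ℂ] (S.Fock →L[ℂ] S.Fock)) x = f x := rfl

lemma conj_parityUnitary_apply (x : S.Fock →L[ℂ] S.Fock) :
    Unitary.conjStarAlgAut ℂ _ S.parityUnitary x = S.parityOp * x * S.parityOp := by
  have h : S.parityUnitary.1 = S.parityOp := rfl
  have h' : Unitary.conjStarAlgAut ℂ _ S.parityUnitary x =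
      S.parityUnitary.1 * x * star S.parityUnitary.1 :=
    Unitary.conjStarAlgAut_apply S.parityUnitary x
  rw [h', h, star_parityOp]

lemma grading_val_eq_conj (x : S.Obs J) :
    (S.grading J x).1 = (Unitary.conjStarAlgAut ℂ _ S.parityUnitary) x.1 := by
  unfold grading
  exact (val_codRestrict _ _).trans ((comp_subtype_apply _ _).trans (starAlgEquiv_coe_apply _ _))

@[simp] lemma grading_val (x : S.Obs J) :
    (S.grading J x).1 = S.parityOp * x.1 * S.parityOp :=
  (grading_val_eq_conj x).trans (conj_parityUnitary_apply x.1)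

lemma starSubalgebra_inclusion_val {A : Type*} [Semiring A] [StarRing A] [Algebra ℂ A]
    [StarModule ℂ A] {B C : StarSubalgebra ℂ A} (h : B ≤ C) (x : B) :
    (StarSubalgebra.inclusion h x).1 = x.1 := rfl

lemma incl_eq_inclusion {I : Set S.Site} (h : I ⊆ J) (x : S.Obs I) :
    incl h x = StarSubalgebra.inclusion (S.algebra_mono h) x := by
  unfold incl
  rfl

@[simp] lemma incl_val {I : Set S.Site} (h : I ⊆ J) (x : S.Obs I) : (incl h x).1 = x.1 :=
  (congrArg Subtype.val (incl_eq_inclusion h x)).trans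
    (starSubalgebra_inclusion_val (S.algebra_mono h) x)

end Basics

/-! ### On-site operators: products, adjoints and graded commutation -/

lemma sgn_zero : sgn 0 = 1 := by simp [sgn]
lemma sgn_one : sgn 1 = -1 := by simp [sgn, ZMod.val_one]
lemma sgn_neg (a : ZMod 2) : sgn (-a) = sgn a := by rw [ZMod.neg_eq_self_mod_two]

lemma onSite_apply (j : S.Site) (M : S.OnSite j) (ψ : S.Fock) (s : S.Config) :
    S.onSite j M ψ s = ∑ v : S.Label j,
      sgn (S.parity j v * S.parityBefore j s) * M (s j) (s j + v) *
        ψ (s + DFinsupp.single j v) := by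
  simp only [onSite, sum_apply, lp.coeFn_sum, Finset.sum_apply, weightedShift_apply,
    Equiv.coe_addRight]

lemma parityBefore_single (i j : S.Site) (v : S.Label i) :
    S.parityBefore j (DFinsupp.single i v) =
      open Classical in if WellOrderingRel i j then S.parity i v else 0 := by
  classical
  simp only [parityBefore, DFinsupp.sumAddHom_single]
  split_ifs <;> rfl

lemma parityBefore_single_self (j : S.Site) (v : S.Label j) :
    S.parityBefore j (DFinsupp.single j v) = 0 := by
  classical
  rw [parityBefore_single, if_neg (irrefl_of WellOrderingRel j)]

lemma onSite_add (j : S.Site) (M N : S.OnSite j) :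
    S.onSite j (M + N) = S.onSite j M + S.onSite j N := by
  ext ψ s
  simp only [onSite_apply, add_apply, lp.coeFn_add, Pi.add_apply, Matrix.add_apply,
    ← Finset.sum_add_distrib]
  exact Finset.sum_congr rfl fun v _ => by ring

lemma onSite_smul (j : S.Site) (c : ℂ) (M : S.OnSite j) :
    S.onSite j (c • M) = c • S.onSite j M := by
  ext ψ s
  simp only [onSite_apply, smul_apply, lp.coeFn_smul, Pi.smul_apply,
    Matrix.smul_apply, smul_eq_mul, Finset.mul_sum]
  exact Finset.sum_congr rfl fun v _ => by ring

lemma onSite_one (j : S.Site) : S.onSite j 1 = 1 := by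
  ext ψ s
  rw [onSite_apply, Finset.sum_eq_single 0]
  · rw [add_zero, Matrix.one_apply_eq]; simp [sgn_zero]
  · intro v _ hv
    rw [Matrix.one_apply_ne (by simpa using fun h => hv h)]
    simp
  · simp

/-- Shifting the label at `j` does not change the parity before `j`, so the Koszul signs of the two
factors multiply to that of the product. The sum over intermediate labels is reindexed by
differences of labels. -/
lemma onSite_mul (j : S.Site) (M N : S.OnSite j) :
    S.onSite j (M * N) = S.onSite j M * S.onSite j N := by
  ext ψ s
  simp only [mul_apply_eq_comp, onSite_apply, Matrix.mul_apply, Finset.mul_sum,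
    Finset.sum_mul]
  rw [Finset.sum_comm]
  refine (Equiv.sum_comp (Equiv.addLeft (s j)) _).symm.trans (Finset.sum_congr rfl fun v _ => ?_)
  refine (Equiv.sum_comp (Equiv.addLeft v) _).symm.trans (Finset.sum_congr rfl fun w _ => ?_)
  simp only [Equiv.coe_addLeft, map_add, parityBefore_single_self, add_zero, DFinsupp.add_apply,
    DFinsupp.single_eq_same, add_mul, sgn_add, DFinsupp.single_add, add_assoc]
  ring

lemma star_weightedShift {ι : Type} (c : ι → ℂ) (C : ℝ) (hC : ∀ s, ‖c s‖ ≤ C)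
    (e : Equiv.Perm ι) :
    star (weightedShift c C hC e) = weightedShift (fun s => star (c (e.symm s))) C
      (fun s => by rw [norm_star]; exact hC _) e.symm := by
  rw [ContinuousLinearMap.star_eq_adjoint]
  refine ((ContinuousLinearMap.eq_adjoint_iff _ _).mpr fun ψ φ => ?_).symm
  rw [lp.inner_eq_tsum, lp.inner_eq_tsum, ← e.tsum_eq]
  refine tsum_congr fun s => ?_
  simp only [weightedShift_apply, Equiv.symm_apply_apply, RCLike.inner_apply, map_mul,
    RCLike.star_def, Complex.conj_conj]
  ring

lemma star_onSite (j : S.Site) (M : S.OnSite j) :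
    star (S.onSite j M) = S.onSite j M.conjTranspose := by
  rw [onSite, star_sum]
  simp only [star_weightedShift]
  ext ψ s
  rw [onSite_apply]
  simp only [sum_apply, lp.coeFn_sum, Finset.sum_apply, weightedShift_apply]
  refine (Equiv.sum_comp (Equiv.neg _) _).symm.trans (Finset.sum_congr rfl fun v _ => ?_)
  have h1 : (Equiv.addRight (DFinsupp.single j (-v)) : Equiv.Perm S.Config).symm s =
      s + DFinsupp.single j v := by
    change s + -_ = _
    rw [DFinsupp.single_neg, neg_neg]
  simp only [Equiv.neg_apply, h1, map_neg, map_add, parityBefore_single_self, add_zero, star_mul',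
    star_sgn, DFinsupp.add_apply, DFinsupp.single_eq_same, add_neg_cancel_right, neg_mul, sgn_neg,
    Matrix.conjTranspose_apply]

/-- Graded commutation of homogeneous on-site operators on distinct sites. -/
lemma onSite_graded_comm {i j : S.Site} (hij : i ≠ j) (M : S.OnSite i) (N : S.OnSite j)
    (d e : ZMod 2) (hM : ∀ a b, M a b ≠ 0 → S.parity i (b - a) = d)
    (hN : ∀ a b, N a b ≠ 0 → S.parity j (b - a) = e) :
    S.onSite i M * S.onSite j N = sgn (d * e) • (S.onSite j N * S.onSite i M) := by
  classical
  ext ψ s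
  simp only [mul_apply_eq_comp, onSite_apply, smul_apply, lp.coeFn_smul, Pi.smul_apply,
    smul_eq_mul, Finset.mul_sum]
  rw [Finset.sum_comm]
  refine Finset.sum_congr rfl fun w _ => Finset.sum_congr rfl fun v _ => ?_
  simp only [map_add, DFinsupp.add_apply, DFinsupp.single_eq_of_ne hij,
    DFinsupp.single_eq_of_ne hij.symm, add_zero, parityBefore_single]
  by_cases hm : M (s i) (s i + v) = 0
  · simp [hm]
  by_cases hn : N (s j) (s j + w) = 0
  · simp [hn]
  have hd : S.parity i v = d := by simpa using hM _ _ hm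
  have he : S.parity j w = e := by simpa using hN _ _ hn
  rw [hd, he, add_right_comm s]
  -- Only the shift at the earlier site changes the parity before the other one; this yields the
  -- factor `sgn (d * e)` in exactly one of the two orders of multiplication.
  rcases trichotomous_of WellOrderingRel i j with h | h | h
  · rw [if_pos h, if_neg (asymm_of WellOrderingRel h)]
    simp only [mul_add, sgn_add, add_zero, mul_comm e d]
    ring
  · exact absurd h hij
  · rw [if_pos h, if_neg (asymm_of WellOrderingRel h)]
    have := sgn_mul_self (d * e)
    simp only [mul_add, sgn_add, add_zero]
    linear_combination (-(sgn (d * S.parityBefore i s) * M (s i) (s i + v) *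
      sgn (e * S.parityBefore j s) * N (s j) (s j + w) *
      ψ (s + DFinsupp.single j w + DFinsupp.single i v))) * this

/-! ### Algebras of sets of sites, degrees and graded commutation -/

section Quasilocal

variable {I J : Set S.Site} {x y : S.Obs Set.univ}

/-- An element of `A_K`, given as an operator. -/
def mkObs {K : Set S.Site} (b : S.Fock →L[ℂ] S.Fock) (h : b ∈ S.algebra K) : S.Obs K := ⟨b, h⟩

lemma mkObs_val {K : Set S.Site} (b : S.Fock →L[ℂ] S.Fock) (h : b ∈ S.algebra K) :
    (mkObs b h).1 = b := rfl

lemma inAlgebra_iff {K : Set S.Site} (x : S.Obs K) : InAlgebra x I ↔ x.1 ∈ S.algebra I := Iff.rfl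

lemma InAlgebra.add {K : Set S.Site} {x y : S.Obs K} (hx : InAlgebra x I) (hy : InAlgebra y I) :
    InAlgebra (x + y) I := (S.algebra I).add_mem hx hy

lemma InAlgebra.mul {K : Set S.Site} {x y : S.Obs K} (hx : InAlgebra x I) (hy : InAlgebra y I) :
    InAlgebra (x * y) I := (S.algebra I).mul_mem hx hy

lemma InAlgebra.smul {K : Set S.Site} {x : S.Obs K} (c : ℂ) (hx : InAlgebra x I) :
    InAlgebra (c • x) I := (S.algebra I).smul_mem hx c

lemma InAlgebra.star {K : Set S.Site} {x : S.Obs K} (hx : InAlgebra x I) :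
    InAlgebra (star x) I := star_mem (s := S.algebra I) hx

lemma InAlgebra.one {K : Set S.Site} : InAlgebra (1 : S.Obs K) I := one_mem (S.algebra I)

lemma InAlgebra.mono {K : Set S.Site} {x : S.Obs K} (h : I ⊆ J) (hx : InAlgebra x I) :
    InAlgebra x J := S.algebra_mono h hx

lemma InAlgebra.grading {K : Set S.Site} {x : S.Obs K} (hx : InAlgebra x I) :
    InAlgebra (S.grading K x) I := by
  rw [inAlgebra_iff, grading_val_eq_conj]
  exact S.parityOp_conj_mem I hx

lemma isClosed_inAlgebra (K I : Set S.Site) : IsClosed {x : S.Obs K | InAlgebra x I} :=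
  (StarSubalgebra.isClosed_topologicalClosure _).preimage obs_isometry_val.continuous

lemma inAlgebra_univ (x : S.Obs Set.univ) : InAlgebra x Set.univ := x.2

lemma site_mem {j : S.Site} (hj : j ∈ I) (M : S.OnSite j) : InAlgebra (S.site j M) I :=
  S.onSite_mem hj M

lemma site_add (j : S.Site) (M N : S.OnSite j) : S.site j (M + N) = S.site j M + S.site j N :=
  obs_ext (onSite_add j M N)

lemma site_smul (j : S.Site) (c : ℂ) (M : S.OnSite j) : S.site j (c • M) = c • S.site j M :=
  obs_ext (onSite_smul j c M)

lemma site_mul (j : S.Site) (M N : S.OnSite j) : S.site j (M * N) = S.site j M * S.site j N :=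
  obs_ext (onSite_mul j M N)

lemma site_one (j : S.Site) : S.site j 1 = 1 := obs_ext (onSite_one j)

lemma site_star (j : S.Site) (M : S.OnSite j) : star (S.site j M) = S.site j M.conjTranspose :=
  obs_ext (star_onSite j M)

/-- On-site operators as a linear map. -/
def siteLin (j : S.Site) : S.OnSite j →ₗ[ℂ] S.Obs Set.univ where
  toFun := S.site j
  map_add' := site_add j
  map_smul' := site_smul j

lemma site_sum (j : S.Site) {ι : Type*} (s : Finset ι) (M : ι → S.OnSite j) :
    S.site j (∑ i ∈ s, M i) = ∑ i ∈ s, S.site j (M i) := map_sum (siteLin j) M s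

lemma site_zero (j : S.Site) : S.site j 0 = 0 := map_zero (siteLin j)

lemma grading_site (j : S.Site) (M : S.OnSite j) :
    S.grading Set.univ (S.site j M) =
      S.site j (Matrix.of fun a b => sgn (S.parity j (b - a)) * M a b) :=
  obs_ext ((grading_val _).trans (S.parityOp_conj_onSite j M))

lemma grading_grading {K : Set S.Site} (x : S.Obs K) : S.grading K (S.grading K x) = x := by
  refine obs_ext ?_
  have h := S.parityOp_mul_self
  rw [grading_val, grading_val, ← mul_assoc, ← mul_assoc, h, one_mul, mul_assoc, h, mul_one]

lemma norm_grading_le {K : Set S.Site} (x : S.Obs K) : ‖S.grading K x‖ ≤ ‖x‖ :=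
  NonUnitalStarAlgHom.norm_apply_le (S.grading K) x

lemma continuous_grading (K : Set S.Site) : Continuous (S.grading K) :=
  AddMonoidHomClass.continuous_of_bound (S.grading K) 1 fun x => by
    rw [one_mul]; exact norm_grading_le x

/-- Induction over the algebra of a set of sites: a closed linear property which is stable under left
multiplication by on-site operators. -/
theorem InAlgebra.induction {P : S.Obs Set.univ → Prop} (closed : IsClosed {x | P x}) (one : P 1)
    (add : ∀ x y, InAlgebra x I → InAlgebra y I → P x → P y → P (x + y))
    (smul : ∀ (c : ℂ) x, InAlgebra x I → P x → P (c • x))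
    (site_mul : ∀ j ∈ I, ∀ M x, InAlgebra x I → P x → P (S.site j M * x))
    {x : S.Obs Set.univ} (hx : InAlgebra x I) : P x := by
  set G : Set (S.Fock →L[ℂ] S.Fock) := {x | ∃ j ∈ I, ∃ M : S.OnSite j, x = S.onSite j M}
  have hGI : ∀ b ∈ Algebra.adjoin ℂ (G ∪ Star.star G), b ∈ S.algebra I :=
    fun b hb => StarSubalgebra.le_topologicalClosure (StarAlgebra.adjoin ℂ G) hb
  have hGu : ∀ b ∈ Algebra.adjoin ℂ (G ∪ Star.star G), b ∈ S.algebra Set.univ :=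
    fun b hb => S.algebra_mono (Set.subset_univ I) (hGI b hb)
  -- `P` is not assumed stable under products, so elements of the adjoined algebra are treated as
  -- left multipliers of an arbitrary `y` with `P y`; taking `y = 1` recovers the claim.
  have key : ∀ b (hb : b ∈ Algebra.adjoin ℂ (G ∪ Star.star G)), ∀ y : S.Obs Set.univ,
      InAlgebra y I → P y → P (mkObs b (hGu b hb) * y) := by
    intro b hb
    induction hb using Algebra.adjoin_induction with
    | mem b h =>
      intro y hyI hy
      rcases h with ⟨j, hj, M, rfl⟩ | ⟨j, hj, M, h⟩
      · exact site_mul j hj M y hyI hy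
      -- The adjoint of an on-site operator is on-site, so the starred generators need no separate
      -- hypothesis.
      · have hb : b = S.onSite j M.conjTranspose := by
          rw [← star_onSite, ← h, star_star]
        subst hb
        exact site_mul j hj _ y hyI hy
    | algebraMap r =>
      intro y hyI hy
      have : mkObs (algebraMap ℂ _ r) (hGu _ (Subalgebra.algebraMap_mem _ r)) * y = r • y :=
        obs_ext (Algebra.smul_def r y.1).symm
      rw [this]
      exact smul r y hyI hy
    | add b c hb hc ihb ihc =>
      intro y hyI hy
      have : mkObs (b + c) (hGu _ (add_mem hb hc)) * y =
        mkObs b (hGu b hb) * y + mkObs c (hGu c hc) * y := obs_ext (add_mul b c y.1)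
      rw [this]
      exact add _ _ (InAlgebra.mul (hGI b hb) hyI) (InAlgebra.mul (hGI c hc) hyI)
        (ihb y hyI hy) (ihc y hyI hy)
    | mul b c hb hc ihb ihc =>
      intro y hyI hy
      have : mkObs (b * c) (hGu _ (mul_mem hb hc)) * y =
        mkObs b (hGu b hb) * (mkObs c (hGu c hc) * y) := obs_ext (mul_assoc b c y.1)
      rw [this]
      exact ihb _ (InAlgebra.mul (hGI c hc) hyI) (ihc y hyI hy)
  have h1 : x ∈ closure {y : S.Obs Set.univ | y.1 ∈ StarAlgebra.adjoin ℂ G} := by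
    rw [obs_isometry_val.isEmbedding.isInducing.closure_eq_preimage_closure_image]
    have h2 : (fun y : S.Obs Set.univ => y.1) '' {y | y.1 ∈ StarAlgebra.adjoin ℂ G} =
        (StarAlgebra.adjoin ℂ G : Set (S.Fock →L[ℂ] S.Fock)) := by
      ext b
      exact ⟨fun ⟨y, hy, h⟩ => h ▸ hy, fun hb => ⟨mkObs b (hGu b hb), hb, rfl⟩⟩
    rw [h2]
    exact hx
  refine closed.closure_subset_iff.mpr (fun y hy => ?_) h1
  have := key y.1 hy 1 InAlgebra.one one
  rwa [mul_one] at this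

variable (S) in
/-- The `d`-th power of the grading automorphism. -/
def twist (d : ZMod 2) : S.Obs Set.univ →⋆ₐ[ℂ] S.Obs Set.univ :=
  if d = 0 then StarAlgHom.id ℂ _ else S.grading Set.univ

lemma twist_zero (x : S.Obs Set.univ) : S.twist 0 x = x := by simp [twist]

lemma twist_one (x : S.Obs Set.univ) : S.twist 1 x = S.grading Set.univ x := by simp [twist]

lemma zmod_two_cases (d : ZMod 2) : d = 0 ∨ d = 1 := by revert d; decide

lemma twist_add (d e : ZMod 2) (x : S.Obs Set.univ) :
    S.twist (d + e) x = S.twist d (S.twist e x) := by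
  rcases zmod_two_cases d with rfl | rfl <;> rcases zmod_two_cases e with rfl | rfl <;>
    simp [twist, grading_grading, show (1 + 1 : ZMod 2) = 0 from rfl]

lemma twist_twist (d : ZMod 2) (x : S.Obs Set.univ) : S.twist d (S.twist d x) = x := by
  rw [← twist_add, ZModModule.add_self, twist_zero]

lemma continuous_twist (d : ZMod 2) : Continuous (S.twist d) := by
  rcases zmod_two_cases d with rfl | rfl
  · rw [show (S.twist 0 : _ → _) = id from funext twist_zero]
    exact continuous_id
  · simpa only [funext twist_one] using continuous_grading _

lemma InAlgebra.twist (d : ZMod 2) (hx : InAlgebra x I) : InAlgebra (S.twist d x) I := by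
  rcases zmod_two_cases d with rfl | rfl
  · rwa [twist_zero]
  · rw [twist_one]; exact hx.grading

/-- `x` is homogeneous of degree `d`. -/
def HasDegree (x : S.Obs Set.univ) (d : ZMod 2) : Prop := S.grading Set.univ x = sgn d • x

lemma HasDegree.twist (e : ZMod 2) {d : ZMod 2} (h : HasDegree x d) :
    S.twist e x = sgn (d * e) • x := by
  rcases zmod_two_cases e with rfl | rfl
  · rw [twist_zero, mul_zero, sgn_zero, one_smul]
  · rw [twist_one, mul_one, h]

lemma HasDegree.mul {d e : ZMod 2} (hx : HasDegree x d) (hy : HasDegree y e) :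
    HasDegree (x * y) (d + e) := by
  rw [HasDegree, map_mul, hx, hy, smul_mul_smul_comm, sgn_add]

lemma HasDegree.star {d : ZMod 2} (hx : HasDegree x d) : HasDegree (star x) d := by
  rw [HasDegree, map_star, hx, star_smul, star_sgn]

lemma HasDegree.one : HasDegree (1 : S.Obs Set.univ) 0 := by
  rw [HasDegree, map_one, sgn_zero, one_smul]

lemma HasDegree.twist_of_even (e : ZMod 2) (h : HasDegree x 0) : S.twist e x = x := by
  rw [h.twist e, zero_mul, sgn_zero, one_smul]

lemma hasDegree_site {j : S.Site} {M : S.OnSite j} {d : ZMod 2}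
    (h : ∀ a b, M a b ≠ 0 → S.parity j (b - a) = d) : HasDegree (S.site j M) d := by
  rw [HasDegree, grading_site, ← site_smul]
  congr 1
  ext a b
  by_cases hab : M a b = 0
  · simp [hab]
  · rw [Matrix.of_apply, h a b hab]; rfl

/-- The part of degree `d` of an on-site operator. -/
def matPart (j : S.Site) (d : ZMod 2) (M : S.OnSite j) : S.OnSite j :=
  Matrix.of fun a b => if S.parity j (b - a) = d then M a b else 0

lemma matPart_spec {j : S.Site} {d : ZMod 2} {M : S.OnSite j} (a b : S.Label j)
    (h : matPart j d M a b ≠ 0) : S.parity j (b - a) = d := by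
  by_contra h'
  exact h (if_neg h')

lemma sum_matPart (j : S.Site) (M : S.OnSite j) : ∑ d, matPart j d M = M := by
  ext a b
  simp [Matrix.sum_apply, matPart]

lemma site_eq_sum (j : S.Site) (M : S.OnSite j) :
    S.site j M = ∑ d, S.site j (matPart j d M) := by
  rw [← site_sum, sum_matPart]

/-- Each on-site factor of `y` splits into homogeneous parts, for which the commutation sign is the
one produced by `twist d`; since `twist d` is a continuous homomorphism, the rule extends to all of
`A_J`. -/
lemma site_mul_eq_twist_mul {i : S.Site} (hi : i ∉ J) {M : S.OnSite i} {d : ZMod 2}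
    (hM : ∀ a b, M a b ≠ 0 → S.parity i (b - a) = d) (hy : InAlgebra y J) :
    S.site i M * y = S.twist d y * S.site i M := by
  refine InAlgebra.induction (P := fun y => S.site i M * y = S.twist d y * S.site i M)
    (isClosed_eq (by fun_prop) ((continuous_twist d).mul continuous_const)) ?_ ?_ ?_ ?_ hy
  · rw [map_one, one_mul, mul_one]
  · intro x y _ _ hx hy
    rw [mul_add, hx, hy, map_add, add_mul]
  · intro c x _ hx
    rw [mul_smul_comm, hx, map_smul, smul_mul_assoc]
  · intro j hj N x _ hx
    have hij : i ≠ j := fun h => hi (h ▸ hj)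
    have h1 : S.site i M * S.site j N = S.twist d (S.site j N) * S.site i M := by
      rw [site_eq_sum j N, Finset.mul_sum, map_sum, Finset.sum_mul]
      refine Finset.sum_congr rfl fun e _ => ?_
      rw [(hasDegree_site (matPart_spec (d := e) (M := N))).twist, smul_mul_assoc, mul_comm e]
      exact obs_ext (onSite_graded_comm hij M _ d e hM matPart_spec)
    rw [← mul_assoc, h1, mul_assoc, hx, ← mul_assoc, map_mul]

/-- A homogeneous element graded-commutes with the algebra of a disjoint set of sites. -/
theorem mul_eq_mul_twist (hIJ : Disjoint I J) (hx : InAlgebra x I) (hy : InAlgebra y J)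
    {e : ZMod 2} (he : HasDegree y e) : x * y = y * S.twist e x := by
  refine InAlgebra.induction (P := fun x => x * y = y * S.twist e x)
    (isClosed_eq (by fun_prop) (continuous_const.mul (continuous_twist e))) ?_ ?_ ?_ ?_ hx
  · rw [map_one, one_mul, mul_one]
  · intro x x' _ _ hx hx'
    rw [add_mul, hx, hx', map_add, mul_add]
  · intro c x _ hx
    rw [smul_mul_assoc, hx, map_smul, mul_smul_comm]
  · intro i hi M x _ hx
    have h1 : S.site i M * y = y * S.twist e (S.site i M) := by
      rw [site_eq_sum i M, Finset.sum_mul, map_sum, Finset.mul_sum]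
      refine Finset.sum_congr rfl fun d _ => ?_
      rw [site_mul_eq_twist_mul (hIJ.notMem_of_mem_left hi) matPart_spec hy,
        (hasDegree_site matPart_spec).twist, he.twist, smul_mul_assoc, mul_smul_comm, mul_comm e]
    rw [mul_assoc, hx, ← mul_assoc, h1, map_mul, mul_assoc]

theorem mul_eq_twist_mul (hIJ : Disjoint I J) (hx : InAlgebra x I) (hy : InAlgebra y J)
    {e : ZMod 2} (he : HasDegree y e) : y * x = S.twist e x * y := by
  rw [mul_eq_mul_twist hIJ (hx.twist e) hy he, twist_twist]

theorem commute_of_even (hIJ : Disjoint I J) (hx : InAlgebra x I) (hy : InAlgebra y J)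
    (he : HasDegree y 0) : x * y = y * x := by
  rw [mul_eq_mul_twist hIJ hx hy he, twist_zero]

/-- The part of degree `d` of an observable. -/
def part (d : ZMod 2) (x : S.Obs Set.univ) : S.Obs Set.univ :=
  (2⁻¹ : ℂ) • (x + sgn d • S.grading Set.univ x)

lemma hasDegree_part (d : ZMod 2) (x : S.Obs Set.univ) : HasDegree (part d x) d := by
  rw [HasDegree, part, map_smul, map_add, map_smul, grading_grading, smul_comm, smul_add (sgn d),
    smul_smul (sgn d), sgn_mul_self, one_smul, add_comm]

lemma part_add_part (x : S.Obs Set.univ) : part 0 x + part 1 x = x := by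
  rw [part, part, sgn_zero, sgn_one, ← smul_add, one_smul, neg_one_smul, add_add_add_comm,
    add_neg_cancel, add_zero, ← two_smul ℂ, smul_smul]
  norm_num

lemma InAlgebra.part (d : ZMod 2) (hx : InAlgebra x I) : InAlgebra (part d x) I :=
  (hx.add (hx.grading.smul _)).smul _

lemma norm_part_le (d : ZMod 2) (x : S.Obs Set.univ) : ‖part d x‖ ≤ ‖x‖ := by
  rw [SpinSystem.part, norm_smul]
  have h1 : ‖x + sgn d • S.grading Set.univ x‖ ≤ ‖x‖ + ‖x‖ := by
    refine (norm_add_le _ _).trans ?_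
    rw [norm_smul, norm_sgn, one_mul]
    gcongr
    exact norm_grading_le x
  have h2 : ‖(2⁻¹ : ℂ)‖ = 2⁻¹ := by norm_num
  rw [h2]
  linarith

end Quasilocal

/-! ### Cauchy–Schwarz estimates and supports of states -/

namespace State

variable {J : Set S.Site} (φ : S.State J)

lemma toPositive_apply (x : S.Obs J) : φ.toPositive x = φ x := rfl

lemma inner_toPreGNS (x y : S.Obs J) :
    inner ℂ (φ.toPositive.toPreGNS x) (φ.toPositive.toPreGNS y) = φ (star x * y) := rfl

lemma norm_toPreGNS_one : ‖φ.toPositive.toPreGNS 1‖ = 1 := by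
  have h := φ.toPositive.preGNS_norm_sq (φ.toPositive.toPreGNS 1)
  rw [PositiveLinearMap.ofPreGNS_toPreGNS, star_one, one_mul, toPositive_apply, φ.map_one] at h
  have h' : ‖φ.toPositive.toPreGNS 1‖ ^ 2 = 1 := by exact_mod_cast h
  exact (pow_eq_one_iff_of_nonneg (norm_nonneg _) two_ne_zero).mp h'

lemma norm_toPreGNS_le (x : S.Obs J) : ‖φ.toPositive.toPreGNS x‖ ≤ ‖x‖ := by
  have h : φ.toPositive.toPreGNS x =
      φ.toPositive.leftMulMapPreGNS x (φ.toPositive.toPreGNS 1) := by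
    rw [PositiveLinearMap.leftMulMapPreGNS_apply, PositiveLinearMap.ofPreGNS_toPreGNS, mul_one]
  rw [h]
  refine (ContinuousLinearMap.le_opNorm _ _).trans ?_
  rw [norm_toPreGNS_one, mul_one]
  exact LinearMap.mkContinuous_norm_le _ (norm_nonneg _) _

lemma norm_apply_le (x : S.Obs J) : ‖φ x‖ ≤ ‖x‖ := by
  have h := φ.inner_toPreGNS 1 x
  rw [star_one, one_mul] at h
  rw [← h]
  refine (norm_inner_le_norm _ _).trans ?_
  rw [norm_toPreGNS_one, one_mul]
  exact φ.norm_toPreGNS_le x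

/-- A state as a continuous linear functional. -/
def toCLM : S.Obs J →L[ℂ] ℂ := φ.toFun.mkContinuous 1 fun x => by
  rw [one_mul]; exact φ.norm_apply_le x

lemma continuous : Continuous φ.toFun := φ.toCLM.continuous

lemma apply_star (x : S.Obs J) : φ (star x) = star (φ x) := by
  have h := inner_conj_symm (𝕜 := ℂ) (φ.toPositive.toPreGNS x) (φ.toPositive.toPreGNS 1)
  rw [inner_toPreGNS, inner_toPreGNS, star_one, one_mul, mul_one] at h
  exact h.symm

/-- By Cauchy–Schwarz in the pre-GNS space, where `x` is a null vector. -/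
lemma apply_star_mul_eq_zero {x : S.Obs J} (hx : φ (star x * x) = 0) (y : S.Obs J) :
    φ (star x * y) = 0 := by
  have h : ‖φ.toPositive.toPreGNS x‖ = 0 := by
    have h := φ.toPositive.preGNS_norm_sq (φ.toPositive.toPreGNS x)
    rw [PositiveLinearMap.ofPreGNS_toPreGNS, toPositive_apply, hx] at h
    exact_mod_cast eq_zero_of_pow_eq_zero h
  have h' := norm_inner_le_norm (𝕜 := ℂ) (φ.toPositive.toPreGNS x) (φ.toPositive.toPreGNS y)
  rw [h, zero_mul, inner_toPreGNS] at h'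
  exact norm_le_zero_iff.mp h'

section Support

variable {p : S.Obs J} (hp : φ p = 1) (hstar : star p = p) (hmul : p * p = p)

include hp hstar hmul

/-- The projection `1 - p` has expectation zero, so it is a null vector and can be dropped. -/
lemma apply_support_mul (x : S.Obs J) : φ (p * x) = φ x := by
  have h0 : φ (star (1 - p) * (1 - p)) = 0 := by
    rw [star_sub, star_one, hstar, mul_sub, mul_one, sub_mul, one_mul, hmul, sub_self, sub_zero,
      map_sub, hp, φ.map_one, sub_self]
  have h := φ.apply_star_mul_eq_zero h0 x
  rw [star_sub, star_one, hstar, sub_mul, one_mul, map_sub, sub_eq_zero] at h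
  exact h.symm

lemma apply_mul_support (x : S.Obs J) : φ (x * p) = φ x := by
  have h := φ.apply_support_mul hp hstar hmul (star x)
  have h' : p * star x = star (x * p) := by rw [star_mul, hstar]
  rw [h', apply_star, apply_star] at h
  exact star_injective h

end Support

lemma apply_eq_zero_of_odd {φ : S.State Set.univ} {I : Set S.Site}
    (h : ∀ x, InAlgebra x I → φ (S.grading Set.univ x) = φ x) {x : S.Obs Set.univ}
    (hx : InAlgebra x I) (hd : HasDegree x 1) : φ x = 0 := by
  have h' := h x hx
  rw [hd, sgn_one, neg_one_smul, map_neg] at h'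
  exact self_eq_neg.mp h'.symm

end State

/-! ### Frames: matrix units for finite sets of sites -/

variable (S) in
/-- A system of isometries from a minimal projection `p` of `A_Y` onto the vectors of an orthonormal
basis; the operators `K a * star (K b)` are matrix units of `A_Y`. -/
structure Frame (Y : Set S.Site) where
  ι : Type
  [fintype : Fintype ι]
  [decidableEq : DecidableEq ι]
  [nonempty : Nonempty ι]
  K : ι → S.Obs Set.univ
  deg : ι → ZMod 2
  p : S.Obs Set.univ
  mem : ∀ a, InAlgebra (K a) Y
  hasDegree : ∀ a, HasDegree (K a) (deg a)
  star_K_mul : ∀ a b, star (K a) * K b = if a = b then p else 0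
  sum_mul_star : ∑ a, K a * star (K a) = 1
  site_mul_mem : ∀ j ∈ Y, ∀ (M : S.OnSite j) a, S.site j M * K a ∈ Submodule.span ℂ (Set.range K)

namespace Frame

attribute [instance] Frame.fintype Frame.decidableEq Frame.nonempty

section Derived

variable {Y : Set S.Site} (F : S.Frame Y)

lemma p_eq (a : F.ι) : F.p = star (F.K a) * F.K a := by rw [F.star_K_mul, if_pos rfl]

lemma K_mul_p (b : F.ι) : F.K b * F.p = F.K b := by
  have h : (∑ a, F.K a * star (F.K a)) * F.K b = F.K b * F.p := by
    rw [Finset.sum_mul, Finset.sum_eq_single b]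
    · rw [mul_assoc, ← F.p_eq]
    · intro a _ hab
      rw [mul_assoc, F.star_K_mul, if_neg hab, mul_zero]
    · simp
  rw [← h, F.sum_mul_star, one_mul]

lemma star_p : star F.p = F.p := by
  obtain ⟨a⟩ := F.nonempty
  rw [F.p_eq a, star_mul, star_star]

lemma p_mul_p : F.p * F.p = F.p := by
  obtain ⟨a⟩ := F.nonempty
  conv_lhs => rw [F.p_eq a, mul_assoc, ← F.p_eq a, F.K_mul_p, ← F.p_eq]

lemma p_mem : InAlgebra F.p Y := by
  obtain ⟨a⟩ := F.nonempty
  rw [F.p_eq a]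
  exact (F.mem a).star.mul (F.mem a)

lemma hasDegree_p : HasDegree F.p 0 := by
  obtain ⟨a⟩ := F.nonempty
  rw [F.p_eq a, ← ZModModule.add_self (F.deg a)]
  exact (F.hasDegree a).star.mul (F.hasDegree a)

/-- The span of the `K a` is finite-dimensional, hence closed; this is what lets stability under
on-site operators pass to the norm-closed algebra. -/
lemma mul_mem_span {y : S.Obs Set.univ} (hy : InAlgebra y Y) (a : F.ι) :
    y * F.K a ∈ Submodule.span ℂ (Set.range F.K) := by
  have hfin : FiniteDimensional ℂ (Submodule.span ℂ (Set.range F.K)) :=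
    FiniteDimensional.span_of_finite ℂ (Set.finite_range _)
  refine InAlgebra.induction (P := fun y => y * F.K a ∈ Submodule.span ℂ (Set.range F.K))
    ((Submodule.closed_of_finiteDimensional _).preimage (by fun_prop)) ?_ ?_ ?_ ?_ hy
  · rw [one_mul]
    exact Submodule.subset_span ⟨a, rfl⟩
  · intro x y _ _ hx hy
    rw [add_mul]
    exact add_mem hx hy
  · intro c x _ hx
    rw [smul_mul_assoc]
    exact Submodule.smul_mem _ c hx
  · intro j hj M x _ hx
    rw [mul_assoc]
    have h : Submodule.span ℂ (Set.range F.K) ≤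
        (Submodule.span ℂ (Set.range F.K)).comap (LinearMap.mulLeft ℂ (S.site j M)) := by
      rw [Submodule.span_le]
      rintro _ ⟨b, rfl⟩
      exact F.site_mul_mem j hj M b
    exact h hx

/-- The matrix of an element of `A_Y`. -/
lemma exists_matrix {y : S.Obs Set.univ} (hy : InAlgebra y Y) :
    ∃ m : F.ι → F.ι → ℂ, (∀ a b, star (F.K a) * y * F.K b = m a b • F.p) ∧
      y = ∑ a, ∑ b, m a b • (F.K a * star (F.K b)) := by
  choose m hm using fun b => (Submodule.mem_span_range_iff_exists_fun ℂ).mp (F.mul_mem_span hy b)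
  refine ⟨fun a b => m b a, fun a b => ?_, ?_⟩
  · rw [mul_assoc, ← hm, Finset.mul_sum, Finset.sum_eq_single a]
    · rw [mul_smul_comm, ← F.p_eq]
    · intro c _ hc
      rw [mul_smul_comm, F.star_K_mul, if_neg hc.symm, smul_zero]
    · simp
  · conv_lhs => rw [← mul_one y, ← F.sum_mul_star, Finset.mul_sum]
    rw [Finset.sum_comm]
    refine Finset.sum_congr rfl fun b _ => ?_
    rw [← mul_assoc, ← hm, Finset.sum_mul]
    exact Finset.sum_congr rfl fun a _ => smul_mul_assoc _ _ _

/-- This is the minimality of `p`. Since `p = K a* K a`, the compression of `y` to `p` is the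
diagonal matrix entry of `K a y K a*`, an element of `A_Y`. -/
lemma exists_p_mul_p {y : S.Obs Set.univ} (hy : InAlgebra y Y) :
    ∃ c : ℂ, F.p * y * F.p = c • F.p := by
  obtain ⟨a⟩ := F.nonempty
  obtain ⟨m, hm, -⟩ := F.exists_matrix (((F.mem a).mul hy).mul (F.mem a).star)
  refine ⟨m a a, ?_⟩
  rw [← hm a a]
  conv_lhs => rw [F.p_eq a]
  simp only [mul_assoc]

/-- A state with `φ p = 1` is given on `A_Y` by the compression to `p`. -/
lemma p_mul_mul_p {φ : S.State Set.univ} (hφ : φ F.p = 1) {y : S.Obs Set.univ}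
    (hy : InAlgebra y Y) : F.p * y * F.p = φ y • F.p := by
  obtain ⟨c, hc⟩ := F.exists_p_mul_p hy
  have h : φ (F.p * y * F.p) = φ y := by
    rw [φ.apply_mul_support hφ F.star_p F.p_mul_p, φ.apply_support_mul hφ F.star_p F.p_mul_p]
  rw [hc, map_smul, hφ, smul_eq_mul, mul_one] at h
  rw [hc, h]

end Derived

section Construction

/-- The frame of the empty set of sites. -/
def empty : S.Frame ∅ where
  ι := Unit
  K _ := 1
  deg _ := 0
  p := 1
  mem _ := InAlgebra.one
  hasDegree _ := HasDegree.one
  star_K_mul _ _ := by simp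
  sum_mul_star := by simp
  site_mul_mem j hj := absurd hj (Set.notMem_empty j)

/-- The rank one operator `|l⟩⟨v|`. -/
def ketBra (j : S.Site) (l : S.Label j) (v : S.Label j → ℂ) : S.OnSite j :=
  Matrix.vecMulVec (Pi.single l 1) (star v)

/-- Evenness of `v` makes the rank one operator homogeneous, with degree read off from the label `l`
alone. It keeps the frame homogeneous when a site is added. -/
lemma ketBra_degree {j : S.Site} {v : S.Label j → ℂ} (hv : ∀ a, S.parity j a ≠ 0 → v a = 0)
    (l a b : S.Label j) (h : ketBra j l v a b ≠ 0) : S.parity j (b - a) = S.parity j l := by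
  rw [ketBra, Matrix.vecMulVec_apply] at h
  have ha : a = l := by
    by_contra h'
    exact h (by rw [Pi.single_eq_of_ne h', zero_mul])
  have hb : S.parity j b = 0 := by
    by_contra h'
    exact h (by rw [Pi.star_apply, hv b h', star_zero, mul_zero])
  rw [map_sub, hb, ha, zero_sub, ZMod.neg_eq_self_mod_two]

lemma dotProduct_star_self {j : S.Site} {v : S.Label j → ℂ} (hv : ∑ a, ‖v a‖ ^ 2 = 1) :
    star v ⬝ᵥ v = 1 := by
  have h : ∀ a, star v a * v a = ((‖v a‖ ^ 2 : ℝ) : ℂ) := fun a => by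
    rw [Pi.star_apply, RCLike.star_def, ← Complex.normSq_eq_conj_mul_self,
      Complex.normSq_eq_norm_sq]
  rw [dotProduct, Finset.sum_congr rfl fun a _ => h a, ← Complex.ofReal_sum, hv, Complex.ofReal_one]

lemma conjTranspose_ketBra_mul {j : S.Site} (v : S.Label j → ℂ) (l m : S.Label j) :
    (ketBra j l v).conjTranspose * ketBra j m v =
      if l = m then Matrix.vecMulVec v (star v) else 0 := by
  rw [ketBra, ketBra, Matrix.conjTranspose_vecMulVec, Matrix.vecMulVec_mul_vecMulVec, star_star]
  split_ifs with h
  · subst h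
    simp
  · have : star (Pi.single l 1 : S.Label j → ℂ) ⬝ᵥ Pi.single m 1 = 0 := by
      simp [dotProduct_single, Pi.single_eq_of_ne (Ne.symm h)]
    rw [this]
    simp

lemma sum_ketBra {j : S.Site} {v : S.Label j → ℂ} (hv : ∑ a, ‖v a‖ ^ 2 = 1) :
    ∑ l, ketBra j l v * (ketBra j l v).conjTranspose = 1 := by
  ext a b
  simp only [ketBra, Matrix.conjTranspose_vecMulVec, Matrix.vecMulVec_mul_vecMulVec, star_star,
    dotProduct_star_self hv, one_smul, Matrix.sum_apply, Matrix.vecMulVec_apply, Pi.star_apply]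
  rw [Finset.sum_eq_single a]
  · by_cases h : a = b
    · subst h; simp
    · rw [Matrix.one_apply_ne h, Pi.single_eq_of_ne (Ne.symm h)]; simp
  · intro c _ hc
    rw [Pi.single_eq_of_ne hc.symm, zero_mul]
  · simp

lemma mul_ketBra {j : S.Site} (v : S.Label j → ℂ) (M : S.OnSite j) (l : S.Label j) :
    M * ketBra j l v = ∑ a, M a l • ketBra j a v := by
  ext x y
  simp only [ketBra, Matrix.mul_apply, Matrix.sum_apply, Matrix.smul_apply, Matrix.vecMulVec_apply,
    smul_eq_mul]
  rw [Finset.sum_eq_single l, Finset.sum_eq_single x]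
  · simp
  · intro c _ hc
    rw [Pi.single_eq_of_ne hc.symm]; simp
  · simp
  · intro c _ hc
    rw [Pi.single_eq_of_ne hc]; simp
  · simp

lemma twist_site (d : ZMod 2) (j : S.Site) (M : S.OnSite j) :
    ∃ N : S.OnSite j, S.twist d (S.site j M) = S.site j N := by
  rcases zmod_two_cases d with rfl | rfl
  · exact ⟨M, twist_zero _⟩
  · exact ⟨_, (twist_one _).trans (grading_site j M)⟩

/-- The frame obtained by adding a site with an even unit vector. -/
def insert {Y : Set S.Site} (F : S.Frame Y) {j : S.Site} (hj : j ∉ Y) (v : S.Label j → ℂ)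
    (hv : ∑ a, ‖v a‖ ^ 2 = 1) (hv' : ∀ a, S.parity j a ≠ 0 → v a = 0) : S.Frame (insert j Y) where
  ι := S.Label j × F.ι
  K la := S.site j (ketBra j la.1 v) * F.K la.2
  deg la := S.parity j la.1 + F.deg la.2
  p := S.site j (Matrix.vecMulVec v (star v)) * F.p
  mem la := (site_mem (Set.mem_insert j Y) _).mul ((F.mem _).mono (Set.subset_insert j Y))
  hasDegree la := (hasDegree_site (ketBra_degree hv' la.1)).mul (F.hasDegree la.2)
  star_K_mul := by
    rintro ⟨l, a⟩ ⟨m, b⟩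
    have h1 : star (S.site j (ketBra j l v) * F.K a) * (S.site j (ketBra j m v) * F.K b) =
        star (F.K a) * (S.site j ((ketBra j l v).conjTranspose * ketBra j m v) * F.K b) := by
      rw [star_mul, site_star, site_mul]
      simp only [mul_assoc]
    have heven : HasDegree (S.site j (Matrix.vecMulVec v (star v))) 0 := by
      refine hasDegree_site fun a b hab => ?_
      have ha : S.parity j a = 0 := by
        by_contra h
        exact hab (by rw [Matrix.vecMulVec_apply, hv' a h, zero_mul])
      have hb : S.parity j b = 0 := by
        by_contra h
        exact hab (by rw [Matrix.vecMulVec_apply, Pi.star_apply, hv' b h, star_zero, mul_zero])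
      rw [map_sub, ha, hb, sub_zero]
    rw [h1, conjTranspose_ketBra_mul]
    by_cases hlm : l = m
    -- The projection at `j` is even, so it moves past `K a*` without a sign and the two
    -- orthogonality relations separate.
    · rw [if_pos hlm, ← mul_assoc, commute_of_even (I := Y) (J := {j}) (Set.disjoint_singleton_right.mpr hj)
        (F.mem a).star (site_mem (Set.mem_singleton _) _) heven, mul_assoc, F.star_K_mul]
      by_cases hab : a = b
      · rw [if_pos hab, if_pos (by rw [hlm, hab])]
      · rw [if_neg hab, if_neg fun h => hab (Prod.ext_iff.mp h).2, mul_zero]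
    · rw [if_neg hlm, if_neg fun h => hlm (Prod.ext_iff.mp h).1, site_zero, zero_mul, mul_zero]
  sum_mul_star := by
    have h1 : ∀ (l : S.Label j) (a : F.ι), S.site j (ketBra j l v) * F.K a *
        star (S.site j (ketBra j l v) * F.K a) =
        S.site j (ketBra j l v) * (F.K a * star (F.K a)) *
          S.site j (ketBra j l v).conjTranspose := by
      intro l a
      rw [star_mul, site_star]
      simp only [mul_assoc]
    rw [Fintype.sum_prod_type]
    simp only [h1, ← Finset.mul_sum, ← Finset.sum_mul, F.sum_mul_star, mul_one, ← site_mul,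
      ← site_sum, sum_ketBra hv, site_one]
  site_mul_mem := by
    rintro i hi M ⟨l, a⟩
    by_cases hij : i = j
    · subst hij
      rw [← mul_assoc, ← site_mul, mul_ketBra, site_sum, Finset.sum_mul]
      refine Submodule.sum_mem _ fun b _ => ?_
      rw [site_smul, smul_mul_assoc]
      exact Submodule.smul_mem _ _ (Submodule.subset_span ⟨(b, a), rfl⟩)
    · have hi' : i ∈ Y := hi.resolve_left hij
      -- Moving `M` past the homogeneous operator at `j` replaces it by its twist, which is again an
      -- on-site operator at `i`, so the span of the old frame absorbs it.
      obtain ⟨N, hN⟩ := twist_site (S.parity j l) i M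
      have h1 : S.site i M * S.site j (ketBra j l v) = S.site j (ketBra j l v) * S.site i N := by
        rw [mul_eq_mul_twist (I := {i}) (J := {j}) (Set.disjoint_singleton.mpr hij)
          (site_mem (Set.mem_singleton _) _) (site_mem (Set.mem_singleton _) _) (hasDegree_site (ketBra_degree hv' l)), hN]
      rw [← mul_assoc, h1, mul_assoc]
      have h : Submodule.span ℂ (Set.range F.K) ≤
          (Submodule.span ℂ (Set.range fun la : S.Label j × F.ι =>
            S.site j (ketBra j la.1 v) * F.K la.2)).comap
              (LinearMap.mulLeft ℂ (S.site j (ketBra j l v))) := by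
        rw [Submodule.span_le]
        rintro _ ⟨b, rfl⟩
        exact Submodule.subset_span ⟨(l, b), rfl⟩
      exact h (F.site_mul_mem i hi' N a)

/-- Every finite set of sites has a frame whose minimal projection is the product of given
even rank one projections. -/
theorem exists_frame (v : ∀ j : S.Site, S.Label j → ℂ) (hv : ∀ j, ∑ a, ‖v j a‖ ^ 2 = 1)
    (hv' : ∀ j a, S.parity j a ≠ 0 → v j a = 0) (Y : Finset S.Site) :
    ∃ F : S.Frame (Y : Set S.Site), ∀ φ : S.State Set.univ,
      (∀ j, φ (S.site j (Matrix.vecMulVec (v j) (star (v j)))) = 1) → φ F.p = 1 := by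
  induction Y using Finset.induction_on with
  | empty =>
    rw [Finset.coe_empty]
    exact ⟨empty, fun φ _ => φ.map_one⟩
  | insert j Y hj ih =>
    obtain ⟨F, hF⟩ := ih
    rw [Finset.coe_insert]
    refine ⟨F.insert (by simpa using hj) (v j) (hv j) (hv' j), fun φ hφ => ?_⟩
    refine (φ.apply_support_mul (hφ j) ?_ ?_ _).trans (hF φ hφ)
    · rw [site_star, Matrix.conjTranspose_vecMulVec, star_star]
    · rw [← site_mul, Matrix.vecMulVec_mul_vecMulVec, dotProduct_star_self (hv j), one_smul]

/-- Every finite set of sites has a frame. -/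
theorem nonempty_frame (Y : Finset S.Site) : Nonempty (S.Frame (Y : Set S.Site)) := by
  obtain ⟨F, -⟩ := exists_frame (S := S) (fun j => Pi.single 0 1)
    (fun j => by
      rw [Finset.sum_eq_single 0]
      · simp
      · intro a _ ha
        simp [Pi.single_eq_of_ne ha]
      · simp)
    (fun j a ha => Pi.single_eq_of_ne (fun h => ha (by rw [h, map_zero])) 1) Y
  exact ⟨F⟩

end Construction

end Frame

/-! ### Dense subspaces: products and local observables -/

section Products

variable {I J : Set S.Site}

/-- Products of elements of `A_I` and `A_J` span a dense subspace of `A_{I ∪ J}`. -/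
theorem mem_closure_span_products {z : S.Obs Set.univ} (hIJ : Disjoint I J)
    (hz : InAlgebra z (I ∪ J)) :
    z ∈ (Submodule.span ℂ {z | ∃ x y : S.Obs Set.univ,
      InAlgebra x I ∧ InAlgebra y J ∧ x * y = z}).topologicalClosure := by
  set T := Submodule.span ℂ {z | ∃ x y : S.Obs Set.univ,
    InAlgebra x I ∧ InAlgebra y J ∧ x * y = z} with hT
  refine InAlgebra.induction (P := fun z => z ∈ T.topologicalClosure)
    T.isClosed_topologicalClosure ?_ (fun x y _ _ => add_mem)
    (fun c x _ => Submodule.smul_mem _ c) ?_ hz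
  · exact T.le_topologicalClosure
      (Submodule.subset_span ⟨1, 1, InAlgebra.one, InAlgebra.one, mul_one 1⟩)
  · intro j hj M z _ hz
    have hle : T ≤ T.comap (LinearMap.mulLeft ℂ (S.site j M)) := by
      rw [hT, Submodule.span_le]
      rintro _ ⟨x, y, hx, hy, rfl⟩
      rw [SetLike.mem_coe, Submodule.mem_comap, LinearMap.mulLeft_apply]
      rcases hj with hj | hj
      · exact Submodule.subset_span ⟨S.site j M * x, y, (site_mem hj M).mul hx, hy, mul_assoc _ _ _⟩
      -- An on-site operator of `J` has to be moved past `x` to restore the order of the factors;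
      -- this is possible for each homogeneous part at the price of twisting `x`.
      · rw [site_eq_sum j M, Finset.sum_mul]
        refine Submodule.sum_mem _ fun d _ => Submodule.subset_span
          ⟨S.twist d x, S.site j (matPart j d M) * y, hx.twist d, (site_mem hj _).mul hy, ?_⟩
        rw [← mul_assoc, ← mul_assoc,
          site_mul_eq_twist_mul (hIJ.notMem_of_mem_right hj) matPart_spec hx]
    have hle' : T.topologicalClosure ≤
        T.topologicalClosure.comap (LinearMap.mulLeft ℂ (S.site j M)) := by
      refine Submodule.topologicalClosure_minimal _
        (hle.trans (Submodule.comap_mono T.le_topologicalClosure)) ?_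
      exact T.isClosed_topologicalClosure.preimage
        (by exact continuous_const.mul continuous_id : Continuous fun x => S.site j M * x)
    exact hle' hz

/-- Used for identities between continuous linear expressions, which need not be compatible with
left multiplication by on-site operators. -/
theorem InAlgebra.mul_induction {P : S.Obs Set.univ → Prop} (hIJ : Disjoint I J)
    (closed : IsClosed {x | P x}) (add : ∀ x y, P x → P y → P (x + y))
    (smul : ∀ (c : ℂ) x, P x → P (c • x))
    (mul : ∀ x y, InAlgebra x I → InAlgebra y J → P (x * y))
    {z : S.Obs Set.univ} (hz : InAlgebra z (I ∪ J)) : P z := by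
  have zero : P 0 := by
    have := smul 0 _ (mul 1 1 InAlgebra.one InAlgebra.one)
    rwa [zero_smul] at this
  let Q : Submodule ℂ (S.Obs Set.univ) :=
    { carrier := {x | P x}
      add_mem' := fun {a b} ha hb => add a b ha hb
      zero_mem' := zero
      smul_mem' := fun c x hx => smul c x hx }
  have hle : Submodule.span ℂ {z | ∃ x y : S.Obs Set.univ,
      InAlgebra x I ∧ InAlgebra y J ∧ x * y = z} ≤ Q := by
    rw [Submodule.span_le]
    rintro _ ⟨x, y, hx, hy, rfl⟩
    exact mul x y hx hy
  exact Submodule.topologicalClosure_minimal _ hle closed (mem_closure_span_products hIJ hz)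

end Products

/-- The observables of finite subsets of `J` are dense in `A_J`. -/
theorem mem_closure_local {J : Set S.Site} {x : S.Obs Set.univ} (hx : InAlgebra x J) :
    x ∈ closure {y : S.Obs Set.univ | ∃ Y : Finset S.Site, (Y : Set S.Site) ⊆ J ∧
      InAlgebra y (Y : Set S.Site)} := by
  classical
  refine InAlgebra.induction (P := fun x => x ∈ closure _) isClosed_closure ?_ ?_ ?_ ?_ hx
  · exact subset_closure ⟨∅, by simp, InAlgebra.one⟩
  · intro x y _ _ hx hy
    refine map_mem_closure₂ continuous_add hx hy ?_
    rintro a ⟨Y, hY, ha⟩ b ⟨Z, hZ, hb⟩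
    refine ⟨Y ∪ Z, by rw [Finset.coe_union]; exact Set.union_subset hY hZ, ?_⟩
    exact (ha.mono (by simp)).add (hb.mono (by simp))
  · intro c x _ hx
    refine map_mem_closure (continuous_const_smul c) hx ?_
    rintro a ⟨Y, hY, ha⟩
    exact ⟨Y, hY, ha.smul c⟩
  · intro j hj M x _ hx
    refine map_mem_closure (f := fun x => S.site j M * x) (by fun_prop) hx ?_
    rintro a ⟨Y, hY, ha⟩
    refine ⟨insert j Y, ?_, (site_mem (by simp) M).mul (ha.mono (by simp))⟩
    rw [Finset.coe_insert]
    exact Set.insert_subset hj hY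

theorem InAlgebra.local_induction {J : Set S.Site} {P : S.Obs Set.univ → Prop}
    (closed : IsClosed {x | P x})
    (loc : ∀ (Y : Finset S.Site) y, (Y : Set S.Site) ⊆ J → InAlgebra y (Y : Set S.Site) → P y)
    {x : S.Obs Set.univ} (hx : InAlgebra x J) : P x :=
  closed.closure_subset_iff.mpr (fun y hy => by
    obtain ⟨Y, hY, hy⟩ := hy
    exact loc Y y hY hy) (mem_closure_local hx)

/-! ### Slice maps -/

namespace Frame

variable {Y : Set S.Site} (F : S.Frame Y) (ψ : S.State Set.univ)

/-- The slice map of a state which is graded on `A_Y`. -/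
def slice : S.Obs Set.univ →ₗ[ℂ] S.Obs Set.univ :=
  ∑ a, ∑ b, ∑ c, ψ (F.K a * star (F.K b)) •
    ((S.twist (F.deg a + F.deg c) : S.Obs Set.univ →ₐ[ℂ] S.Obs Set.univ).toLinearMap ∘ₗ
      LinearMap.mulLeft ℂ (F.K c * star (F.K a)) ∘ₗ
        LinearMap.mulRight ℂ (F.K b * star (F.K c)))

lemma slice_apply (z : S.Obs Set.univ) : F.slice ψ z = ∑ a, ∑ b, ∑ c,
    ψ (F.K a * star (F.K b)) • S.twist (F.deg a + F.deg c)
      (F.K c * star (F.K a) * (z * (F.K b * star (F.K c)))) := by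
  simp only [slice, LinearMap.sum_apply]
  rfl

lemma twist_K_mul_p_mul_star (d : ZMod 2) (c : F.ι) :
    S.twist d (F.K c * F.p * star (F.K c)) = F.K c * star (F.K c) := by
  rw [F.K_mul_p]
  refine HasDegree.twist_of_even d ?_
  have h := (F.hasDegree c).mul (F.hasDegree c).star
  rwa [ZModModule.add_self] at h

lemma sum_apply_matrix {y : S.Obs Set.univ} {m : F.ι → F.ι → ℂ}
    (hy : y = ∑ a, ∑ b, m a b • (F.K a * star (F.K b))) :
    ∑ a, ∑ b, ψ (F.K a * star (F.K b)) * m a b = ψ y := by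
  conv_rhs => rw [hy]
  simp only [map_sum, map_smul, smul_eq_mul]
  exact Finset.sum_congr rfl fun a _ => Finset.sum_congr rfl fun b _ => mul_comm _ _

/-- Moving `x` to the left past `K c K a*` twists it by `deg a + deg c`, and the outer twist in the
slice map undoes this. What remains is `K a* y K b = m a b • p`; the sum over `c` gives `1`, and the
sum over `a`, `b` reassembles `ψ y`. Gradedness of `ψ` plays no role on this side. -/
lemma slice_mul {I : Set S.Site} (hIY : Disjoint I Y) {x y : S.Obs Set.univ} (hx : InAlgebra x I)
    (hy : InAlgebra y Y) : F.slice ψ (x * y) = ψ y • x := by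
  obtain ⟨m, hm, hm'⟩ := F.exists_matrix hy
  rw [slice_apply, ← F.sum_apply_matrix ψ hm', Finset.sum_smul]
  refine Finset.sum_congr rfl fun a _ => ?_
  rw [Finset.sum_smul]
  refine Finset.sum_congr rfl fun b _ => ?_
  have h : ∀ c, S.twist (F.deg a + F.deg c)
      (F.K c * star (F.K a) * (x * y * (F.K b * star (F.K c)))) =
      m a b • (x * (F.K c * star (F.K c))) := by
    intro c
    have hdeg := (F.hasDegree c).mul (F.hasDegree a).star
    rw [add_comm] at hdeg
    have h1 : F.K c * star (F.K a) * (x * y * (F.K b * star (F.K c))) =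
        m a b • (S.twist (F.deg a + F.deg c) x * (F.K c * F.p * star (F.K c))) := by
      calc _ = F.K c * star (F.K a) * x * (y * (F.K b * star (F.K c))) := by
            simp only [mul_assoc]
        _ = S.twist (F.deg a + F.deg c) x *
            (F.K c * (star (F.K a) * y * F.K b) * star (F.K c)) := by
            rw [mul_eq_twist_mul hIY hx ((F.mem c).mul (F.mem a).star) hdeg]
            simp only [mul_assoc]
        _ = _ := by rw [hm, mul_smul_comm, smul_mul_assoc, mul_smul_comm]
    rw [h1, map_smul, map_mul, twist_twist, twist_K_mul_p_mul_star]
  simp only [h]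
  rw [← Finset.smul_sum, ← Finset.smul_sum, ← Finset.mul_sum, F.sum_mul_star, mul_one, smul_smul]

section Graded

variable {ψ} (hψ : ∀ y, InAlgebra y Y → ψ (S.grading Set.univ y) = ψ y)

include hψ

lemma apply_matrixUnit_eq_zero {a b : F.ι} (hab : F.deg a ≠ F.deg b) :
    ψ (F.K a * star (F.K b)) = 0 := by
  refine State.apply_eq_zero_of_odd hψ ((F.mem a).mul (F.mem b).star) ?_
  have h := (F.hasDegree a).mul (F.hasDegree b).star
  have h1 : F.deg a + F.deg b = 1 := by
    revert hab
    generalize F.deg a = d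
    generalize F.deg b = e
    revert d e
    decide
  rwa [h1] at h

/-- Here `x` moves to the right past `K b K c*`, so the twist is by `deg b + deg c`. It agrees with
the outer twist only for `deg a = deg b`; the other terms vanish because `ψ` is graded on `A_Y`. -/
lemma slice_mul' {I : Set S.Site} (hIY : Disjoint I Y) {x y : S.Obs Set.univ} (hx : InAlgebra x I)
    (hy : InAlgebra y Y) : F.slice ψ (y * x) = ψ y • x := by
  obtain ⟨m, hm, hm'⟩ := F.exists_matrix hy
  rw [slice_apply, ← F.sum_apply_matrix ψ hm', Finset.sum_smul]
  refine Finset.sum_congr rfl fun a _ => ?_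
  rw [Finset.sum_smul]
  refine Finset.sum_congr rfl fun b _ => ?_
  by_cases hab : F.deg a = F.deg b
  · have h : ∀ c, S.twist (F.deg a + F.deg c)
        (F.K c * star (F.K a) * (y * x * (F.K b * star (F.K c)))) =
        m a b • ((F.K c * star (F.K c)) * x) := by
      intro c
      have hdeg := (F.hasDegree b).mul (F.hasDegree c).star
      rw [← hab] at hdeg
      have h1 : F.K c * star (F.K a) * (y * x * (F.K b * star (F.K c))) =
          m a b • ((F.K c * F.p * star (F.K c)) * S.twist (F.deg a + F.deg c) x) := by
        calc _ = F.K c * star (F.K a) * y * (x * (F.K b * star (F.K c))) := by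
              simp only [mul_assoc]
          _ = (F.K c * (star (F.K a) * y * F.K b) * star (F.K c)) *
              S.twist (F.deg a + F.deg c) x := by
              rw [mul_eq_mul_twist hIY hx ((F.mem b).mul (F.mem c).star) hdeg]
              simp only [mul_assoc]
          _ = _ := by rw [hm, mul_smul_comm, smul_mul_assoc, smul_mul_assoc]
      rw [h1, map_smul, map_mul, twist_twist, twist_K_mul_p_mul_star]
    simp only [h]
    rw [← Finset.smul_sum, ← Finset.smul_sum, ← Finset.sum_mul, F.sum_mul_star, one_mul, smul_smul]
  · simp [F.apply_matrixUnit_eq_zero hψ hab]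

-- The numbers `ψ (K a K b*)` form a Gram matrix, hence equal `B* B` for some matrix `B`, and the
-- slice becomes a sum of terms `star X * X` with `X = ∑ b, B i b • u c b`. The twists of the two
-- factors `u c a` and `u c b` fit together only for `deg a = deg b`, which is again where the
-- gradedness of `ψ` enters.
open scoped MatrixOrder in
lemma slice_star_mul_self_nonneg (w : S.Obs Set.univ) : 0 ≤ F.slice ψ (star w * w) := by
  set G : Matrix F.ι F.ι ℂ :=
    Matrix.gram ℂ fun a => ψ.toPositive.toPreGNS (star (F.K a)) with hG
  have hGapp : ∀ a b, G a b = ψ (F.K a * star (F.K b)) := fun a b => by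
    rw [hG, Matrix.gram_apply, State.inner_toPreGNS, star_star]
  obtain ⟨B, hB⟩ := CStarAlgebra.nonneg_iff_eq_star_mul_self.mp
    (Matrix.posSemidef_gram ℂ fun a => ψ.toPositive.toPreGNS (star (F.K a))).nonneg
  have hGB : ∀ a b, ψ (F.K a * star (F.K b)) = ∑ i, star (B i a) * B i b := fun a b => by
    rw [← hGapp, hG, hB, Matrix.star_eq_conjTranspose, Matrix.mul_apply]
    rfl
  set u : F.ι → F.ι → S.Obs Set.univ := fun c b =>
    S.twist (F.deg b + F.deg c) (w * (F.K b * star (F.K c))) with hu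
  have key : F.slice ψ (star w * w) =
      ∑ c, ∑ i, star (∑ a, B i a • u c a) * ∑ b, B i b • u c b := by
    have h1 : ∀ c i, star (∑ a, B i a • u c a) * ∑ b, B i b • u c b =
        ∑ a, ∑ b, (star (B i a) * B i b) • (star (u c a) * u c b) := by
      intro c i
      rw [star_sum, Finset.sum_mul]
      refine Finset.sum_congr rfl fun a _ => ?_
      rw [Finset.mul_sum]
      refine Finset.sum_congr rfl fun b _ => ?_
      rw [star_smul, smul_mul_smul_comm]
    have h2 : ∀ c, ∑ i, star (∑ a, B i a • u c a) * ∑ b, B i b • u c b =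
        ∑ a, ∑ b, ψ (F.K a * star (F.K b)) • (star (u c a) * u c b) := by
      intro c
      simp only [h1]
      rw [Finset.sum_comm]
      refine Finset.sum_congr rfl fun a _ => ?_
      rw [Finset.sum_comm]
      refine Finset.sum_congr rfl fun b _ => ?_
      rw [hGB, Finset.sum_smul]
    simp only [h2]
    rw [slice_apply, Finset.sum_comm' (t' := Finset.univ) (s' := fun _ => Finset.univ) (by simp)]
    conv_rhs => rw [Finset.sum_comm]; enter [2, a]; rw [Finset.sum_comm]
    rw [Finset.sum_comm]
    refine Finset.sum_congr rfl fun a _ => Finset.sum_congr rfl fun b _ =>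
      Finset.sum_congr rfl fun c _ => ?_
    by_cases hab : F.deg a = F.deg b
    · congr 1
      rw [hu]
      dsimp only
      rw [← hab, ← map_star, ← map_mul, star_mul, star_mul, star_star]
      simp only [mul_assoc]
    · rw [F.apply_matrixUnit_eq_zero hψ hab, zero_smul, zero_smul]
  rw [key]
  exact Finset.sum_nonneg fun c _ => Finset.sum_nonneg fun i _ => star_mul_self_nonneg _

end Graded

end Frame

/-- A slice map of the state `ψ` on `A_Y`: a positive map `E` with `E (x y) = E (y x) = ψ(y) x` for
`y ∈ A_Y` and `x` in the algebra of the complement. -/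
structure IsSlice (E : S.Obs Set.univ →ₗ[ℂ] S.Obs Set.univ) (Y : Set S.Site)
    (ψ : S.State Set.univ) : Prop where
  nonneg : ∀ w, 0 ≤ E (star w * w)
  mul_right : ∀ {x y}, InAlgebra x Yᶜ → InAlgebra y Y → E (x * y) = ψ y • x
  mul_left : ∀ {x y}, InAlgebra x Yᶜ → InAlgebra y Y → E (y * x) = ψ y • x

theorem exists_isSlice (Y : Finset S.Site) {ψ : S.State Set.univ}
    (hψ : ∀ y, InAlgebra y (Y : Set S.Site) → ψ (S.grading Set.univ y) = ψ y) :
    ∃ E, IsSlice E (Y : Set S.Site) ψ := by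
  obtain ⟨F⟩ := Frame.nonempty_frame Y
  exact ⟨F.slice ψ, F.slice_star_mul_self_nonneg hψ, F.slice_mul ψ disjoint_compl_left,
    F.slice_mul' hψ disjoint_compl_left⟩

namespace IsSlice

variable {E : S.Obs Set.univ →ₗ[ℂ] S.Obs Set.univ} {Y : Set S.Site} {ψ : S.State Set.univ}

lemma map_one (h : IsSlice E Y ψ) : E 1 = 1 := by
  have := h.mul_right (x := 1) (y := 1) InAlgebra.one InAlgebra.one
  rwa [mul_one, ψ.map_one, one_smul] at this

/-- A positive unital map does not increase the norm of positive elements. The constant 4 comes from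
writing `x` as a combination of four positive elements of norm at most `‖x‖`; no sharper bound is
needed. -/
lemma norm_apply_le (h : IsSlice E Y ψ) (x : S.Obs Set.univ) : ‖E x‖ ≤ 4 * ‖x‖ := by
  set f : S.Obs Set.univ →ₚ[ℂ] S.Obs Set.univ := PositiveLinearMap.mk₀ E fun x hx => by
    obtain ⟨b, rfl⟩ := CStarAlgebra.nonneg_iff_eq_star_mul_self.mp hx
    exact h.nonneg b
  have hf : ∀ x, 0 ≤ x → ‖E x‖ ≤ ‖x‖ := by
    intro x hx
    have h1 : ‖E 1‖ ≤ 1 := by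
      have h2 : (1 : S.Obs Set.univ) = star 1 * 1 := by simp
      rw [h.map_one]
      rcases subsingleton_or_nontrivial (S.Obs Set.univ) with h0 | h0
      · rw [Subsingleton.elim (1 : S.Obs Set.univ) 0, norm_zero]; exact zero_le_one
      · rw [CStarRing.norm_one]
    exact (f.norm_apply_le_of_nonneg x hx).trans
      (mul_le_of_le_one_left (norm_nonneg x) h1)
  obtain ⟨y, hy0, hyn, hy⟩ := CStarAlgebra.exists_sum_four_nonneg x
  conv_lhs => rw [hy]
  rw [map_sum]
  refine (norm_sum_le _ _).trans ?_
  have : ∀ i ∈ (Finset.univ : Finset (Fin 4)), ‖E (Complex.I ^ (i : ℕ) • y i)‖ ≤ ‖x‖ := by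
    intro i _
    rw [map_smul, norm_smul, norm_pow, Complex.norm_I, one_pow, one_mul]
    exact (hf _ (hy0 i)).trans (hyn i)
  refine (Finset.sum_le_card_nsmul _ _ _ this).trans ?_
  simp

lemma continuous (h : IsSlice E Y ψ) : Continuous E :=
  AddMonoidHomClass.continuous_of_bound E 4 h.norm_apply_le

/-- On a product the slice map returns a multiple of the factor from `X`; linearity and continuity
do the rest. -/
lemma apply_mem (h : IsSlice E Y ψ) {X : Set S.Site} (hX : Disjoint X Y) {z : S.Obs Set.univ}
    (hz : InAlgebra z (X ∪ Y)) : InAlgebra (E z) X := by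
  refine InAlgebra.mul_induction (P := fun z => InAlgebra (E z) X) hX
    ((isClosed_inAlgebra _ X).preimage h.continuous) ?_ ?_ ?_ hz
  · intro x y hx hy
    rw [map_add]
    exact hx.add hy
  · intro c x hx
    rw [map_smul]
    exact hx.smul c
  · intro x y hx hy
    rw [h.mul_right (hx.mono hX.subset_compl_right) hy]
    exact hx.smul _

end IsSlice

/-! ### Existence of product states -/

namespace State

/-- The state `φ ∘ E` for a slice map `E`. -/
def compSlice (φ : S.State Set.univ) {E : S.Obs Set.univ →ₗ[ℂ] S.Obs Set.univ} {Y : Set S.Site}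
    {ψ : S.State Set.univ} (h : IsSlice E Y ψ) : S.State Set.univ where
  toFun := φ.toFun ∘ₗ E
  nonneg a := by
    obtain ⟨b, hb⟩ := CStarAlgebra.nonneg_iff_eq_star_mul_self.mp (h.nonneg a)
    rw [LinearMap.comp_apply, hb]
    exact φ.nonneg b
  map_one := by rw [LinearMap.comp_apply, h.map_one, φ.map_one]

/-- Pointwise limits of states along ultrafilters. -/
theorem exists_ultrafilter_limit {ι : Type*} {J : Set S.Site} (U : Ultrafilter ι)
    (φ : ι → S.State J) : ∃ Φ : S.State J, ∀ x, Filter.Tendsto (fun i => φ i x) U (nhds (Φ x)) := by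
  have h : ∀ x, ∃ c, Filter.Tendsto (fun i => φ i x) U (nhds c) := by
    intro x
    -- The values at `x` stay in the disc of radius `‖x‖`, so compactness gives a limit along the
    -- ultrafilter.
    obtain ⟨c, -, hc⟩ := (isCompact_closedBall (0 : ℂ) ‖x‖).ultrafilter_le_nhds
      (U.map fun i => φ i x) (by
        rw [Filter.le_principal_iff]
        refine Filter.mem_map.mpr (Filter.univ_mem' fun i => ?_)
        simpa using (φ i).norm_apply_le x)
    exact ⟨c, hc⟩
  choose f hf using h
  refine ⟨⟨⟨⟨f, fun x y => ?_⟩, fun c x => ?_⟩, fun a => ?_, ?_⟩, hf⟩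
  · refine tendsto_nhds_unique (hf (x + y)) (((hf x).add (hf y)).congr fun i => ?_)
    rw [map_add]
  · refine tendsto_nhds_unique (hf (c • x)) (((hf x).const_smul c).congr fun i => ?_)
    rw [map_smul]
  · exact ge_of_tendsto' (hf _) fun i => (φ i).nonneg a
  · refine tendsto_nhds_unique (hf 1) (tendsto_const_nhds.congr fun i => ?_)
    rw [(φ i).map_one]

/-- The product of the restrictions of a state to `A_I` and `A_J`, the latter being graded, exists. -/
theorem exists_product (Ψ : S.State Set.univ) {I J : Set S.Site} (hIJ : Disjoint I J)
    (hJ : ∀ y, InAlgebra y J → Ψ (S.grading Set.univ y) = Ψ y) :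
    ∃ Φ : S.State Set.univ, ∀ x y, InAlgebra x I → InAlgebra y J →
      Φ (x * y) = Ψ x * Ψ y ∧ Φ (y * x) = Ψ x * Ψ y := by
  classical
  have hslice : ∀ Y : Finset S.Site, ∃ E, IsSlice E ((Y.filter (· ∈ J) : Finset S.Site) : Set S.Site) Ψ :=
    fun Y => exists_isSlice _ fun y hy => hJ y (hy.mono fun j hj => (Finset.mem_filter.mp hj).2)
  choose E hE using hslice
  -- Slice maps exist only for finite sets of sites, so all of `J` is reached by a limit over the
  -- finite sets `Y`, slicing out `Y ∩ J`.
  obtain ⟨Φ, hΦ⟩ := exists_ultrafilter_limit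
    (Ultrafilter.of (Filter.atTop : Filter (Finset S.Site))) fun Y => Ψ.compSlice (hE Y)
  refine ⟨Φ, fun x y hx hy => ?_⟩
  have hxY : ∀ Y : Finset S.Site,
      InAlgebra x ((Y.filter (· ∈ J) : Finset S.Site) : Set S.Site)ᶜ := fun Y =>
    hx.mono fun i hi hi' => hIJ.notMem_of_mem_left hi (Finset.mem_filter.mp hi').2
  have hcl : ∀ P : S.Obs Set.univ → S.Obs Set.univ, Continuous P →
      (∀ (Y : Finset S.Site) y, InAlgebra y ((Y.filter (· ∈ J) : Finset S.Site) : Set S.Site) →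
        E Y (P y) = Ψ y • x) → Φ (P y) = Ψ x * Ψ y := by
    intro P hP hEP
    refine InAlgebra.local_induction (P := fun y => Φ (P y) = Ψ x * Ψ y)
      (isClosed_eq (Φ.continuous.comp hP) (continuous_const.mul Ψ.continuous)) ?_ hy
    intro Y0 y hY0 hy
    -- As soon as `Y` contains the finite support `Y0` of `y`, the approximants take the constant
    -- value `Ψ x * Ψ y`.
    refine tendsto_nhds_unique (hΦ (P y)) (tendsto_const_nhds.congr' ?_)
    refine Filter.Eventually.filter_mono (Ultrafilter.of_le _) ?_
    filter_upwards [Filter.eventually_ge_atTop Y0] with Y hY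
    have h1 : E Y (P y) = Ψ y • x := hEP Y y (hy.mono fun j hj =>
      Finset.mem_coe.mpr (Finset.mem_filter.mpr ⟨hY hj, hY0 hj⟩))
    change _ = Ψ (E Y (P y))
    rw [h1, map_smul, smul_eq_mul, mul_comm]
  exact ⟨hcl (fun y => x * y) (by fun_prop) fun Y y hy => (hE Y).mul_right (hxY Y) hy,
    hcl (fun y => y * x) (by fun_prop) fun Y y hy => (hE Y).mul_left (hxY Y) hy⟩

end State

/-! ### Asymptotic factorization -/

namespace State

/-- The correlations in `φ` of `b` with the observables of `K` decay at infinity, where `φ`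
approaches `ω`. -/
def AsympFactor (φ ω : S.State Set.univ) (K : Set S.Site) (b : S.Obs Set.univ) : Prop :=
  ∀ ε : ℝ, 0 < ε → ∃ Y : Finset S.Site, ∀ z : S.Obs Set.univ, InAlgebra z (K \ Y) →
    ‖φ (b * z) - φ b * ω z‖ ≤ ε * ‖z‖

section AsympFactor

variable {φ ω : S.State Set.univ} {K : Set S.Site}

lemma AsympFactor.add {b c : S.Obs Set.univ} (hb : AsympFactor φ ω K b)
    (hc : AsympFactor φ ω K c) : AsympFactor φ ω K (b + c) := by
  classical
  intro ε hε
  obtain ⟨Y, hY⟩ := hb (ε / 2) (half_pos hε)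
  obtain ⟨Z, hZ⟩ := hc (ε / 2) (half_pos hε)
  refine ⟨Y ∪ Z, fun z hz => ?_⟩
  have h1 := hY z (hz.mono (Set.sdiff_subset_sdiff_right (by simp)))
  have h2 := hZ z (hz.mono (Set.sdiff_subset_sdiff_right (by simp)))
  have h3 : φ ((b + c) * z) - φ (b + c) * ω z =
      (φ (b * z) - φ b * ω z) + (φ (c * z) - φ c * ω z) := by
    rw [add_mul, map_add, map_add]; ring
  rw [h3]
  refine (norm_add_le _ _).trans ?_
  linarith

lemma AsympFactor.smul {b : S.Obs Set.univ} (c : ℂ) (hb : AsympFactor φ ω K b) :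
    AsympFactor φ ω K (c • b) := by
  intro ε hε
  obtain ⟨Y, hY⟩ := hb (ε / (‖c‖ + 1)) (div_pos hε (by positivity))
  refine ⟨Y, fun z hz => ?_⟩
  have h3 : φ ((c • b) * z) - φ (c • b) * ω z = c * (φ (b * z) - φ b * ω z) := by
    rw [smul_mul_assoc, map_smul, map_smul, smul_eq_mul, smul_eq_mul]; ring
  rw [h3, norm_mul]
  calc ‖c‖ * ‖φ (b * z) - φ b * ω z‖ ≤ (‖c‖ + 1) * (ε / (‖c‖ + 1) * ‖z‖) := by
        gcongr
        · linarith
        · exact hY z hz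
    _ = ε * ‖z‖ := by field_simp

lemma AsympFactor.of_approx {b : S.Obs Set.univ}
    (h : ∀ δ : ℝ, 0 < δ → ∃ c, AsympFactor φ ω K c ∧ ‖b - c‖ ≤ δ) : AsympFactor φ ω K b := by
  intro ε hε
  obtain ⟨c, hc, hbc⟩ := h (ε / 4) (by positivity)
  obtain ⟨Y, hY⟩ := hc (ε / 2) (half_pos hε)
  refine ⟨Y, fun z hz => ?_⟩
  have h3 : φ (b * z) - φ b * ω z =
      φ ((b - c) * z) - φ (b - c) * ω z + (φ (c * z) - φ c * ω z) := by
    rw [sub_mul, map_sub, map_sub]; ring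
  have h4 : ‖φ ((b - c) * z)‖ ≤ ε / 4 * ‖z‖ :=
    (φ.norm_apply_le _).trans ((norm_mul_le _ _).trans (by gcongr))
  have h5 : ‖φ (b - c) * ω z‖ ≤ ε / 4 * ‖z‖ := by
    rw [norm_mul]
    gcongr
    · exact (φ.norm_apply_le _).trans hbc
    · exact ω.norm_apply_le z
  rw [h3]
  refine (norm_add_le _ _).trans ?_
  linarith [norm_sub_le (φ ((b - c) * z)) (φ (b - c) * ω z), hY z hz]

lemma isClosed_asympFactor : IsClosed {b | AsympFactor φ ω K b} := by
  refine isClosed_of_closure_subset fun b hb => AsympFactor.of_approx fun δ hδ => ?_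
  obtain ⟨c, hc, hbc⟩ := Metric.mem_closure_iff.mp hb δ hδ
  exact ⟨c, hc, by rw [← dist_eq_norm]; exact hbc.le⟩

end AsympFactor

/-! ### Product vector states and their images under graded automorphisms -/

/-- A state which is a tensor product of vector states of even unit vectors. -/
def IsProductVector (φ : S.State Set.univ) : Prop :=
  ∃ v : ∀ j : S.Site, S.Label j → ℂ,
    (∀ j, ∑ a, ‖v j a‖ ^ 2 = 1) ∧ (∀ j a, S.parity j a ≠ 0 → v j a = 0) ∧
      ∀ j, φ (S.site j (Matrix.vecMulVec (v j) (star (v j)))) = 1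

namespace IsProductVector

variable {φ : S.State Set.univ}

lemma exists_frame (hφ : IsProductVector φ) (Y : Finset S.Site) :
    ∃ F : S.Frame (Y : Set S.Site), φ F.p = 1 := by
  obtain ⟨v, hv, hv', h⟩ := hφ
  obtain ⟨F, hF⟩ := Frame.exists_frame v hv hv' Y
  exact ⟨F, hF φ h⟩

/-- On local observables the state is the compression to the minimal projection `p` of a frame.
Since `p` is even, the grading automorphism respects this compression. -/
theorem apply_grading (hφ : IsProductVector φ) (x : S.Obs Set.univ) :
    φ (S.grading Set.univ x) = φ x := by
  refine InAlgebra.local_induction (P := fun x => φ (S.grading Set.univ x) = φ x)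
    (isClosed_eq (φ.continuous.comp (continuous_grading _)) φ.continuous) ?_ (inAlgebra_univ x)
  intro Y y _ hy
  obtain ⟨F, hF⟩ := hφ.exists_frame Y
  have hp : S.grading Set.univ F.p = F.p := by
    rw [F.hasDegree_p, sgn_zero, one_smul]
  have h1 := congrArg (S.grading Set.univ) (F.p_mul_mul_p hF hy)
  rw [map_mul, map_mul, map_smul, hp, F.p_mul_mul_p hF hy.grading] at h1
  have h2 := congrArg φ.toFun h1
  rwa [map_smul, map_smul, hF, smul_eq_mul, smul_eq_mul, mul_one, mul_one] at h2

/-- For local `x` the support projection `p` of its sites is even and so commutes with `y`.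
Inserting it on both sides of `x` turns `x` into the scalar `φ x`. -/
theorem apply_mul (hφ : IsProductVector φ) {I J : Set S.Site} (hIJ : Disjoint I J)
    {x y : S.Obs Set.univ} (hx : InAlgebra x I) (hy : InAlgebra y J) : φ (x * y) = φ x * φ y := by
  refine InAlgebra.local_induction (P := fun x => φ (x * y) = φ x * φ y)
    (isClosed_eq (φ.continuous.comp (by fun_prop)) (φ.continuous.mul continuous_const)) ?_ hx
  intro Y x hY hx
  obtain ⟨F, hF⟩ := hφ.exists_frame Y
  have hcomm : y * F.p = F.p * y :=
    commute_of_even (hIJ.symm.mono_right hY) hy F.p_mem F.hasDegree_p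
  rw [← φ.apply_mul_support hF F.star_p F.p_mul_p (x * y), mul_assoc, hcomm,
    ← φ.apply_support_mul hF F.star_p F.p_mul_p, ← mul_assoc, ← mul_assoc, F.p_mul_mul_p hF hx,
    smul_mul_assoc, map_smul, smul_eq_mul, φ.apply_support_mul hF F.star_p F.p_mul_p]

/-- The images of product vector states under graded automorphisms are clustering. -/
theorem asympFactor_comp (hφ : IsProductVector φ) {α : S.Aut} (hα : IsGradedAut α)
    (b : S.Obs Set.univ) :
    AsympFactor (φ.comp (α : S.Obs Set.univ →⋆ₐ[ℂ] S.Obs Set.univ))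
      (φ.comp (α : S.Obs Set.univ →⋆ₐ[ℂ] S.Obs Set.univ)) Set.univ b := by
  have hnorm : ∀ x, ‖α x‖ ≤ ‖x‖ := fun x =>
    NonUnitalStarAlgHom.norm_apply_le (α : S.Obs Set.univ →⋆ₐ[ℂ] S.Obs Set.univ) x
  intro ε hε
  change ∃ Y : Finset S.Site, ∀ z : S.Obs Set.univ, InAlgebra z (Set.univ \ Y) →
    ‖φ (α (b * z)) - φ (α b) * φ (α z)‖ ≤ ε * ‖z‖
  obtain ⟨b', ⟨X, -, hb'⟩, hbb'⟩ := Metric.mem_closure_iff.mp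
    (mem_closure_local (inAlgebra_univ (α b))) (ε / 4) (by positivity)
  rw [dist_eq_norm] at hbb'
  obtain ⟨F, hF⟩ := hφ.exists_frame X
  -- Although `α` does not preserve locality, `q` is an even norm limit of local observables. It
  -- therefore almost commutes with every `z` supported far away, and `p` almost commutes with `α
  -- z`.
  set q := α.symm F.p with hq
  have hαq : α q = F.p := α.apply_symm_apply F.p
  have hqdeg : HasDegree q 0 := by
    have hinj : α (S.grading Set.univ q) = α q := by
      rw [hα, hαq, F.hasDegree_p, sgn_zero, one_smul]
    rw [HasDegree, sgn_zero, one_smul]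
    exact α.injective hinj
  have hδ : 0 < ε / (4 * (‖b'‖ + 1)) := by positivity
  obtain ⟨q', ⟨Y, -, hq'⟩, hqq'⟩ := Metric.mem_closure_iff.mp
    (mem_closure_local (inAlgebra_univ q)) _ hδ
  rw [dist_eq_norm] at hqq'
  refine ⟨Y, fun z hz => ?_⟩
  -- Replacing the local approximant by its even part costs nothing, because `q` is even, and gives
  -- exact commutation with `z`.
  have hpart : ‖q - part 0 q'‖ ≤ ‖q - q'‖ := by
    have h1 : q = part 0 q := by
      rw [part, hqdeg, sgn_zero, one_smul, one_smul, ← two_smul ℂ q, smul_smul]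
      norm_num
    have h2 : part 0 q - part 0 q' = part 0 (q - q') := by
      simp only [part, map_sub, smul_sub, smul_add]
      abel
    conv_lhs => rw [h1, h2]
    exact norm_part_le 0 _
  have hcomm : z * part 0 q' = part 0 q' * z :=
    commute_of_even Set.disjoint_sdiff_left hz (hq'.part 0) (hasDegree_part 0 q')
  have hc : ‖α z * F.p - F.p * α z‖ ≤ 2 * (ε / (4 * (‖b'‖ + 1))) * ‖z‖ := by
    rw [← hαq, ← map_mul, ← map_mul, ← map_sub]
    refine (hnorm _).trans ?_
    have h1 : z * q - q * z = z * (q - part 0 q') - (q - part 0 q') * z := by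
      rw [mul_sub, sub_mul, hcomm]; abel
    rw [h1]
    refine (norm_sub_le _ _).trans ?_
    have h2 := norm_mul_le z (q - part 0 q')
    have h3 := norm_mul_le (q - part 0 q') z
    have h4 : ‖z‖ * ‖q - part 0 q'‖ ≤ ‖z‖ * (ε / (4 * (‖b'‖ + 1))) := by
      gcongr
      exact hpart.trans hqq'.le
    nlinarith
  -- If `p` commuted with `α z`, then `φ (b' * α z) = φ (p b' p * α z) = φ b' * φ (α z)`; the error
  -- is the commutator.
  have h1 : φ (b' * α z) - φ b' * φ (α z) = φ (b' * (α z * F.p - F.p * α z)) := by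
    rw [mul_sub, map_sub, ← mul_assoc, φ.apply_mul_support hF F.star_p F.p_mul_p,
      ← φ.apply_support_mul hF F.star_p F.p_mul_p (b' * (F.p * α z)), ← mul_assoc, ← mul_assoc,
      F.p_mul_mul_p hF hb', smul_mul_assoc, map_smul, smul_eq_mul,
      φ.apply_support_mul hF F.star_p F.p_mul_p]
  have h2 : ‖φ (b' * α z) - φ b' * φ (α z)‖ ≤ ε / 2 * ‖z‖ := by
    rw [h1]
    refine (φ.norm_apply_le _).trans ((norm_mul_le _ _).trans ?_)
    calc ‖b'‖ * ‖α z * F.p - F.p * α z‖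
        ≤ (‖b'‖ + 1) * (2 * (ε / (4 * (‖b'‖ + 1))) * ‖z‖) := by
          gcongr
          linarith
      _ = ε / 2 * ‖z‖ := by field_simp; ring
  have h3 : φ (α (b * z)) - φ (α b) * φ (α z) = φ ((α b - b') * α z) - φ (α b - b') * φ (α z) +
      (φ (b' * α z) - φ b' * φ (α z)) := by
    rw [map_mul α, sub_mul, map_sub, map_sub]; ring
  have h4 : ‖φ ((α b - b') * α z)‖ ≤ ε / 4 * ‖z‖ :=
    (φ.norm_apply_le _).trans ((norm_mul_le _ _).trans (by gcongr; exact hnorm z))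
  have h5 : ‖φ (α b - b') * φ (α z)‖ ≤ ε / 4 * ‖z‖ := by
    rw [norm_mul]
    gcongr
    · exact (φ.norm_apply_le _).trans hbb'.le
    · exact (φ.norm_apply_le _).trans (hnorm z)
  rw [h3]
  refine (norm_add_le _ _).trans ?_
  linarith [norm_sub_le (φ ((α b - b') * α z)) (φ (α b - b') * φ (α z))]

end IsProductVector

/-! ### States with unitarily equivalent GNS representations -/

section GNS

variable {φ ψ : S.State Set.univ}

lemma inner_gns (φ : S.State Set.univ) (a x : S.Obs Set.univ) :
    inner ℂ (φ.toPositive.toPreGNS a : φ.toPositive.GNS)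
      (φ.toPositive.gnsStarAlgHom x (φ.toPositive.toPreGNS a : φ.toPositive.GNS)) =
        φ (star a * (x * a)) := by
  have h : φ.toPositive.gnsStarAlgHom x (φ.toPositive.toPreGNS a : φ.toPositive.GNS) =
      (φ.toPositive.toPreGNS (x * a) : φ.toPositive.GNS) := by
    change φ.toPositive.gnsNonUnitalStarAlgHom x _ = _
    rw [PositiveLinearMap.gnsNonUnitalStarAlgHom_apply_coe,
      PositiveLinearMap.leftMulMapPreGNS_apply, PositiveLinearMap.ofPreGNS_toPreGNS]
  rw [h, UniformSpace.Completion.inner_coe, inner_toPreGNS]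

/-- A state whose GNS representation is equivalent to the one of `φ` is approximated in norm by the
functionals `x ↦ φ (a* x a)` with local `a`. -/
lemma UnitarilyEquivalent.exists_approx (h : φ.UnitarilyEquivalent ψ) {δ : ℝ} (hδ : 0 < δ) :
    ∃ (a : S.Obs Set.univ) (Y : Finset S.Site), InAlgebra a (Y : Set S.Site) ∧
      ∀ x, ‖ψ x - φ (star a * (x * a))‖ ≤ δ * ‖x‖ := by
  obtain ⟨U, hU⟩ := h
  set ξ : ψ.toPositive.GNS := (ψ.toPositive.toPreGNS 1 : ψ.toPositive.GNS) with hξ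
  have hξn : ‖ξ‖ = 1 := by
    rw [hξ, UniformSpace.Completion.norm_coe, norm_toPreGNS_one]
  set v := U.symm ξ with hv
  have hvn : ‖v‖ = 1 := by rw [hv, LinearIsometryEquiv.norm_map, hξn]
  have hψ : ∀ x, ψ x = inner ℂ v (φ.toPositive.gnsStarAlgHom x v) := by
    intro x
    have h1 := inner_gns ψ 1 x
    rw [star_one, one_mul, mul_one] at h1
    rw [← h1, ← U.inner_map_map, hU, hv, U.apply_symm_apply]
  have hπ : ∀ x, ‖φ.toPositive.gnsStarAlgHom x‖ ≤ ‖x‖ := fun x =>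
    NonUnitalStarAlgHom.norm_apply_le φ.toPositive.gnsStarAlgHom x
  -- The bound by `1` keeps `‖u‖ ≤ 2`, and the two error terms then add up to `3 * η * ‖x‖`.
  set η := min 1 (δ / 3) with hη
  have hη0 : 0 < η := lt_min one_pos (by positivity)
  obtain ⟨w, hw⟩ := Metric.denseRange_iff.mp
    (UniformSpace.Completion.denseRange_coe (α := φ.toPositive.PreGNS)) v (η / 2) (half_pos hη0)
  obtain ⟨a, ⟨Y, -, ha⟩, hwa⟩ := Metric.mem_closure_iff.mp
    (mem_closure_local (inAlgebra_univ (φ.toPositive.ofPreGNS w))) (η / 2) (half_pos hη0)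
  refine ⟨a, Y, ha, fun x => ?_⟩
  set u : φ.toPositive.GNS := (φ.toPositive.toPreGNS a : φ.toPositive.GNS) with hu
  have hvu : ‖v - u‖ ≤ η := by
    have h1 : ‖(w : φ.toPositive.GNS) - u‖ ≤ η / 2 := by
      rw [hu, ← UniformSpace.Completion.coe_sub, UniformSpace.Completion.norm_coe]
      have h2 : w - φ.toPositive.toPreGNS a =
        φ.toPositive.toPreGNS (φ.toPositive.ofPreGNS w - a) := rfl
      rw [h2]
      rw [dist_eq_norm] at hwa
      exact (norm_toPreGNS_le φ _).trans hwa.le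
    have h3 : v - u = (v - w) + (w - u) := by abel
    rw [h3]
    rw [dist_eq_norm] at hw
    refine (norm_add_le _ _).trans ?_
    linarith
  have hun : ‖u‖ ≤ 2 := by
    have h1 : u = v - (v - u) := by abel
    rw [h1]
    refine (norm_sub_le _ _).trans ?_
    linarith [min_le_left 1 (δ / 3)]
  have key : ψ x - φ (star a * (x * a)) =
      inner ℂ v (φ.toPositive.gnsStarAlgHom x (v - u)) +
        inner ℂ (v - u) (φ.toPositive.gnsStarAlgHom x u) := by
    rw [hψ, ← inner_gns, ← hu, map_sub, inner_sub_right, inner_sub_left]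
    ring
  have hb : ∀ y : φ.toPositive.GNS, ‖φ.toPositive.gnsStarAlgHom x y‖ ≤ ‖x‖ * ‖y‖ := fun y =>
    (ContinuousLinearMap.le_opNorm _ _).trans (by gcongr; exact hπ x)
  rw [key]
  calc _ ≤ ‖v‖ * (‖x‖ * ‖v - u‖) + ‖v - u‖ * (‖x‖ * ‖u‖) := by
        refine (norm_add_le _ _).trans (add_le_add ?_ ?_)
        · exact (norm_inner_le_norm _ _).trans (by gcongr; exact hb _)
        · exact (norm_inner_le_norm _ _).trans (by gcongr; exact hb _)
    _ ≤ 1 * (‖x‖ * η) + η * (‖x‖ * 2) := by rw [hvn]; gcongr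
    _ ≤ δ * ‖x‖ := by nlinarith [min_le_right 1 (δ / 3), norm_nonneg x]

/-- A state whose GNS representation is equivalent to the one of a graded clustering state `φ` is
clustering and coincides with `φ` at infinity. -/
theorem UnitarilyEquivalent.asympFactor (h : φ.UnitarilyEquivalent ψ)
    (hgr : ∀ x, φ (S.grading Set.univ x) = φ x) (hφ : ∀ b, AsympFactor φ φ Set.univ b)
    (b : S.Obs Set.univ) : AsympFactor ψ φ Set.univ b := by
  classical
  intro ε hε
  have hδ : 0 < ε / (4 * (‖b‖ + 1)) := by positivity
  obtain ⟨a, X, ha, hap⟩ := h.exists_approx hδ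
  obtain ⟨Y0, hY0⟩ := hφ (star a * (b * a)) (ε / 4) (by positivity)
  obtain ⟨Y1, hY1⟩ := hφ (star a * (b * S.grading Set.univ a)) (ε / 4) (by positivity)
  refine ⟨X ∪ (Y0 ∪ Y1), fun z hz => ?_⟩
  have hzX : InAlgebra z (Set.univ \ (X : Set S.Site)) :=
    hz.mono (Set.sdiff_subset_sdiff_right (by simp))
  have hz0 := hY0 (part 0 z) ((hz.part 0).mono (Set.sdiff_subset_sdiff_right
    (by intro i hi; simp only [Finset.coe_union]; exact Or.inr (Or.inl hi))))
  have hz1 := hY1 (part 1 z) ((hz.part 1).mono (Set.sdiff_subset_sdiff_right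
    (by intro i hi; simp only [Finset.coe_union]; exact Or.inr (Or.inr hi))))
  have hodd : φ (part 1 z) = 0 := apply_eq_zero_of_odd (fun x _ => hgr x) (inAlgebra_univ _)
    (hasDegree_part 1 z)
  have hev : φ (part 0 z) = φ z := by
    conv_rhs => rw [← part_add_part z, map_add, hodd, add_zero]
  have hc0 : part 0 z * a = a * part 0 z := by
    rw [commute_of_even Set.disjoint_sdiff_right ha (hzX.part 0) (hasDegree_part 0 z)]
  have hc1 : part 1 z * a = S.grading Set.univ a * part 1 z := by
    rw [mul_eq_twist_mul Set.disjoint_sdiff_right ha (hzX.part 1) (hasDegree_part 1 z), twist_one]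
  rw [hodd, mul_zero, sub_zero] at hz1
  rw [hev] at hz0
  -- Far from the support of `a`, the even part of `z` commutes with `a` and the odd part does so up
  -- to the grading of `a`. The clustering of `φ` applies to both terms, and the odd one tends to
  -- zero because `φ` is graded; `ψ` itself need not be graded.
  have e1 : star a * (b * z * a) = star a * (b * a) * part 0 z +
      star a * (b * S.grading Set.univ a) * part 1 z := by
    conv_lhs => rw [← part_add_part z]
    rw [mul_add, add_mul, mul_assoc b, mul_assoc b, hc0, hc1, mul_add]
    simp only [mul_assoc]
  have h1 := hap (b * z)
  have h2 := hap b
  rw [e1, map_add] at h1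
  have e2 : ψ (b * z) - ψ b * φ z =
      (ψ (b * z) - (φ (star a * (b * a) * part 0 z) +
        φ (star a * (b * S.grading Set.univ a) * part 1 z))) +
      (φ (star a * (b * a) * part 0 z) - φ (star a * (b * a)) * φ z) +
      φ (star a * (b * S.grading Set.univ a) * part 1 z) -
      (ψ b - φ (star a * (b * a))) * φ z := by ring
  have hb1 : ε / (4 * (‖b‖ + 1)) * ‖b‖ ≤ ε / 4 := by
    rw [div_mul_eq_mul_div, div_le_div_iff₀ (by positivity) (by norm_num)]
    nlinarith [norm_nonneg b]
  have h3 : ε / (4 * (‖b‖ + 1)) * ‖b * z‖ ≤ ε / 4 * ‖z‖ := by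
    calc _ ≤ ε / (4 * (‖b‖ + 1)) * (‖b‖ * ‖z‖) := by gcongr; exact norm_mul_le _ _
      _ = ε / (4 * (‖b‖ + 1)) * ‖b‖ * ‖z‖ := by ring
      _ ≤ ε / 4 * ‖z‖ := by gcongr
  have h4 : ‖(ψ b - φ (star a * (b * a))) * φ z‖ ≤ ε / 4 * ‖z‖ := by
    rw [norm_mul]
    gcongr
    · exact h2.trans hb1
    · exact φ.norm_apply_le z
  have h5 : ε / 4 * ‖part 0 z‖ ≤ ε / 4 * ‖z‖ := by gcongr; exact norm_part_le 0 z
  have h6 : ε / 4 * ‖part 1 z‖ ≤ ε / 4 * ‖z‖ := by gcongr; exact norm_part_le 1 z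
  rw [e2]
  refine (norm_sub_le _ _).trans ?_
  refine (add_le_add (norm_add₃_le) le_rfl).trans ?_
  linarith

end GNS

end State

namespace State

/-! ### From asymptotic factorization to quasi-equivalence -/

section Quasi

variable {φ ψ ω : S.State Set.univ} {K : Set S.Site}

/-- The hypothesis at `1` says that `φ` and `ω` agree at infinity, so `ω z` may be replaced by `φ
z`. -/
lemma AsympFactor.self (h1 : AsympFactor φ ω K 1) {b : S.Obs Set.univ}
    (hb : AsympFactor φ ω K b) : AsympFactor φ φ K b := by
  classical
  intro ε hε
  obtain ⟨Y, hY⟩ := hb (ε / 2) (half_pos hε)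
  have hε' : 0 < ε / (2 * (‖b‖ + 1)) := by positivity
  obtain ⟨Z, hZ⟩ := h1 _ hε'
  refine ⟨Y ∪ Z, fun z hz => ?_⟩
  have e1 := hY z (hz.mono (Set.sdiff_subset_sdiff_right (by simp)))
  have e2 := hZ z (hz.mono (Set.sdiff_subset_sdiff_right (by simp)))
  rw [one_mul, φ.map_one, one_mul] at e2
  have e3 : φ (b * z) - φ b * φ z = (φ (b * z) - φ b * ω z) - φ b * (φ z - ω z) := by ring
  have e4 : ‖φ b * (φ z - ω z)‖ ≤ ε / 2 * ‖z‖ := by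
    rw [norm_mul]
    calc ‖φ b‖ * ‖φ z - ω z‖ ≤ (‖b‖ + 1) * (ε / (2 * (‖b‖ + 1)) * ‖z‖) := by
          gcongr
          linarith [φ.norm_apply_le b]
      _ = ε / 2 * ‖z‖ := by field_simp
  rw [e3]
  refine (norm_sub_le _ _).trans ?_
  linarith

/-- The decay of correlations is uniform on the observables of a finite set of sites. -/
lemma exists_uniform_asympFactor (h : ∀ b, InAlgebra b K → AsympFactor φ ω K b)
    (X : Finset S.Site) (hX : (X : Set S.Site) ⊆ K) {ε : ℝ} (hε : 0 < ε) :
    ∃ Y : Finset S.Site, ∀ x z : S.Obs Set.univ, InAlgebra x (X : Set S.Site) →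
      InAlgebra z (K \ Y) → ‖φ (x * z) - φ x * ω z‖ ≤ ε * ‖x‖ * ‖z‖ := by
  classical
  obtain ⟨F⟩ := Frame.nonempty_frame X
  have hp : 0 < ‖F.p‖ := by
    rw [norm_pos_iff]
    intro hp
    have h1 : (1 : S.Obs Set.univ) = 0 := by
      rw [← F.sum_mul_star]
      refine Finset.sum_eq_zero fun a _ => ?_
      rw [← F.K_mul_p, hp, mul_zero, zero_mul]
    have h2 := φ.map_one
    rw [h1, map_zero] at h2
    exact zero_ne_one h2
  -- It is enough to have decay for the finitely many matrix units. From `K a* x K b = m a b • p`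
  -- the matrix entries of `x` are at most `‖K a‖ ‖K b‖ ‖x‖ / ‖p‖`, and `C` collects these factors;
  -- only `p ≠ 0` matters, not the value of its norm.
  obtain ⟨C, hC⟩ : ∃ C : ℝ, C = ∑ a, ∑ b, ‖F.K a‖ * ‖F.K b‖ / ‖F.p‖ := ⟨_, rfl⟩
  have hC0 : 0 ≤ C := by
    rw [hC]
    exact Finset.sum_nonneg fun a _ => Finset.sum_nonneg fun b _ => by positivity
  have hε' : 0 < ε / (C + 1) := div_pos hε (by linarith)
  choose Y hY using fun a b =>
    h (F.K a * star (F.K b)) (((F.mem a).mul (F.mem b).star).mono hX) (ε / (C + 1)) hε'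
  refine ⟨Finset.univ.biUnion fun a => Finset.univ.biUnion fun b => Y a b,
    fun x z hx hz => ?_⟩
  obtain ⟨m, hm, hm'⟩ := F.exists_matrix hx
  have hmb : ∀ a b, ‖m a b‖ ≤ ‖F.K a‖ * ‖F.K b‖ / ‖F.p‖ * ‖x‖ := by
    intro a b
    rw [div_mul_eq_mul_div, le_div_iff₀ hp, ← norm_smul, ← hm]
    refine (norm_mul_le _ _).trans ?_
    calc ‖star (F.K a) * x‖ * ‖F.K b‖ ≤ ‖star (F.K a)‖ * ‖x‖ * ‖F.K b‖ := by
          gcongr; exact norm_mul_le _ _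
      _ = ‖F.K a‖ * ‖F.K b‖ * ‖x‖ := by rw [norm_star]; ring
  have e1 : φ (x * z) - φ x * ω z = ∑ a, ∑ b, m a b *
      (φ (F.K a * star (F.K b) * z) - φ (F.K a * star (F.K b)) * ω z) := by
    conv_lhs => rw [hm']
    simp only [Finset.sum_mul, map_sum, smul_mul_assoc, map_smul, smul_eq_mul,
      ← Finset.sum_sub_distrib]
    exact Finset.sum_congr rfl fun a _ => Finset.sum_congr rfl fun b _ => by ring
  have e2 : ∀ a b, ‖m a b * (φ (F.K a * star (F.K b) * z) -
      φ (F.K a * star (F.K b)) * ω z)‖ ≤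
        ‖F.K a‖ * ‖F.K b‖ / ‖F.p‖ * (‖x‖ * (ε / (C + 1) * ‖z‖)) := by
    intro a b
    rw [norm_mul, ← mul_assoc]
    gcongr
    · exact hmb a b
    · refine hY a b z (hz.mono (Set.sdiff_subset_sdiff_right ?_))
      intro i hi
      simp only [Finset.coe_biUnion, Finset.coe_univ, Set.mem_univ, Set.iUnion_true,
        Set.mem_iUnion]
      exact ⟨a, b, hi⟩
  rw [e1]
  calc _ ≤ ∑ a, ∑ b, ‖F.K a‖ * ‖F.K b‖ / ‖F.p‖ * (‖x‖ * (ε / (C + 1) * ‖z‖)) :=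
        (norm_sum_le _ _).trans (Finset.sum_le_sum fun a _ =>
          (norm_sum_le _ _).trans (Finset.sum_le_sum fun b _ => e2 a b))
    _ = C * (‖x‖ * (ε / (C + 1) * ‖z‖)) := by simp only [← Finset.sum_mul, hC]
    _ ≤ (C + 1) * (‖x‖ * (ε / (C + 1) * ‖z‖)) := by gcongr; linarith
    _ = ε * ‖x‖ * ‖z‖ := by field_simp

lemma norm_incl {I J : Set S.Site} (h : I ⊆ J) (x : S.Obs I) : ‖incl h x‖ = ‖x‖ := by
  rw [obs_norm, obs_norm, incl_val]

lemma inAlgebra_incl {I J L : Set S.Site} (h : I ⊆ J) {x : S.Obs I} (hx : InAlgebra x L) :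
    InAlgebra (incl h x) L := by
  rw [inAlgebra_iff, incl_val]; exact hx

lemma restrict_apply {I J : Set S.Site} (φ : S.State J) (h : I ⊆ J) (x : S.Obs I) :
    φ.restrict h x = φ (incl h x) := rfl

/-- The finite set must lie in `K` and contain `X`, so the set from the uniform estimate is cut down
to `K` and enlarged by `X`; neither change harms the estimate for observables of `K`. -/
lemma isFactorial_restrict (h : ∀ b, InAlgebra b K → AsympFactor φ ω K b) :
    (φ.restrict (Set.subset_univ K)).IsFactorial := by
  classical
  intro ε hε X hX
  obtain ⟨Y, hY⟩ := exists_uniform_asympFactor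
    (fun b hb => (h 1 InAlgebra.one).self (h b hb)) X hX hε
  refine ⟨X ∪ Y.filter (· ∈ K), Finset.subset_union_left, ?_, fun x y hx hy => ?_⟩
  · intro j hj
    rcases Finset.mem_union.mp hj with hj | hj
    · exact hX hj
    · exact (Finset.mem_filter.mp hj).2
  · have h1 := hY (incl (Set.subset_univ K) x) (incl (Set.subset_univ K) y)
      (inAlgebra_incl _ hx) ((inAlgebra_incl _ hy).mono fun j hj => ⟨hj.1, fun hjY => hj.2
        (Finset.mem_union_right _ (Finset.mem_filter.mpr ⟨hjY, hj.1⟩))⟩)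
    rwa [norm_incl, norm_incl, ← map_mul] at h1

/-- States over `A_K` with decaying correlations which coincide with the same state at infinity are
quasi-equivalent. -/
theorem quasiEquivalent_of_asympFactor (hφ : ∀ b, InAlgebra b K → AsympFactor φ ω K b)
    (hψ : ∀ b, InAlgebra b K → AsympFactor ψ ω K b) :
    (φ.restrict (Set.subset_univ K)).QuasiEquivalent (ψ.restrict (Set.subset_univ K)) := by
  classical
  refine ⟨isFactorial_restrict hφ, isFactorial_restrict hψ, fun ε hε => ?_⟩
  obtain ⟨Y, hY⟩ := hφ 1 InAlgebra.one (ε / 2) (half_pos hε)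
  obtain ⟨Z, hZ⟩ := hψ 1 InAlgebra.one (ε / 2) (half_pos hε)
  refine ⟨(Y ∪ Z).filter (· ∈ K), fun j hj => (Finset.mem_filter.mp hj).2, fun x hx => ?_⟩
  have hx' : ∀ W : Finset S.Site, W ⊆ Y ∪ Z →
      InAlgebra (incl (Set.subset_univ K) x) (K \ (W : Set S.Site)) :=
    fun W hW => (inAlgebra_incl _ hx).mono fun j hj => ⟨hj.1, fun hjY => hj.2
        (Finset.mem_filter.mpr ⟨hW hjY, hj.1⟩)⟩
  have e1 := hY _ (hx' Y Finset.subset_union_left)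
  have e2 := hZ _ (hx' Z Finset.subset_union_right)
  rw [one_mul, map_one, one_mul, norm_incl] at e1 e2
  rw [restrict_apply, restrict_apply, ← sub_sub_sub_cancel_right _ _
    (ω (incl (Set.subset_univ K) x))]
  refine (norm_sub_le _ _).trans ?_
  linarith

end Quasi

/-! ### Behaviour at infinity of the product of the restrictions -/

/-- The product of the restrictions of a clustering state is clustering. -/
theorem product_asympFactor {Ψ Φ ω : S.State Set.univ} {I J : Set S.Site} (hIJ : Disjoint I J)
    (hJ : ∀ y, InAlgebra y J → Ψ (S.grading Set.univ y) = Ψ y)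
    (hω : ∀ x, ω (S.grading Set.univ x) = ω x) (hΨ : ∀ b, AsympFactor Ψ ω Set.univ b)
    (hΦ : ∀ x y, InAlgebra x I → InAlgebra y J → Φ (x * y) = Ψ x * Ψ y) (X : Finset S.Site)
    (hX : ∀ x y, InAlgebra x (I \ X) → InAlgebra y (J \ X) → ω (x * y) = ω x * ω y)
    {b : S.Obs Set.univ} (hb : InAlgebra b (I ∪ J)) : AsympFactor Φ ω (I ∪ J) b := by
  classical
  refine InAlgebra.mul_induction (P := fun b => AsympFactor Φ ω (I ∪ J) b) hIJ isClosed_asympFactor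
    (fun _ _ => AsympFactor.add) (fun c _ => AsympFactor.smul c) ?_ hb
  intro x₁ x₂ hx₁ hx₂
  -- The factor `x₂` and later `z` are made local because their sites are going to be sliced out;
  -- `x₁` may stay quasi-local.
  refine InAlgebra.local_induction (P := fun x₂ => AsympFactor Φ ω (I ∪ J) (x₁ * x₂))
    (isClosed_asympFactor.preimage (by fun_prop)) ?_ hx₂
  intro Y₂ x₂ hY₂ hx₂ ε hε
  -- The 8 is twice the norm bound 4 of slice maps: each of the two approximations below may cost `ε
  -- / 2 * ‖z‖`.
  have hε₁ : 0 < ε / (8 * (‖x₂‖ + 1)) := by positivity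
  have hε₂ : 0 < ε / (8 * (‖x₁‖ + 1)) := by positivity
  obtain ⟨Ya, hYa⟩ := hΨ x₁ _ hε₁
  obtain ⟨Yb, hYb⟩ := hΨ x₂ _ hε₂
  refine ⟨X ∪ (Ya ∪ Yb), fun z hz => ?_⟩
  refine InAlgebra.local_induction
    (P := fun z => ‖Φ (x₁ * x₂ * z) - Φ (x₁ * x₂) * ω z‖ ≤ ε * ‖z‖)
    (isClosed_le ((Φ.continuous.comp (by fun_prop)).sub
      (continuous_const.mul ω.continuous)).norm (by fun_prop)) ?_ hz
  intro Z z hZ hz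
  set ZI : Finset S.Site := Z.filter (· ∈ I) with hZI
  set ZJ : Finset S.Site := Z.filter (· ∈ J) with hZJ
  have hZIsub : (ZI : Set S.Site) ⊆ I \ (X ∪ (Ya ∪ Yb) : Finset S.Site) := fun j hj =>
    ⟨(Finset.mem_filter.mp hj).2, (hZ (Finset.mem_filter.mp hj).1).2⟩
  have hZJsub : (ZJ : Set S.Site) ⊆ J \ (X ∪ (Ya ∪ Yb) : Finset S.Site) := fun j hj =>
    ⟨(Finset.mem_filter.mp hj).2, (hZ (Finset.mem_filter.mp hj).1).2⟩
  have hZIJ : Disjoint (ZI : Set S.Site) (ZJ : Set S.Site) :=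
    hIJ.mono (hZIsub.trans Set.sdiff_subset) (hZJsub.trans Set.sdiff_subset)
  have hWJ : ((ZJ ∪ Y₂ : Finset S.Site) : Set S.Site) ⊆ J := by
    rw [Finset.coe_union]
    exact Set.union_subset (hZJsub.trans Set.sdiff_subset) hY₂
  have hZIW : Disjoint (ZI : Set S.Site) ((ZJ ∪ Y₂ : Finset S.Site) : Set S.Site) :=
    hIJ.mono (hZIsub.trans Set.sdiff_subset) hWJ
  have hzIJ : InAlgebra z ((ZI : Set S.Site) ∪ ZJ) := by
    refine hz.mono fun j hj => ?_
    rcases (hZ hj).1 with h | h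
    · exact Or.inl (Finset.mem_coe.mpr (Finset.mem_filter.mpr ⟨hj, h⟩))
    · exact Or.inr (Finset.mem_coe.mpr (Finset.mem_filter.mpr ⟨hj, h⟩))
  have hsubW : (ZJ : Set S.Site) ⊆ ((ZJ ∪ Y₂ : Finset S.Site) : Set S.Site) := by simp
  have hx₂W : InAlgebra x₂ ((ZJ ∪ Y₂ : Finset S.Site) : Set S.Site) := hx₂.mono (by simp)
  -- `E` evaluates the `J` side in `Ψ` and leaves observables of `ZI`, which avoids `Ya`. `E'`
  -- evaluates the `I` side in `ω` and leaves observables of `ZJ`, which avoids `Yb`.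
  obtain ⟨E, hE⟩ := exists_isSlice (ZJ ∪ Y₂) (ψ := Ψ) fun y hy => hJ y (hy.mono hWJ)
  obtain ⟨E', hE'⟩ := exists_isSlice ZI (ψ := ω) fun y _ => hω y
  have hw : InAlgebra (x₂ * z) ((ZI : Set S.Site) ∪ ((ZJ ∪ Y₂ : Finset S.Site) : Set S.Site)) :=
    (hx₂W.mono Set.subset_union_right).mul (hzIJ.mono (Set.union_subset_union_right _ hsubW))
  have ha : Φ (x₁ * (x₂ * z)) = Ψ (x₁ * E (x₂ * z)) := by
    refine InAlgebra.mul_induction (P := fun w => Φ (x₁ * w) = Ψ (x₁ * E w)) hZIW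
      (isClosed_eq (Φ.continuous.comp (by fun_prop))
        (Ψ.continuous.comp (continuous_const.mul hE.continuous))) ?_ ?_ ?_ hw
    · intro x y hx hy
      simp only [mul_add, map_add] at *
      rw [hx, hy]
    · intro c x hx
      simp only [mul_smul_comm, map_smul] at *
      rw [hx]
    · intro x y hx hy
      rw [hE.mul_right (hx.mono hZIW.subset_compl_right) hy, ← mul_assoc,
        hΦ _ _ (hx₁.mul (hx.mono (hZIsub.trans Set.sdiff_subset))) (hy.mono hWJ), mul_smul_comm,
        map_smul, smul_eq_mul, mul_comm]
  -- For `z = y * x` with `y` on `ZJ` and `x` on `ZI`, both sides equal `Ψ (x₂ * y) * ω x`. This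
  -- order of the factors keeps `x₂ * y` together for the slice.
  have hc : ω (E (x₂ * z)) = Ψ (x₂ * E' z) := by
    rw [Set.union_comm] at hzIJ
    refine InAlgebra.mul_induction (P := fun z => ω (E (x₂ * z)) = Ψ (x₂ * E' z)) hZIJ.symm
      (isClosed_eq (ω.continuous.comp (hE.continuous.comp (by fun_prop)))
        (Ψ.continuous.comp (continuous_const.mul hE'.continuous))) ?_ ?_ ?_ hzIJ
    · intro x y hx hy
      simp only [mul_add, map_add] at *
      rw [hx, hy]
    · intro c x hx
      simp only [mul_smul_comm, map_smul] at *
      rw [hx]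
    · intro y x hy hx
      rw [← mul_assoc, hE.mul_left (hx.mono hZIW.subset_compl_right)
        (hx₂W.mul (hy.mono hsubW)), hE'.mul_right (hy.mono hZIJ.subset_compl_left) hx,
        mul_smul_comm, map_smul, map_smul, smul_eq_mul, smul_eq_mul, mul_comm]
  -- The factorization of `ω` at infinity enters only here.
  have he : ω (E' z) = ω z := by
    refine InAlgebra.mul_induction (P := fun z => ω (E' z) = ω z) hZIJ
      (isClosed_eq (ω.continuous.comp hE'.continuous) ω.continuous) ?_ ?_ ?_ hzIJ
    · intro x y hx hy
      simp only [map_add] at *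
      rw [hx, hy]
    · intro c x hx
      simp only [map_smul] at *
      rw [hx]
    · intro x y hx hy
      rw [hE'.mul_left (hy.mono hZIJ.subset_compl_left) hx, map_smul, smul_eq_mul, hX x y
        (hx.mono (hZIsub.trans (Set.sdiff_subset_sdiff_right (by simp))))
        (hy.mono (hZJsub.trans (Set.sdiff_subset_sdiff_right (by simp))))]
  have hEz : InAlgebra (E (x₂ * z)) (Set.univ \ (Ya : Set S.Site)) :=
    (hE.apply_mem hZIW hw).mono fun j hj => ⟨trivial, fun h => (hZIsub hj).2 (by
      simp only [Finset.coe_union]; exact Or.inr (Or.inl h))⟩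
  have hE'z : InAlgebra (E' z) (Set.univ \ (Yb : Set S.Site)) := by
    rw [Set.union_comm] at hzIJ
    exact (hE'.apply_mem hZIJ.symm hzIJ).mono fun j hj => ⟨trivial, fun h => (hZJsub hj).2 (by
      simp only [Finset.coe_union]; exact Or.inr (Or.inr h))⟩
  have e1 := hYa _ hEz
  have e2 := hYb _ hE'z
  -- The chain is `Φ (x₁ x₂ z) = Ψ (x₁ E(x₂ z)) ≈ Ψ x₁ * ω (E(x₂ z)) = Ψ x₁ * Ψ (x₂ E'(z)) ≈ Ψ x₁ *
  -- Ψ x₂ * ω (E'(z)) = Φ (x₁ x₂) * ω z`.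
  have e3 : Φ (x₁ * x₂ * z) - Φ (x₁ * x₂) * ω z =
      (Ψ (x₁ * E (x₂ * z)) - Ψ x₁ * ω (E (x₂ * z))) +
        Ψ x₁ * (Ψ (x₂ * E' z) - Ψ x₂ * ω (E' z)) := by
    rw [mul_assoc x₁, ha, hΦ _ _ hx₁ (hx₂.mono hY₂), hc, he]; ring
  have e4 : ε / (8 * (‖x₂‖ + 1)) * ‖E (x₂ * z)‖ ≤ ε / 2 * ‖z‖ := by
    calc _ ≤ ε / (8 * (‖x₂‖ + 1)) * (4 * ((‖x₂‖ + 1) * ‖z‖)) := by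
          gcongr
          refine (hE.norm_apply_le _).trans ?_
          gcongr
          refine (norm_mul_le _ _).trans ?_
          gcongr
          linarith
      _ = ε / 2 * ‖z‖ := by field_simp; ring
  have e5 : ‖Ψ x₁ * (Ψ (x₂ * E' z) - Ψ x₂ * ω (E' z))‖ ≤ ε / 2 * ‖z‖ := by
    rw [norm_mul]
    calc _ ≤ (‖x₁‖ + 1) * (ε / (8 * (‖x₁‖ + 1)) * (4 * ‖z‖)) := by
          gcongr
          · linarith [Ψ.norm_apply_le x₁]
          · refine e2.trans ?_
            gcongr
            exact hE'.norm_apply_le z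
      _ = ε / 2 * ‖z‖ := by field_simp; ring
  rw [e3]
  refine (norm_add_le _ _).trans ?_
  linarith

/-- The split property of a clustering state which is a product at infinity. -/
theorem exists_isTensor_quasiEquivalent {Ψ ω : S.State Set.univ} {I J : Set S.Site}
    (hIJ : Disjoint I J)
    (hgr : (Ψ.restrict (Set.subset_univ I)).IsGraded ∨ (Ψ.restrict (Set.subset_univ J)).IsGraded)
    (hω : ∀ x, ω (S.grading Set.univ x) = ω x) (hΨ : ∀ b, AsympFactor Ψ ω Set.univ b)
    (X : Finset S.Site)
    (hX : ∀ x y, InAlgebra x (I \ X) → InAlgebra y (J \ X) →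
      ω (x * y) = ω x * ω y ∧ ω (y * x) = ω y * ω x) :
    ∃ Φ : S.State (I ∪ J), Φ.IsTensor (Ψ.restrict (Set.subset_univ I))
      (Ψ.restrict (Set.subset_univ J)) ∧
        (Ψ.restrict (Set.subset_univ (I ∪ J))).QuasiEquivalent Φ := by
  have hgr' : ∀ L : Set S.Site, (Ψ.restrict (Set.subset_univ L)).IsGraded →
      ∀ y, InAlgebra y L → Ψ (S.grading Set.univ y) = Ψ y := by
    intro L hL y hy
    have h1 := hL (mkObs y.1 hy)
    rw [restrict_apply, restrict_apply] at h1
    have h2 : incl (Set.subset_univ L) (mkObs y.1 hy) = y :=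
      obs_ext ((incl_val _ _).trans (mkObs_val _ _))
    have h3 : incl (Set.subset_univ L) (S.grading L (mkObs y.1 hy)) = S.grading Set.univ y := by
      refine obs_ext ?_
      rw [incl_val, grading_val, grading_val]
      exact congrArg (fun b => S.parityOp * b * S.parityOp) (mkObs_val y.1 hy)
    rwa [h2, h3] at h1
  have hΨK : ∀ b, InAlgebra b (I ∪ J) → AsympFactor Ψ ω (I ∪ J) b := fun b _ ε hε => by
    obtain ⟨Y, hY⟩ := hΨ b ε hε
    exact ⟨Y, fun z hz => hY z (hz.mono (Set.sdiff_subset_sdiff_left (Set.subset_univ _)))⟩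
  suffices h : ∃ Φ : S.State Set.univ,
      (∀ x y, InAlgebra x I → InAlgebra y J → Φ (x * y) = Ψ x * Ψ y) ∧
        ∀ b, InAlgebra b (I ∪ J) → AsympFactor Φ ω (I ∪ J) b by
    obtain ⟨Φ, h1, h2⟩ := h
    refine ⟨Φ.restrict (Set.subset_univ _), fun x y => ?_, quasiEquivalent_of_asympFactor hΨK h2⟩
    rw [restrict_apply, restrict_apply, restrict_apply, map_mul]
    have e1 : incl (Set.subset_univ (I ∪ J)) (incl Set.subset_union_left x) =
        incl (Set.subset_univ I) x := obs_ext (by rw [incl_val, incl_val, incl_val])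
    have e2 : incl (Set.subset_univ (I ∪ J)) (incl Set.subset_union_right y) =
        incl (Set.subset_univ J) y := obs_ext (by rw [incl_val, incl_val, incl_val])
    rw [e1, e2]
    exact h1 _ _ (inAlgebra_incl _ x.2) (inAlgebra_incl _ y.2)
  -- The graded factor is the one that is sliced out, so the roles of `I` and `J` are exchanged if
  -- it lives on `I`. This is why `ω` is required to factorize in both orders.
  rcases hgr with h | h
  · obtain ⟨Φ, hΦ⟩ := Ψ.exists_product hIJ.symm (hgr' I h)
    refine ⟨Φ, fun x y hx hy => by rw [(hΦ y x hy hx).2, mul_comm], fun b hb => ?_⟩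
    rw [Set.union_comm] at hb ⊢
    exact product_asympFactor hIJ.symm (hgr' I h) hω hΨ (fun y x hy hx => (hΦ y x hy hx).1) X
      (fun y x hy hx => (hX x y hx hy).2) hb
  · obtain ⟨Φ, hΦ⟩ := Ψ.exists_product hIJ (hgr' J h)
    refine ⟨Φ, fun x y hx hy => (hΦ x y hx hy).1, fun b hb => ?_⟩
    exact product_asympFactor hIJ (hgr' J h) hω hΨ (fun x y hx hy => (hΦ x y hx hy).1) X
      (fun x y hx hy => (hX x y hx hy).1) hb

end State

/-! ### Embedding the algebra of a system into that of a stack -/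

section Ampliation

variable {H : Type*} [NormedAddCommGroup H] [InnerProductSpace ℂ H] {ι : Type*}

lemma sum_norm_apply_le (x : H →L[ℂ] H) (ψ : lp (fun _ : ι => H) 2) (F : Finset ι) :
    ∑ i ∈ F, ‖x (ψ i)‖ ^ (2 : ENNReal).toReal ≤ (‖x‖ * ‖ψ‖) ^ (2 : ENNReal).toReal := by
  have h2 : (2 : ENNReal).toReal = ((2 : ℕ) : ℝ) := by simp
  have key := lp.sum_rpow_le_norm_rpow (p := 2) (by simp) ψ F
  simp only [h2, Real.rpow_natCast] at key ⊢
  calc ∑ i ∈ F, ‖x (ψ i)‖ ^ 2 ≤ ∑ i ∈ F, ‖x‖ ^ 2 * ‖ψ i‖ ^ 2 := by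
        refine Finset.sum_le_sum fun i _ => ?_
        rw [← mul_pow]
        gcongr
        exact x.le_opNorm _
    _ = ‖x‖ ^ 2 * ∑ i ∈ F, ‖ψ i‖ ^ 2 := by rw [Finset.mul_sum]
    _ ≤ ‖x‖ ^ 2 * ‖ψ‖ ^ 2 := by gcongr
    _ = (‖x‖ * ‖ψ‖) ^ 2 := by ring

variable (ι) in
/-- The operator `x ⊗ 1` on the Hilbert sum of copies of a Hilbert space. -/
def ampliationOp (x : H →L[ℂ] H) : lp (fun _ : ι => H) 2 →L[ℂ] lp (fun _ : ι => H) 2 :=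
  LinearMap.mkContinuous
    { toFun := fun ψ => ⟨fun i => x (ψ i), memℓp_gen' (sum_norm_apply_le x ψ)⟩
      map_add' := fun ψ φ => by ext i; exact map_add x _ _
      map_smul' := fun a ψ => by ext i; exact map_smul x _ _ }
    ‖x‖ (fun ψ => lp.norm_le_of_forall_sum_le (by simp)
      (mul_nonneg (norm_nonneg _) (norm_nonneg _)) (sum_norm_apply_le x ψ))

lemma ampliationOp_apply (x : H →L[ℂ] H) (ψ : lp (fun _ : ι => H) 2) (i : ι) :
    ampliationOp ι x ψ i = x (ψ i) := rfl

variable (H ι) in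
/-- The representation `x ↦ x ⊗ 1`. -/
def ampliation [CompleteSpace H] :
    (H →L[ℂ] H) →⋆ₐ[ℂ] (lp (fun _ : ι => H) 2 →L[ℂ] lp (fun _ : ι => H) 2) where
  toFun := ampliationOp ι
  map_one' := by ext ψ i; rfl
  map_mul' x y := by ext ψ i; rfl
  map_zero' := by ext ψ i; rfl
  map_add' x y := by ext ψ i; rfl
  commutes' r := by
    ext ψ i
    rw [ampliationOp_apply, Algebra.algebraMap_eq_smul_one, Algebra.algebraMap_eq_smul_one]
    rfl
  map_star' x := by
    rw [ContinuousLinearMap.star_eq_adjoint (ampliationOp ι x)]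
    refine (ContinuousLinearMap.eq_adjoint_iff _ _).mpr fun ψ φ => ?_
    rw [lp.inner_eq_tsum, lp.inner_eq_tsum]
    refine tsum_congr fun i => ?_
    rw [ampliationOp_apply, ampliationOp_apply, ContinuousLinearMap.star_eq_adjoint,
      ContinuousLinearMap.adjoint_inner_left]

end Ampliation

section StackEmbedding

/-- A site of the first system as a site of the stack. -/
def siteL (T : SpinSystem k) (j : S.Site) : (stack S T).Site := (Sum.inl j : S.Site ⊕ T.Site)

/-- A site of the second system as a site of the stack. -/
def siteR (S : SpinSystem k) {T : SpinSystem k} (j : T.Site) : (stack S T).Site :=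
  (Sum.inr j : S.Site ⊕ T.Site)

variable {T : SpinSystem k}

lemma siteL_injective : Function.Injective (siteL T : S.Site → _) := Sum.inl_injective

lemma siteR_injective : Function.Injective (siteR S : T.Site → _) := Sum.inr_injective

lemma siteL_ne_siteR (i : S.Site) (j : T.Site) : siteL T i ≠ siteR S j := Sum.inl_ne_inr

lemma site_cases {P : (stack S T).Site → Prop} (hL : ∀ j, P (siteL T j)) (hR : ∀ j, P (siteR S j))
    (i : (stack S T).Site) : P i := by
  rcases i with j | j
  · exact hL j
  · exact hR j

/-- A label of a site of the first system as a label of the stack. -/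
def lblL (T : SpinSystem k) {j : S.Site} : S.Label j ≃+ (stack S T).Label (siteL T j) :=
  AddEquiv.refl (S.Label j)

/-- A label of a site of the second system as a label of the stack. -/
def lblR (S : SpinSystem k) {T : SpinSystem k} {j : T.Site} :
    T.Label j ≃+ (stack S T).Label (siteR S j) :=
  AddEquiv.refl (T.Label j)

variable (S T) in
/-- The first component of a configuration of a stack. -/
def cfgL : (stack S T).Config →+ S.Config :=
  (DFinsupp.mapRange.addMonoidHom fun j : S.Site => (lblL T (j := j)).symm.toAddMonoidHom).comp
    { toFun := DFinsupp.comapDomain (siteL T) siteL_injective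
      map_zero' := DFinsupp.comapDomain_zero _ _
      map_add' := DFinsupp.comapDomain_add _ _ }

variable (S T) in
/-- The second component of a configuration of a stack. -/
def cfgR : (stack S T).Config →+ T.Config :=
  (DFinsupp.mapRange.addMonoidHom fun j : T.Site => (lblR S (j := j)).symm.toAddMonoidHom).comp
    { toFun := DFinsupp.comapDomain (siteR S) siteR_injective
      map_zero' := DFinsupp.comapDomain_zero _ _
      map_add' := DFinsupp.comapDomain_add _ _ }

lemma cfgL_apply (c : (stack S T).Config) (j : S.Site) :
    cfgL S T c j = (lblL T).symm (c (siteL T j)) := rfl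

lemma cfgR_apply (c : (stack S T).Config) (j : T.Site) :
    cfgR S T c j = (lblR S).symm (c (siteR S j)) := rfl

/-- The configuration of the stack with label `v` at the site `j` of the first system. -/
def singleL (T : SpinSystem k) (j : S.Site) (v : S.Label j) : (stack S T).Config :=
  DFinsupp.single (siteL T j) (lblL T v)

/-- The configuration of the stack with label `v` at the site `j` of the second system. -/
def singleR (S : SpinSystem k) {T : SpinSystem k} (j : T.Site) (v : T.Label j) :
    (stack S T).Config :=
  DFinsupp.single (siteR S j) (lblR S v)

lemma cfgL_singleL (j : S.Site) (v : S.Label j) :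
    cfgL S T (singleL T j v) = DFinsupp.single j v := by
  ext1 i
  rw [cfgL_apply, singleL]
  by_cases h : i = j
  · subst h
    rw [DFinsupp.single_eq_same, DFinsupp.single_eq_same, AddEquiv.symm_apply_apply]
  · rw [DFinsupp.single_eq_of_ne h, DFinsupp.single_eq_of_ne (siteL_injective.ne h), map_zero]

lemma cfgR_singleL (j : S.Site) (v : S.Label j) : cfgR S T (singleL T j v) = 0 := by
  ext1 i
  rw [cfgR_apply, singleL, DFinsupp.single_eq_of_ne (siteL_ne_siteR j i).symm, map_zero,
    DFinsupp.zero_apply]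

lemma cfgL_singleR (j : T.Site) (v : T.Label j) : cfgL S T (singleR S j v) = 0 := by
  ext1 i
  rw [cfgL_apply, singleR, DFinsupp.single_eq_of_ne (siteL_ne_siteR i j), map_zero,
    DFinsupp.zero_apply]

lemma cfgR_singleR (j : T.Site) (v : T.Label j) :
    cfgR S T (singleR S j v) = DFinsupp.single j v := by
  ext1 i
  rw [cfgR_apply, singleR]
  by_cases h : i = j
  · subst h
    rw [DFinsupp.single_eq_same, DFinsupp.single_eq_same, AddEquiv.symm_apply_apply]
  · rw [DFinsupp.single_eq_of_ne h, DFinsupp.single_eq_of_ne (siteR_injective.ne h), map_zero]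

lemma stack_parity_lblL (j : S.Site) (v : S.Label j) :
    (stack S T).parity (siteL T j) (lblL T v) = S.parity j v := by
  cases k <;> rfl

lemma cfg_ext {c d : (stack S T).Config} (hL : cfgL S T c = cfgL S T d)
    (hR : cfgR S T c = cfgR S T d) : c = d := by
  refine DFinsupp.ext fun i => ?_
  revert i
  refine site_cases (fun i => ?_) fun i => ?_
  · exact (lblL T).symm.injective (DFunLike.congr_fun hL i)
  · exact (lblR S).symm.injective (DFunLike.congr_fun hR i)

lemma exists_cfg (s : S.Config) (t : T.Config) :
    ∃ c : (stack S T).Config, cfgL S T c = s ∧ cfgR S T c = t := by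
  induction s using DFinsupp.induction with
  | h0 =>
    induction t using DFinsupp.induction with
    | h0 => exact ⟨0, map_zero _, map_zero _⟩
    | ha j v t _ _ ih =>
      obtain ⟨c, h1, h2⟩ := ih
      refine ⟨singleR S j v + c, ?_, ?_⟩
      · rw [map_add, cfgL_singleR, h1, add_zero]
      · rw [map_add, cfgR_singleR, h2]
  | ha j v s _ _ ih =>
    obtain ⟨c, h1, h2⟩ := ih
    refine ⟨singleL T j v + c, ?_, ?_⟩
    · rw [map_add, cfgL_singleL, h1]
    · rw [map_add, cfgR_singleL, h2, zero_add]

lemma cfg_induction {P : (stack S T).Config → Prop} (zero : P 0)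
    (hL : ∀ i x c, P c → P (singleL T i x + c)) (hR : ∀ i x c, P c → P (singleR S i x + c))
    (c : (stack S T).Config) : P c := by
  induction c using DFinsupp.induction with
  | h0 => exact zero
  | ha i x c _ _ ih =>
    revert x
    refine site_cases (P := fun i => ∀ x : (stack S T).Label i, x ≠ 0 → P (DFinsupp.single i x + c))
      (fun j x _ => ?_) (fun j x _ => ?_) i
    · have := hL j ((lblL T).symm x) c ih
      rwa [singleL, AddEquiv.apply_symm_apply] at this
    · have := hR j ((lblR S).symm x) c ih
      rwa [singleR, AddEquiv.apply_symm_apply] at this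

/-- The bilinear form on configurations with given weights of the pairs of sites. -/
def parityForm (W : S.Site → S.Site → ZMod 2) : S.Config →+ S.Config →+ ZMod 2 :=
  DFinsupp.sumAddHom fun i => AddMonoidHom.mk'
    (fun x => DFinsupp.sumAddHom fun j =>
      (AddMonoidHom.mulLeft (W i j * S.parity i x)).comp (S.parity j))
    (fun x y => by
      refine DFinsupp.addHom_ext fun j v => ?_
      rw [AddMonoidHom.add_apply, DFinsupp.sumAddHom_single, DFinsupp.sumAddHom_single,
        DFinsupp.sumAddHom_single]
      simp only [AddMonoidHom.comp_apply, AddMonoidHom.coe_mulLeft, map_add]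
      ring)

lemma parityForm_single_single (W : S.Site → S.Site → ZMod 2) (i j : S.Site) (x : S.Label i)
    (y : S.Label j) : parityForm W (DFinsupp.single i x) (DFinsupp.single j y) =
      W i j * S.parity i x * S.parity j y := by
  rw [parityForm, DFinsupp.sumAddHom_single]
  exact DFinsupp.sumAddHom_single _ _ _

open Classical in
/-- The pairs of sites of a stack whose order has to be reversed in order to have the sites of the
first system, in their own order, before all others. -/
def stackWeight (S T : SpinSystem k) : (stack S T).Site → (stack S T).Site → ZMod 2
  | Sum.inl i, Sum.inl j =>
    if WellOrderingRel i j ∧ WellOrderingRel (siteL T j) (siteL T i) then 1 else 0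
  | Sum.inr i, Sum.inl j => if WellOrderingRel (siteR S i) (siteL T j) then 1 else 0
  | _, Sum.inr _ => 0

open Classical in
lemma stackWeight_inl_inl (i j : S.Site) : stackWeight S T (siteL T i) (siteL T j) =
    if WellOrderingRel i j ∧ WellOrderingRel (siteL T j) (siteL T i) then 1 else 0 := rfl

open Classical in
lemma stackWeight_inr_inl (i : T.Site) (j : S.Site) : stackWeight S T (siteR S i) (siteL T j) =
    if WellOrderingRel (siteR S i) (siteL T j) then 1 else 0 := rfl

lemma stackWeight_inr (i : S.Site) (j : T.Site) : stackWeight S T (siteL T i) (siteR S j) = 0 := rfl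

/-- The exponent of the sign of the reordering of the sites of a stack. -/
def stackSign (c : (stack S T).Config) : ZMod 2 := parityForm (stackWeight S T) c c

/-- Both sides are additive in `c`, so single sites suffice. A site of the first system contributes
exactly when the two well-orderings disagree on its order relative to `j`; a site of the second
system contributes exactly when it precedes `j` in the stack. -/
lemma stackWeight_symm (j : S.Site) (v : S.Label j) (c : (stack S T).Config) :
    parityForm (stackWeight S T) c (singleL T j v) + parityForm (stackWeight S T) (singleL T j v) c =
      S.parity j v * ((stack S T).parityBefore (siteL T j) c +
        S.parityBefore j (cfgL S T c)) := by
  classical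
  have h : ∀ a b : (stack S T).Config,
      parityForm (stackWeight S T) (a + b) (singleL T j v) +
        parityForm (stackWeight S T) (singleL T j v) (a + b) =
      (parityForm (stackWeight S T) a (singleL T j v) +
        parityForm (stackWeight S T) (singleL T j v) a) +
      (parityForm (stackWeight S T) b (singleL T j v) +
        parityForm (stackWeight S T) (singleL T j v) b) := fun a b => by
    rw [map_add, map_add, AddMonoidHom.add_apply]; ring
  revert c
  refine cfg_induction (by simp) (fun i x c ih => ?_) (fun i x c ih => ?_)
  · rw [h, ih, map_add, map_add, map_add, cfgL_singleL]
    have h2 : parityForm (stackWeight S T) (singleL T i x) (singleL T j v) +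
        parityForm (stackWeight S T) (singleL T j v) (singleL T i x) =
        S.parity j v * ((stack S T).parityBefore (siteL T j)
          (singleL T i x) + S.parityBefore j (DFinsupp.single i x)) := by
      rw [singleL, singleL, parityForm_single_single, parityForm_single_single, stack_parity_lblL,
        stack_parity_lblL, parityBefore_single, parityBefore_single, stack_parity_lblL,
        stackWeight_inl_inl, stackWeight_inl_inl]
      generalize S.parity i x = p
      generalize S.parity j v = q
      rcases trichotomous_of WellOrderingRel i j with hij | hij | hij
      · have hij' := asymm_of WellOrderingRel hij
        rcases trichotomous_of WellOrderingRel (siteL T i) (siteL T j) with h | h | h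
        · have h' := asymm_of WellOrderingRel h
          simp only [hij, hij', h, h', and_false, if_true, if_false]
          revert p q; decide
        · exact absurd (siteL_injective h ▸ hij) (irrefl_of WellOrderingRel _)
        · have h' := asymm_of WellOrderingRel h
          simp only [hij, hij', h, h', and_self, if_true, if_false]
          revert p q; decide
      · subst hij
        simp only [irrefl_of WellOrderingRel, and_self, if_false]
        ring
      · have hij' := asymm_of WellOrderingRel hij
        rcases trichotomous_of WellOrderingRel (siteL T i) (siteL T j) with h | h | h
        · have h' := asymm_of WellOrderingRel h
          simp only [hij, hij', h, h', and_self, if_true, if_false]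
          revert p q; decide
        · exact absurd (siteL_injective h ▸ hij) (irrefl_of WellOrderingRel _)
        · have h' := asymm_of WellOrderingRel h
          simp only [hij, hij', h, h', and_false, if_false]
          revert p q; decide
    rw [h2]
    ring
  · rw [h, ih, map_add, map_add, map_add, cfgL_singleR, map_zero]
    have h2 : parityForm (stackWeight S T) (singleR S i x) (singleL T j v) +
        parityForm (stackWeight S T) (singleL T j v) (singleR S i x) =
        S.parity j v * (stack S T).parityBefore (siteL T j) (singleR S i x) := by
      rw [singleL, singleR, parityForm_single_single, parityForm_single_single, stack_parity_lblL,
        parityBefore_single, stackWeight_inr, stackWeight_inr_inl]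
      split_ifs <;> ring
    rw [h2]
    ring

/-- Since `stackSign` is a quadratic form vanishing on single labels of the first system, a shift
changes it by the polarization, which is the difference of the Koszul exponents at `j` in the stack
and in the first system. -/
lemma stackSign_add_singleL (j : S.Site) (v : S.Label j) (c : (stack S T).Config) :
    stackSign (c + singleL T j v) = stackSign c +
      S.parity j v * ((stack S T).parityBefore (siteL T j) c +
        S.parityBefore j (cfgL S T c)) := by
  have h : parityForm (stackWeight S T) (singleL T j v) (singleL T j v) = 0 := by
    classical
    rw [singleL, parityForm_single_single, stackWeight_inl_inl,
      if_neg (fun h => irrefl_of WellOrderingRel j h.1), zero_mul, zero_mul]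
  rw [← stackWeight_symm, stackSign, stackSign, map_add, map_add, AddMonoidHom.add_apply,
    AddMonoidHom.add_apply, h]
  ring

variable (S T) in
/-- The basis of the Hilbert sum of copies of the Hilbert space of the first system which is labelled
by the configurations of the stack. -/
def stackVec (c : (stack S T).Config) : lp (fun _ : T.Config => S.Fock) 2 := by
  classical
  exact lp.single 2 (cfgR S T c) (lp.single 2 (cfgL S T c) (sgn (stackSign c)))

lemma inner_stackVec (c : (stack S T).Config) (η : lp (fun _ : T.Config => S.Fock) 2) :
    inner ℂ (stackVec S T c) η = sgn (stackSign c) * η (cfgR S T c) (cfgL S T c) := by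
  classical
  rw [stackVec, lp.inner_single_left, lp.inner_single_left, RCLike.inner_apply,
    starRingEnd_apply, star_sgn, mul_comm]

lemma orthonormal_stackVec : Orthonormal ℂ (stackVec S T) := by
  classical
  rw [orthonormal_iff_ite]
  intro c d
  rw [inner_stackVec, stackVec]
  by_cases hR : cfgR S T c = cfgR S T d
  · by_cases hL : cfgL S T c = cfgL S T d
    · have hcd := cfg_ext hL hR
      subst hcd
      rw [if_pos rfl, lp.single_apply_self, lp.single_apply_self, sgn_mul_self]
    · rw [if_neg fun h => hL (congrArg (cfgL S T) h), hR, lp.single_apply_self, lp.single_apply_ne _ _ _ hL,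
        mul_zero]
  · rw [if_neg fun h => hR (congrArg (cfgR S T) h), lp.single_apply_ne _ _ _ hR]
    exact mul_zero _

variable (S T) in
/-- The Hilbert basis of the vectors `stackVec`. -/
def stackBasis : HilbertBasis (stack S T).Config ℂ (lp (fun _ : T.Config => S.Fock) 2) :=
  HilbertBasis.mkOfOrthogonalEqBot orthonormal_stackVec (by
    rw [Submodule.eq_bot_iff]
    intro η hη
    ext t s
    obtain ⟨c, rfl, rfl⟩ := exists_cfg (S := S) (T := T) s t
    have h := (Submodule.mem_orthogonal _ _).mp hη _ (Submodule.subset_span ⟨c, rfl⟩)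
    rw [inner_stackVec] at h
    have h' := congrArg (fun a => sgn (stackSign c) * a) h
    simp only [← mul_assoc, sgn_mul_self, one_mul, mul_zero] at h'
    exact h')

lemma stackBasis_repr (η : lp (fun _ : T.Config => S.Fock) 2) (c : (stack S T).Config) :
    (stackBasis S T).repr η c = sgn (stackSign c) * η (cfgR S T c) (cfgL S T c) := by
  rw [HilbertBasis.repr_apply_apply, stackBasis, HilbertBasis.coe_mkOfOrthogonalEqBot,
    inner_stackVec]

variable (S T) in
/-- The representation of the operators of the first system on the Hilbert space of the stack. -/
def stackRep : (S.Fock →L[ℂ] S.Fock) →⋆ₐ[ℂ] ((stack S T).Fock →L[ℂ] (stack S T).Fock) :=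
  ((stackBasis S T).repr.conjStarAlgEquiv : _ →⋆ₐ[ℂ] _).comp (ampliation S.Fock T.Config)

lemma stackRep_apply (x : S.Fock →L[ℂ] S.Fock) (ξ : (stack S T).Fock) (c : (stack S T).Config) :
    stackRep S T x ξ c = sgn (stackSign c) *
      x ((stackBasis S T).repr.symm ξ (cfgR S T c)) (cfgL S T c) := by
  change (stackBasis S T).repr (ampliationOp T.Config x ((stackBasis S T).repr.symm ξ)) c = _
  rw [stackBasis_repr, ampliationOp_apply]

/-- An on-site operator of the first system as an on-site operator of the stack. -/
def matL (T : SpinSystem k) {j : S.Site} (M : S.OnSite j) : (stack S T).OnSite (siteL T j) :=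
  Matrix.of fun a b => M ((lblL T).symm a) ((lblL T).symm b)

/-- The ampliation carries the Koszul signs for the order of the first system. The signs in the
basis `stackVec` are chosen so that conjugation turns them into the signs for the order of the
stack. -/
lemma stackRep_onSite (j : S.Site) (M : S.OnSite j) :
    stackRep S T (S.onSite j M) = (stack S T).onSite (siteL T j) (matL T M) := by
  ext ξ c
  set η := (stackBasis S T).repr.symm ξ with hη
  have hξ : ∀ d, ξ d = sgn (stackSign d) * η (cfgR S T d) (cfgL S T d) := fun d => by
    rw [← stackBasis_repr, hη, LinearIsometryEquiv.apply_symm_apply]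
  rw [stackRep_apply, onSite_apply, onSite_apply, Finset.mul_sum,
    ← Equiv.sum_comp (lblL T (j := j)).toEquiv]
  refine Finset.sum_congr rfl fun v _ => ?_
  have h1 : DFinsupp.single (siteL T j) ((lblL T (j := j)).toEquiv v) = singleL T j v := rfl
  have h2 : (lblL T (j := j)).toEquiv v = lblL T v := rfl
  rw [h1, h2, hξ, stackSign_add_singleL, map_add, map_add, cfgR_singleL, cfgL_singleL, add_zero,
    matL, Matrix.of_apply, map_add, AddEquiv.symm_apply_apply, stack_parity_lblL, ← cfgL_apply,
    sgn_add, mul_add, sgn_add]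
  have h3 := sgn_mul_self (S.parity j v * (stack S T).parityBefore (siteL T j) c)
  linear_combination (-(sgn (stackSign c) * sgn (S.parity j v * S.parityBefore j (cfgL S T c)) *
    M (cfgL S T c j) (cfgL S T c j + v) *
      η (cfgR S T c) (cfgL S T c + DFinsupp.single j v))) * h3

lemma stackRep_mem {x : S.Fock →L[ℂ] S.Fock} (hx : x ∈ S.algebra Set.univ) :
    stackRep S T x ∈ (stack S T).algebra Set.univ := by
  have hcont : Continuous (stackRep S T) :=
    AddMonoidHomClass.continuous_of_bound (stackRep S T) 1 fun x => by
      rw [one_mul]; exact NonUnitalStarAlgHom.norm_apply_le (stackRep S T) x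
  have hle : S.algebra Set.univ ≤ ((stack S T).algebra Set.univ).comap (stackRep S T) := by
    refine StarSubalgebra.topologicalClosure_minimal (StarAlgebra.adjoin_le ?_) ?_
    · rintro _ ⟨j, hj, M, rfl⟩
      change stackRep S T (S.onSite j M) ∈ (stack S T).algebra Set.univ
      rw [stackRep_onSite]
      exact (stack S T).onSite_mem (Set.mem_univ _) _
    · exact (StarSubalgebra.isClosed_topologicalClosure _).preimage hcont
  exact hle hx

variable (S T) in
/-- The embedding of the algebra of the first system into the algebra of the stack. -/
def embL : S.Obs Set.univ →⋆ₐ[ℂ] (stack S T).Obs Set.univ :=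
  StarAlgHom.codRestrict ((stackRep S T).comp (S.algebra Set.univ).subtype)
    ((stack S T).algebra Set.univ) (fun x => stackRep_mem x.2)

lemma embL_val (x : S.Obs Set.univ) : (embL S T x).1 = stackRep S T x.1 := by
  unfold embL
  rfl

lemma embL_site (j : S.Site) (M : S.OnSite j) :
    embL S T (S.site j M) = (stack S T).site (siteL T j) (matL T M) :=
  obs_ext ((embL_val _).trans (stackRep_onSite j M))

end StackEmbedding

/-! ### States of stacks -/

section StackStates

variable {T : SpinSystem k}

lemma norm_embL_le (x : S.Obs Set.univ) : ‖embL S T x‖ ≤ ‖x‖ :=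
  NonUnitalStarAlgHom.norm_apply_le (embL S T) x

lemma continuous_embL : Continuous (embL S T) :=
  AddMonoidHomClass.continuous_of_bound (embL S T) 1 fun x => by
    rw [one_mul]; exact norm_embL_le x

lemma InAlgebra.embL {J : Set S.Site} {x : S.Obs Set.univ} (hx : InAlgebra x J) :
    InAlgebra (embL S T x) (siteL T '' J) := by
  refine InAlgebra.induction (P := fun x => InAlgebra (SpinSystem.embL S T x) (siteL T '' J))
    ((isClosed_inAlgebra _ _).preimage continuous_embL) ?_ ?_ ?_ ?_ hx
  · rw [map_one]; exact InAlgebra.one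
  · intro x y _ _ hx hy
    rw [map_add]; exact hx.add hy
  · intro c x _ hx
    rw [map_smul]; exact hx.smul c
  · intro j hj M x _ hx
    rw [map_mul, embL_site]
    exact (site_mem (Set.mem_image_of_mem _ hj) _).mul hx

lemma stack_parity_sub (j : S.Site) (a b : (stack S T).Label (siteL T j)) :
    (stack S T).parity (siteL T j) (b - a) =
      S.parity j ((lblL T).symm b - (lblL T).symm a) := by
  rw [← map_sub, ← stack_parity_lblL (T := T) j ((lblL T).symm (b - a)),
    AddEquiv.apply_symm_apply]

lemma embL_grading (x : S.Obs Set.univ) :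
    embL S T (S.grading Set.univ x) = (stack S T).grading Set.univ (embL S T x) := by
  refine InAlgebra.induction
    (P := fun x => embL S T (S.grading Set.univ x) = (stack S T).grading Set.univ (embL S T x))
    (isClosed_eq (continuous_embL.comp (continuous_grading _))
      ((continuous_grading _).comp continuous_embL)) ?_ ?_ ?_ ?_ (inAlgebra_univ x)
  · rw [map_one, map_one, map_one]
  · intro x y _ _ hx hy
    rw [map_add, map_add, map_add, map_add, hx, hy]
  · intro c x _ hx
    rw [map_smul, map_smul, map_smul, map_smul, hx]
  · intro j _ M x _ hx
    rw [map_mul, map_mul, map_mul, map_mul, hx, grading_site, embL_site, embL_site, grading_site]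
    congr 2
    ext a b
    rw [matL, Matrix.of_apply, Matrix.of_apply, Matrix.of_apply, stack_parity_sub, matL,
      Matrix.of_apply]

lemma word_cons (p : Σ j, S.OnSite j) (w : List (Σ j, S.OnSite j)) :
    S.word (p :: w) = S.site p.1 p.2 * S.word w := by
  rw [word, word, List.map_cons, List.prod_cons]

lemma word_nil : S.word [] = 1 := rfl

lemma word_append (w w' : List (Σ j, S.OnSite j)) : S.word (w ++ w') = S.word w * S.word w' := by
  rw [word, word, word, List.map_append, List.prod_append]

lemma word_inlWord (w : List (Σ j, S.OnSite j)) :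
    (stack S T).word (inlWord T w) = embL S T (S.word w) := by
  induction w with
  | nil => rw [word_nil, map_one]; rfl
  | cons p w ih =>
    rw [word_cons, map_mul, embL_site, ← ih]
    exact word_cons (S := stack S T) _ _

/-- A stack is specified on words only. Keeping an arbitrary word `w` to the left of `x` makes the
claim inductive: an on-site factor split off from `x` is appended to `w`. -/
lemma IsStack.apply_embL {Φ : (stack S T).State Set.univ} {φ : S.State Set.univ}
    {ψ : T.State Set.univ} (h : IsStack Φ φ ψ) (x : S.Obs Set.univ) : Φ (embL S T x) = φ x := by
  suffices h' : ∀ w, Φ (embL S T (S.word w * x)) = φ (S.word w * x) by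
    simpa only [word_nil, one_mul] using h' []
  refine InAlgebra.induction
    (P := fun x => ∀ w, Φ (embL S T (S.word w * x)) = φ (S.word w * x)) ?_ ?_ ?_ ?_ ?_
    (inAlgebra_univ x)
  · rw [Set.ofPred_forall]
    exact isClosed_iInter fun w => isClosed_eq
      (Φ.continuous.comp (continuous_embL.comp (by fun_prop))) (φ.continuous.comp (by fun_prop))
  · intro w
    have h1 := h w []
    have h2 : (stack S T).word (inrWord S ([] : List (Σ j, T.OnSite j))) = 1 := rfl
    rw [h2, word_inlWord, mul_one, word_nil, ψ.map_one, mul_one] at h1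
    rw [mul_one, h1]
  · intro x y _ _ hx hy w
    rw [mul_add, map_add, map_add, map_add, hx, hy]
  · intro c x _ hx w
    rw [mul_smul_comm, map_smul, map_smul, map_smul, hx]
  · intro j _ M x _ hx w
    have h1 := hx (w ++ [⟨j, M⟩])
    rwa [word_append, word_cons, word_nil, mul_one, mul_assoc] at h1

lemma State.IsTrivial.exists_vec {φ : S.State Set.univ} (h : φ.IsTrivial) :
    ∃ v : ∀ j : S.Site, S.Label j → ℂ, (∀ j, ∑ a, ‖v j a‖ ^ 2 = 1) ∧
      (∀ j a, S.parity j a ≠ 0 → v j a = 0) ∧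
        ∀ j, φ (S.word [⟨j, Matrix.vecMulVec (v j) (star (v j))⟩]) = 1 := by
  obtain ⟨v, h1, h2, h3⟩ := h
  refine ⟨v, h1, h2, fun j => ?_⟩
  have h4 := h3 [j] (fun j => Matrix.vecMulVec (v j) (star (v j))) (List.nodup_singleton j)
  rw [word_cons, word_nil, mul_one]
  rw [List.map_singleton, List.map_singleton, List.prod_singleton, List.prod_singleton] at h4
  rw [h4]
  have h5 : ∑ a, star (v j a) * v j a = 1 := by
    have h6 : ∀ a, star (v j a) * v j a = ((‖v j a‖ ^ 2 : ℝ) : ℂ) := fun a => by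
      rw [Complex.star_def, ← Complex.normSq_eq_conj_mul_self, Complex.normSq_eq_norm_sq]
    simp only [h6]
    rw [← Complex.ofReal_sum, h1, Complex.ofReal_one]
  calc ∑ a, ∑ b, star (v j a) * Matrix.vecMulVec (v j) (star (v j)) a b * v j b
      = ∑ a, ∑ b, (star (v j a) * v j a) * (star (v j b) * v j b) := by
        refine Finset.sum_congr rfl fun a _ => Finset.sum_congr rfl fun b _ => ?_
        rw [Matrix.vecMulVec_apply, Pi.star_apply]
        ring
    _ = 1 := by rw [← Finset.sum_mul_sum, h5, one_mul]

/-- The on-site vectors of the two systems are put together; the expectation of each rank one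
projection is obtained by taking the empty word for the other system. -/
lemma IsStack.isProductVector {Φ : (stack S T).State Set.univ} {φ : S.State Set.univ}
    {ψ : T.State Set.univ} (h : IsStack Φ φ ψ) (hφ : φ.IsTrivial) (hψ : ψ.IsTrivial) :
    Φ.IsProductVector := by
  obtain ⟨v, hv1, hv2, hv3⟩ := hφ.exists_vec
  obtain ⟨w, hw1, hw2, hw3⟩ := hψ.exists_vec
  refine ⟨fun j => match j with
    | Sum.inl j => v j
    | Sum.inr j => w j, site_cases hv1 hw1, site_cases (fun j a ha => hv2 j a ?_)
      (fun j a ha => hw2 j a ?_), site_cases (fun j => ?_) (fun j => ?_)⟩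
  · cases k <;> exact ha
  · cases k <;> exact ha
  · have h1 := h [⟨j, Matrix.vecMulVec (v j) (star (v j))⟩] []
    rw [hv3, word_nil, ψ.map_one, mul_one] at h1
    rw [← h1]
    exact congrArg Φ.toFun ((mul_one _).trans (mul_one _)).symm
  · have h1 := h [] [⟨j, Matrix.vecMulVec (w j) (star (w j))⟩]
    rw [hw3, word_nil, φ.map_one, mul_one] at h1
    rw [← h1]
    exact congrArg Φ.toFun ((one_mul _).trans (mul_one _)).symm

end StackStates

end SpinSystem

/-! ### Polar coordinates, sectors and boundaries of cones -/

lemma norm_dir (t : ℝ) : ‖dir t‖ = 1 := by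
  rw [EuclideanSpace.norm_eq, Fin.sum_univ_two]
  simp [dir]

lemma continuous_dir : Continuous dir := by
  unfold dir
  fun_prop

lemma dir_add_two_pi (t : ℝ) : dir (t + 2 * Real.pi) = dir t := by
  rw [dir, dir, Real.cos_add_two_pi, Real.sin_add_two_pi]

lemma dir_sub_two_pi (t : ℝ) : dir (t - 2 * Real.pi) = dir t := by
  rw [dir, dir, Real.cos_sub_two_pi, Real.sin_sub_two_pi]

lemma dir_add_int (t : ℝ) (n : ℤ) : dir (t + n * (2 * Real.pi)) = dir t := by
  rw [dir, dir, Real.cos_add_int_mul_two_pi, Real.sin_add_int_mul_two_pi]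

lemma exists_int_of_dir_eq {t u : ℝ} (h : dir t = dir u) : ∃ n : ℤ, t = u + n * (2 * Real.pi) := by
  have h0 : Real.cos t = Real.cos u := congrArg (fun x : Plane => x 0) h
  have h1 : Real.sin t = Real.sin u := congrArg (fun x : Plane => x 1) h
  obtain ⟨n, hn⟩ := Real.Angle.angle_eq_iff_two_pi_dvd_sub.mp (Real.Angle.cos_sin_inj h0 h1)
  exact ⟨n, by linarith⟩

lemma eq_of_dir_eq {t u : ℝ} (h : dir t = dir u) (h1 : t < u + 2 * Real.pi)
    (h2 : u < t + 2 * Real.pi) : t = u := by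
  obtain ⟨n, hn⟩ := exists_int_of_dir_eq h
  have hpi := Real.two_pi_pos
  have e1 : n < 1 := by
    have : (n : ℝ) < 1 := by nlinarith
    exact_mod_cast this
  have e2 : -1 < n := by
    have : (-1 : ℝ) < n := by nlinarith
    exact_mod_cast this
  have : n = 0 := by omega
  rw [hn, this, Int.cast_zero, zero_mul, add_zero]

lemma norm_smul_dir {r : ℝ} (hr : 0 ≤ r) (t : ℝ) : ‖r • dir t‖ = r := by
  rw [norm_smul, norm_dir, mul_one, Real.norm_of_nonneg hr]

lemma polar_inj {p : Plane} {r s t u : ℝ} (hr : 0 ≤ r) (hs : 0 ≤ s)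
    (h : p + r • dir t = p + s • dir u) : r = s ∧ (r ≠ 0 → dir t = dir u) := by
  have h1 := add_left_cancel h
  have h2 : r = s := by rw [← norm_smul_dir hr t, ← norm_smul_dir hs u, h1]
  subst h2
  exact ⟨rfl, fun h0 => smul_right_injective Plane h0 h1⟩

lemma exists_polar (p x : Plane) (c : ℝ) :
    ∃ r : ℝ, 0 ≤ r ∧ ∃ t ∈ Set.Ico c (c + 2 * Real.pi), x = p + r • dir t := by
  set z : ℂ := ⟨(x - p) 0, (x - p) 1⟩ with hz
  have h0 : x = p + ‖z‖ • dir z.arg := by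
    have h1 : x - p = ‖z‖ • dir z.arg := by
      ext i
      fin_cases i
      · exact (Complex.norm_mul_cos_arg z).symm
      · exact (Complex.norm_mul_sin_arg z).symm
    rw [← h1, add_sub_cancel]
  refine ⟨‖z‖, norm_nonneg _, toIcoMod Real.two_pi_pos c z.arg, toIcoMod_mem_Ico _ _ _, ?_⟩
  have h2 : toIcoMod Real.two_pi_pos c z.arg =
      z.arg + ((-toIcoDiv Real.two_pi_pos c z.arg : ℤ) : ℝ) * (2 * Real.pi) := by
    rw [toIcoMod, zsmul_eq_mul]
    push_cast
    ring
  rw [h2, dir_add_int, ← h0]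

/-- The closed region of the plane with the given apex and interval of directions. -/
def closedSector (p : Plane) (lo hi : ℝ) : Set Plane :=
  {x | ∃ r : ℝ, 0 ≤ r ∧ ∃ t ∈ Set.Icc lo hi, x = p + r • dir t}

/-- The open region of the plane with the given apex and interval of directions. -/
def openSector (p : Plane) (lo hi : ℝ) : Set Plane :=
  {x | ∃ r : ℝ, 0 < r ∧ ∃ t ∈ Set.Ioo lo hi, x = p + r • dir t}

section Sector

variable {p : Plane} {lo hi : ℝ}

lemma Cone.region_eq (C : Cone) : C.region = openSector C.apex C.lo C.hi := by
  ext x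
  simp only [Cone.region, Cone.ray, openSector, Set.mem_iUnion, Set.mem_ofPred_eq]
  constructor
  · rintro ⟨t, ht, r, hr, hx⟩
    exact ⟨r, hr, t, ht, hx⟩
  · rintro ⟨r, hr, t, ht, hx⟩
    exact ⟨t, ht, r, hr, hx⟩

lemma closedSector_mono {lo' hi' : ℝ} (h1 : lo' ≤ lo) (h2 : hi ≤ hi') :
    closedSector p lo hi ⊆ closedSector p lo' hi' := by
  rintro x ⟨r, hr, t, ht, hx⟩
  exact ⟨r, hr, t, ⟨h1.trans ht.1, ht.2.trans h2⟩, hx⟩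

lemma openSector_subset_closedSector : openSector p lo hi ⊆ closedSector p lo hi := by
  rintro x ⟨r, hr, t, ht, hx⟩
  exact ⟨r, hr.le, t, ⟨ht.1.le, ht.2.le⟩, hx⟩

lemma closedSector_add_two_pi :
    closedSector p (lo + 2 * Real.pi) (hi + 2 * Real.pi) = closedSector p lo hi := by
  ext x
  constructor
  · rintro ⟨r, hr, t, ht, hx⟩
    exact ⟨r, hr, t - 2 * Real.pi, ⟨by linarith [ht.1], by linarith [ht.2]⟩, by
      rw [hx, dir_sub_two_pi]⟩
  · rintro ⟨r, hr, t, ht, hx⟩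
    exact ⟨r, hr, t + 2 * Real.pi, ⟨by linarith [ht.1], by linarith [ht.2]⟩, by
      rw [hx, dir_add_two_pi]⟩

lemma apex_mem_closedSector (h : lo ≤ hi) : p ∈ closedSector p lo hi :=
  ⟨0, le_rfl, lo, ⟨le_rfl, h⟩, by rw [zero_smul, add_zero]⟩

/-- The sector is the projection of a closed subset of the plane times the compact interval of
directions, and such projections are closed maps. The radius is recovered as `‖x - p‖`. -/
lemma isClosed_closedSector : IsClosed (closedSector p lo hi) := by
  have h : closedSector p lo hi = Prod.fst ''
      {q : Plane × Set.Icc lo hi | q.1 = p + ‖q.1 - p‖ • dir q.2} := by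
    ext x
    constructor
    · rintro ⟨r, hr, t, ht, hx⟩
      refine ⟨(x, ⟨t, ht⟩), ?_, rfl⟩
      change x = p + ‖x - p‖ • dir t
      have h1 : x - p = r • dir t := by rw [hx, add_sub_cancel_left]
      rw [h1, norm_smul_dir hr, hx]
    · rintro ⟨⟨y, t⟩, hq, rfl⟩
      exact ⟨‖y - p‖, norm_nonneg _, t.1, t.2, hq⟩
  rw [h]
  refine isClosedMap_fst_of_compactSpace _ (isClosed_eq continuous_fst ?_)
  have := continuous_dir
  fun_prop

lemma closure_openSector (h : lo < hi) : closure (openSector p lo hi) = closedSector p lo hi := by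
  refine (closure_minimal openSector_subset_closedSector isClosed_closedSector).antisymm ?_
  rintro x ⟨r, hr, t, ht, rfl⟩
  have hcont : Continuous fun q : ℝ × ℝ => p + q.1 • dir q.2 := by
    have := continuous_dir
    fun_prop
  have hmem : (r, t) ∈ closure (Set.Ioi (0 : ℝ) ×ˢ Set.Ioo lo hi) := by
    rw [closure_prod_eq, closure_Ioi, closure_Ioo h.ne]
    exact ⟨hr, ht⟩
  refine closure_mono ?_ (image_closure_subset_closure_image hcont ⟨_, hmem, rfl⟩)
  rintro _ ⟨⟨s, u⟩, ⟨hs, hu⟩, rfl⟩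
  exact ⟨s, hs, u, hu, rfl⟩

lemma disjoint_openSector {lo' hi' : ℝ} (h1 : hi ≤ lo') (h2 : hi' ≤ lo + 2 * Real.pi) :
    Disjoint (openSector p lo hi) (openSector p lo' hi') := by
  rw [Set.disjoint_left]
  rintro x ⟨r, hr, t, ht, hx⟩ ⟨s, hs, u, hu, hx'⟩
  have h := (polar_inj hr.le hs.le (hx.symm.trans hx')).2 hr.ne'
  have := eq_of_dir_eq h (by linarith [ht.2, hu.1, Real.two_pi_pos]) (by linarith [ht.1, hu.2])
  linarith [ht.2, hu.1]

lemma closedSector_inter {lo' hi' : ℝ} (h1 : hi < lo') (h2 : hi' < lo + 2 * Real.pi)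
    (h3 : lo ≤ hi) (h4 : lo' ≤ hi') : closedSector p lo hi ∩ closedSector p lo' hi' = {p} := by
  refine Set.Subset.antisymm ?_ (Set.singleton_subset_iff.mpr
    ⟨apex_mem_closedSector h3, apex_mem_closedSector h4⟩)
  rintro x ⟨⟨r, hr, t, ht, hx⟩, ⟨s, hs, u, hu, hx'⟩⟩
  by_cases h0 : r = 0
  · rw [hx, h0, zero_smul, add_zero]; rfl
  · have h := (polar_inj hr hs (hx.symm.trans hx')).2 h0
    have := eq_of_dir_eq h (by linarith [ht.2, hu.1, Real.two_pi_pos]) (by linarith [ht.1, hu.2])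
    linarith [ht.2, hu.1]

lemma closedSector_union {m : ℝ} (h : hi = lo + 2 * Real.pi) :
    closedSector p lo m ∪ closedSector p m hi = Set.univ := by
  refine Set.eq_univ_of_forall fun x => ?_
  obtain ⟨r, hr, t, ht, hx⟩ := exists_polar p x lo
  rcases le_total t m with htm | htm
  · exact Or.inl ⟨r, hr, t, ⟨ht.1, htm⟩, hx⟩
  · exact Or.inr ⟨r, hr, t, ⟨htm, by rw [h]; exact ht.2.le⟩, hx⟩

lemma compl_openSector (h1 : lo < hi) (h2 : hi < lo + 2 * Real.pi) :
    (openSector p lo hi)ᶜ = closedSector p hi (lo + 2 * Real.pi) := by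
  ext x
  constructor
  · intro hx
    obtain ⟨r, hr, t, ht, rfl⟩ := exists_polar p x hi
    rcases le_or_gt t (lo + 2 * Real.pi) with h | h
    · exact ⟨r, hr, t, ⟨ht.1, h⟩, rfl⟩
    · rcases hr.eq_or_lt with rfl | hr
      · rw [zero_smul, add_zero]
        exact apex_mem_closedSector h2.le
      · refine absurd ⟨r, hr, t - 2 * Real.pi, ⟨by linarith, by linarith [ht.2]⟩, ?_⟩ hx
        rw [dir_sub_two_pi]
  · rintro ⟨s, hs, u, hu, hx'⟩ ⟨r, hr, t, ht, hx⟩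
    have h := (polar_inj hr.le hs (hx.symm.trans hx')).2 hr.ne'
    have := eq_of_dir_eq h (by linarith [ht.2, hu.1, Real.two_pi_pos]) (by linarith [ht.1, hu.2])
    linarith [ht.2, hu.1]

lemma compl_closedSector (h1 : lo < hi) (h2 : hi < lo + 2 * Real.pi) :
    (closedSector p lo hi)ᶜ = openSector p hi (lo + 2 * Real.pi) := by
  rw [← closedSector_add_two_pi, ← compl_openSector h2 (by linarith), compl_compl]

lemma Cone.boundary_eq (C : Cone) :
    C.boundary = closedSector C.apex C.lo C.hi ∩ closedSector C.apex C.hi (C.lo + 2 * Real.pi) := by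
  rw [Cone.boundary, Cone.region_eq, closure_openSector C.lo_lt_hi,
    frontier_eq_closure_inter_closure, isClosed_closedSector.closure_eq,
    compl_closedSector C.lo_lt_hi C.hi_lt, closure_openSector C.hi_lt]

lemma Cone.apex_add_dir_lo_mem_boundary (C : Cone) : C.apex + dir C.lo ∈ C.boundary := by
  rw [C.boundary_eq]
  exact ⟨⟨1, zero_le_one, C.lo, ⟨le_rfl, C.lo_lt_hi.le⟩, by rw [one_smul]⟩,
    ⟨1, zero_le_one, C.lo + 2 * Real.pi, ⟨C.hi_lt.le, le_rfl⟩, by rw [one_smul, dir_add_two_pi]⟩⟩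

lemma Cone.apex_add_dir_hi_mem_boundary (C : Cone) : C.apex + dir C.hi ∈ C.boundary := by
  rw [C.boundary_eq]
  exact ⟨⟨1, zero_le_one, C.hi, ⟨C.lo_lt_hi.le, le_rfl⟩, by rw [one_smul]⟩,
    ⟨1, zero_le_one, C.hi, ⟨le_rfl, C.hi_lt.le⟩, by rw [one_smul]⟩⟩

lemma Cone.exists_of_mem_boundary (C : Cone) {x : Plane} (hx : x ∈ C.boundary) :
    ∃ r : ℝ, 0 ≤ r ∧ (x = C.apex + r • dir C.lo ∨ x = C.apex + r • dir C.hi) := by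
  rw [C.boundary_eq] at hx
  obtain ⟨⟨r, hr, t, ht, hx⟩, ⟨s, hs, u, hu, hx'⟩⟩ := hx
  refine ⟨r, hr, ?_⟩
  by_cases h0 : r = 0
  · left; rw [hx, h0, zero_smul, zero_smul]
  · have h := (polar_inj hr hs (hx.symm.trans hx')).2 h0
    by_cases hl : t = C.lo
    · left; rw [hx, hl]
    · have hl' := lt_of_le_of_ne ht.1 (Ne.symm hl)
      have := eq_of_dir_eq h (by linarith [ht.2, hu.1, Real.two_pi_pos]) (by linarith [hu.2])
      right
      rw [hx, le_antisymm ht.2 (this ▸ hu.1)]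

end Sector

/-- The apexes may differ. By compactness the two ranges of directions are at distance at least some
`δ > 0`. At a common point the radii differ by at most `‖p' - p‖`, which forces `r * δ ≤ 2 * ‖p' -
p‖`. -/
lemma isBounded_closedSector_inter (p p' : Plane) {lo hi a b : ℝ} (h1 : hi < a)
    (h2 : b < lo + 2 * Real.pi) :
    Bornology.IsBounded (closedSector p lo hi ∩ closedSector p' a b) := by
  obtain ⟨δ, hδ, hle⟩ : ∃ δ : ℝ, 0 < δ ∧
      ∀ t ∈ Set.Icc lo hi, ∀ u ∈ Set.Icc a b, δ ≤ ‖dir t - dir u‖ := by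
    rcases (Set.Icc lo hi ×ˢ Set.Icc a b).eq_empty_or_nonempty with he | hne
    · exact ⟨1, one_pos, fun t ht u hu => absurd (Set.mk_mem_prod ht hu) (he ▸ Set.notMem_empty _)⟩
    · have hcont : Continuous fun q : ℝ × ℝ => ‖dir q.1 - dir q.2‖ := by
        have := continuous_dir
        fun_prop
      obtain ⟨q, hq, hmin⟩ := (isCompact_Icc.prod isCompact_Icc).exists_isMinOn hne
        hcont.continuousOn
      refine ⟨‖dir q.1 - dir q.2‖, ?_,
        fun t ht u hu => isMinOn_iff.mp hmin (t, u) (Set.mk_mem_prod ht hu)⟩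
      rw [norm_pos_iff, sub_ne_zero]
      intro h
      have := eq_of_dir_eq h (by linarith [hq.1.2, hq.2.1, Real.two_pi_pos])
        (by linarith [hq.1.1, hq.2.2])
      linarith [hq.1.2, hq.2.1]
  refine (Metric.isBounded_closedBall (x := p) (r := 2 * ‖p' - p‖ / δ)).subset ?_
  rintro x ⟨⟨r, hr, t, ht, hx⟩, ⟨s, hs, u, hu, hx'⟩⟩
  have h3 : p' - p = r • dir t - s • dir u := by
    rw [sub_eq_sub_iff_add_eq_add, ← hx', add_comm (r • dir t), ← hx]
  have h4 : |r - s| ≤ ‖p' - p‖ := by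
    have := abs_norm_sub_norm_le (r • dir t) (s • dir u)
    rwa [norm_smul_dir hr, norm_smul_dir hs, ← h3] at this
  have h5 : r • (dir t - dir u) = (p' - p) - (r - s) • dir u := by
    rw [h3, smul_sub, sub_smul]; abel
  have h6 : r * δ ≤ 2 * ‖p' - p‖ := by
    calc r * δ ≤ r * ‖dir t - dir u‖ := by gcongr; exact hle t ht u hu
      _ = ‖r • (dir t - dir u)‖ := by rw [norm_smul, Real.norm_of_nonneg hr]
      _ ≤ ‖p' - p‖ + ‖(r - s) • dir u‖ := by rw [h5]; exact norm_sub_le _ _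
      _ ≤ 2 * ‖p' - p‖ := by
        rw [norm_smul, norm_dir, mul_one, Real.norm_eq_abs]; linarith
  rw [mem_closedBall_iff_norm, hx, add_sub_cancel_left, norm_smul_dir hr, le_div_iff₀ hδ]
  exact h6

/-! ### Generic directions and the adapted partition -/

/-- The directions from a point in which there is a site. -/
def siteAngles {k : Statistics} (Q : SpinSystem k) (p : Plane) : Set ℝ :=
  {t | ∃ j, ∃ r : ℝ, 0 ≤ r ∧ Q.pos j = p + r • dir t}

section Generic

variable {k : Statistics} {Q : SpinSystem k}

lemma exists_notMem_range_pos (Q : SpinSystem k) : ∃ p : Plane, p ∉ Set.range Q.pos := by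
  have := Q.countable_site
  exact ((Set.countable_range Q.pos).dense_compl ℝ).nonempty

/-- From a point that is not itself a site, each site is seen in one direction modulo `2π`. Seen
from a site, every angle would be excluded. -/
lemma countable_siteAngles {p : Plane} (hp : p ∉ Set.range Q.pos) :
    (siteAngles Q p).Countable := by
  have := Q.countable_site
  have h : siteAngles Q p = ⋃ j, {t | ∃ r : ℝ, 0 ≤ r ∧ Q.pos j = p + r • dir t} := by
    ext t
    simp only [siteAngles, Set.mem_iUnion, Set.mem_ofPred_eq]
  rw [h]
  refine Set.countable_iUnion fun j => ?_
  rcases Set.eq_empty_or_nonempty {t | ∃ r : ℝ, 0 ≤ r ∧ Q.pos j = p + r • dir t} with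
    he | ⟨t, r, hr, hj⟩
  · rw [he]; exact Set.countable_empty
  · refine (Set.countable_range fun n : ℤ => t + n * (2 * Real.pi)).mono ?_
    rintro u ⟨s, hs, hj'⟩
    have hs0 : s ≠ 0 := fun h0 => hp ⟨j, by rw [hj', h0, zero_smul, add_zero]⟩
    obtain ⟨n, hn⟩ := exists_int_of_dir_eq ((polar_inj hs hr (hj'.symm.trans hj)).2 hs0)
    exact ⟨n, hn.symm⟩

lemma exists_notMem_siteAngles {p : Plane} (hp : p ∉ Set.range Q.pos) {a b : ℝ} (h : a < b) :
    ∃ t, t ∉ siteAngles Q p ∧ a < t ∧ t < b := by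
  obtain ⟨t, ht, h1, h2⟩ := ((countable_siteAngles hp).dense_compl ℝ).exists_between h
  exact ⟨t, ht, h1, h2⟩

lemma sub_two_pi_notMem_siteAngles {p : Plane} {t : ℝ} (ht : t ∉ siteAngles Q p) :
    t - 2 * Real.pi ∉ siteAngles Q p := by
  rintro ⟨j, r, hr, hj⟩
  exact ht ⟨j, r, hr, by rw [hj, dir_sub_two_pi]⟩

lemma Cone.isGeneric_of_notMem (C : Cone) (h1 : C.lo ∉ siteAngles Q C.apex)
    (h2 : C.hi ∉ siteAngles Q C.apex) : C.IsGeneric Q := by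
  intro j hj
  obtain ⟨r, hr, h | h⟩ := C.exists_of_mem_boundary hj
  · exact h1 ⟨j, r, hr, h⟩
  · exact h2 ⟨j, r, hr, h⟩

/-- Disjoint cones whose boundaries meet only at the apex, with angles in a common range. -/
lemma exists_angles {L R : Cone} (hap : L.apex = R.apex) (hd : Disjoint L.region R.region)
    (hb : L.boundary ∩ R.boundary = {L.apex}) :
    ∃ r₀ r₁ : ℝ, L.hi < r₀ ∧ r₀ < r₁ ∧ r₁ < L.lo + 2 * Real.pi ∧
      R.region = openSector L.apex r₀ r₁ := by
  -- A multiple of `2π` brings the lower angle of `R` into one period starting at `L.lo`.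
  set n : ℤ := toIcoDiv Real.two_pi_pos L.lo R.lo with hn
  set r₀ : ℝ := R.lo + ((-n : ℤ) : ℝ) * (2 * Real.pi) with hr₀
  set r₁ : ℝ := R.hi + ((-n : ℤ) : ℝ) * (2 * Real.pi) with hr₁
  have hmem : r₀ ∈ Set.Ico L.lo (L.lo + 2 * Real.pi) := by
    have h := toIcoMod_mem_Ico Real.two_pi_pos L.lo R.lo
    rw [toIcoMod, ← hn, zsmul_eq_mul] at h
    rw [hr₀]
    push_cast
    rwa [neg_mul, ← sub_eq_add_neg]
  have hr : R.region = openSector L.apex r₀ r₁ := by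
    rw [R.region_eq, ← hap]
    ext x
    constructor
    · rintro ⟨r, hr, t, ht, hx⟩
      exact ⟨r, hr, t + ((-n : ℤ) : ℝ) * (2 * Real.pi),
        ⟨by linarith [ht.1], by linarith [ht.2]⟩, by rw [hx, dir_add_int]⟩
    · rintro ⟨r, hr, t, ht, hx⟩
      refine ⟨r, hr, t + (n : ℝ) * (2 * Real.pi), ?_, by rw [hx, dir_add_int]⟩
      rw [hr₀, hr₁] at ht
      push_cast at ht
      exact ⟨by linarith [ht.1], by linarith [ht.2]⟩
  have h01 : r₀ < r₁ := by linarith [R.lo_lt_hi]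
  -- Two coinciding boundary directions would give a common boundary point at distance 1 from the
  -- apex. This makes the inequalities between the angles strict.
  have hne : ∀ t u, L.apex + dir t ∈ L.boundary → R.apex + dir u ∈ R.boundary →
      dir u ≠ dir t := by
    intro t u ht hu h
    have h1 : L.apex + dir t ∈ ({L.apex} : Set Plane) := by
      rw [← hb]
      refine ⟨ht, ?_⟩
      rwa [hap, ← h]
    have h2 : dir t = 0 := by simpa using h1
    have h3 := norm_dir t
    rw [h2, norm_zero] at h3
    exact zero_ne_one h3
  have d0 : dir r₀ = dir R.lo := dir_add_int _ _
  have d1 : dir r₁ = dir R.hi := dir_add_int _ _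
  have hLlo := L.apex_add_dir_lo_mem_boundary
  have hLhi := L.apex_add_dir_hi_mem_boundary
  have hRlo := R.apex_add_dir_lo_mem_boundary
  have hRhi := R.apex_add_dir_hi_mem_boundary
  have hcommon : ∀ t, L.lo < t → t < L.hi → ∀ u, r₀ < u → u < r₁ → dir t ≠ dir u := by
    intro t h1 h2 u h3 h4 h
    have h5 : L.apex + (1 : ℝ) • dir t ∉ R.region := Set.disjoint_left.mp hd ?_
    · refine h5 ?_
      rw [hr]
      exact ⟨1, one_pos, u, ⟨h3, h4⟩, by rw [h]⟩
    · rw [L.region_eq]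
      exact ⟨1, one_pos, t, ⟨h1, h2⟩, rfl⟩
  have hlt : L.hi < r₀ := by
    rcases lt_trichotomy r₀ L.hi with h | h | h
    · obtain ⟨t, ht, ht'⟩ := exists_between (lt_min h h01)
      exact absurd rfl (hcommon t (hmem.1.trans_lt ht) (ht'.trans_le (min_le_left _ _)) t ht
        (ht'.trans_le (min_le_right _ _)))
    · exact absurd (by rw [← d0, h]) (hne _ _ hLhi hRlo)
    · exact h
  refine ⟨r₀, r₁, hlt, h01, ?_, hr⟩
  rcases lt_trichotomy r₁ (L.lo + 2 * Real.pi) with h | h | h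
  · exact h
  · exact absurd (by rw [← d1, h, dir_add_two_pi]) (hne _ _ hLlo hRhi)
  · obtain ⟨t, ht, ht'⟩ := exists_between
      (lt_min h (add_lt_add_left L.lo_lt_hi (2 * Real.pi)))
    have e1 := ht'.trans_le (min_le_left _ _)
    have e2 := ht'.trans_le (min_le_right _ _)
    exact absurd (dir_sub_two_pi t) (hcommon (t - 2 * Real.pi) (by linarith) (by linarith) t
      (hmem.2.trans ht) e1)

/-- A good conical partition adapted to a pair of disjoint cones: outside a bounded region, each of
the two cones is contained in one of the cones `A_a` and does not meet the cones `B_{a(a+1)}`. -/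
theorem exists_goodConicalPartition (Q : SpinSystem k) {L R : Cone} (hap : L.apex = R.apex)
    (hd : Disjoint L.region R.region) (hb : L.boundary ∩ R.boundary = {L.apex}) :
    ∃ (P : GoodConicalPartition Q) (a b : Fin (P.m + 2)), a ≠ b ∧
      Bornology.IsBounded (L.region \ ((P.A a).region \ ⋃ c, (P.B c).region)) ∧
      Bornology.IsBounded (R.region \ ((P.A b).region \ ⋃ c, (P.B c).region)) := by
  obtain ⟨r₀, r₁, h1, h2, h3, hR⟩ := exists_angles hap hd hb
  have h0 := L.lo_lt_hi
  -- The sites of `Q` may lie on the boundaries of `L` and `R` or at their apex. A different apex is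
  -- harmless, since only the behaviour outside a bounded region matters.
  obtain ⟨p, hp⟩ := exists_notMem_range_pos Q
  -- In each of the two angular gaps between `L` and `R`, three generic angles `s < t < u` are
  -- chosen: `t` separates the cones `A`, and `(s, u)` is the cone `B` around it.
  obtain ⟨s₁, hs₁, ls₁, us₁⟩ := exists_notMem_siteAngles hp h1
  obtain ⟨t₁, ht₁, lt₁, ut₁⟩ := exists_notMem_siteAngles hp us₁
  obtain ⟨u₁, hu₁, lu₁, uu₁⟩ := exists_notMem_siteAngles hp ut₁
  obtain ⟨s₂, hs₂, ls₂, us₂⟩ := exists_notMem_siteAngles hp h3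
  obtain ⟨t₂, ht₂, lt₂, ut₂⟩ := exists_notMem_siteAngles hp us₂
  obtain ⟨u₂, hu₂, lu₂, uu₂⟩ := exists_notMem_siteAngles hp ut₂
  have hpi := Real.two_pi_pos
  set A₀ : Cone := ⟨p, t₂ - 2 * Real.pi, t₁, by linarith, by linarith⟩ with hA₀
  set A₁ : Cone := ⟨p, t₁, t₂, by linarith, by linarith⟩ with hA₁
  set B₀ : Cone := ⟨p, s₁, u₁, by linarith, by linarith⟩ with hB₀
  set B₁ : Cone := ⟨p, s₂, u₂, by linarith, by linarith⟩ with hB₁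
  have rA₀ : A₀.region = openSector p (t₂ - 2 * Real.pi) t₁ := A₀.region_eq
  have rA₁ : A₁.region = openSector p t₁ t₂ := A₁.region_eq
  have rB₀ : B₀.region = openSector p s₁ u₁ := B₀.region_eq
  have rB₁ : B₁.region = openSector p s₂ u₂ := B₁.region_eq
  have hdA : Disjoint A₀.region A₁.region := by
    rw [rA₀, rA₁]
    exact disjoint_openSector le_rfl (by linarith)
  have hcB : closure B₀.region ∩ closure B₁.region = {p} := by
    rw [rB₀, rB₁, closure_openSector (by linarith), closure_openSector (by linarith)]
    exact closedSector_inter (by linarith) (by linarith) (by linarith) (by linarith)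
  let P : GoodConicalPartition Q :=
    { m := 0
      apex := p
      A := ![A₀, A₁]
      B := ![B₀, B₁]
      A_generic := by
        intro a
        fin_cases a
        · exact A₀.isGeneric_of_notMem (sub_two_pi_notMem_siteAngles ht₂) ht₁
        · exact A₁.isGeneric_of_notMem ht₁ ht₂
      B_generic := by
        intro a
        fin_cases a
        · exact B₀.isGeneric_of_notMem hs₁ hu₁
        · exact B₁.isGeneric_of_notMem hs₂ hu₂
      A_apex := by intro a; fin_cases a <;> rfl
      B_apex := by intro a; fin_cases a <;> rfl
      A_disjoint := by
        intro a b hab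
        fin_cases a <;> fin_cases b
        · exact absurd rfl hab
        · exact hdA
        · exact hdA.symm
        · exact absurd rfl hab
      A_cover := by
        refine Set.eq_univ_of_univ_subset ?_
        rw [← closedSector_union (p := p) (lo := t₂ - 2 * Real.pi) (m := t₁) (hi := t₂) (by ring),
          ← closure_openSector (by linarith), ← closure_openSector (by linarith), ← rA₀, ← rA₁]
        exact Set.union_subset (closure_mono (Set.subset_iUnion_of_subset 0 subset_rfl))
          (closure_mono (Set.subset_iUnion_of_subset 1 subset_rfl))
      A_order := by
        intro a
        fin_cases a
        · rfl
        · exact dir_sub_two_pi t₂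
      B_closure := by
        intro a b hab
        fin_cases a <;> fin_cases b
        · exact absurd rfl hab
        · exact hcB
        · exact (Set.inter_comm _ _).trans hcB
        · exact absurd rfl hab
      B_contains := by
        intro a
        fin_cases a
        · change Cone.ray p t₁ ⊆ B₀.region
          rw [rB₀]
          rintro x ⟨r, hr, hx⟩
          exact ⟨r, hr, t₁, ⟨by linarith, by linarith⟩, hx⟩
        · change Cone.ray p t₂ ⊆ B₁.region
          rw [rB₁]
          rintro x ⟨r, hr, hx⟩
          exact ⟨r, hr, t₂, ⟨by linarith, by linarith⟩, hx⟩ }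
  have hB : ⋃ c, (P.B c).region = B₀.region ∪ B₁.region := by
    ext x
    rw [Set.mem_iUnion, Fin.exists_fin_two]
    rfl
  have hdiff : ∀ X Y Z W : Set Plane, X \ (Y \ (Z ∪ W)) ⊆ X ∩ (Yᶜ ∪ Z ∪ W) := by
    rintro X Y Z W x ⟨h, h'⟩
    refine ⟨h, ?_⟩
    by_contra h''
    simp only [Set.mem_union, Set.mem_compl_iff, not_or, not_not] at h''
    exact h' ⟨h''.1.1, fun h => h.elim h''.1.2 h''.2⟩
  refine ⟨P, 0, 1, Fin.zero_ne_one, ?_, ?_⟩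
  -- The complement of `A₀` together with both cones `B` has directions in `[s₁, u₂]`, which avoids
  -- those of `L`.
  · rw [hB]
    refine (isBounded_closedSector_inter L.apex p (lo := L.lo) (hi := L.hi) (a := s₁) (b := u₂)
      ls₁ uu₂).subset ((hdiff _ _ _ _).trans (Set.inter_subset_inter ?_ ?_))
    · rw [L.region_eq]; exact openSector_subset_closedSector
    · change A₀.regionᶜ ∪ B₀.region ∪ B₁.region ⊆ _
      rw [rA₀, rB₀, rB₁, compl_openSector (by linarith) (by linarith)]
      refine Set.union_subset (Set.union_subset ?_ ?_) ?_
      · exact closedSector_mono (by linarith) (by linarith)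
      · exact openSector_subset_closedSector.trans (closedSector_mono (by linarith) (by linarith))
      · exact openSector_subset_closedSector.trans (closedSector_mono (by linarith) (by linarith))
  -- Likewise everything to be avoided has directions in `[s₂, u₁ + 2π]`, away from those of `R`;
  -- the cone `B₀` is turned by `2π` to fit into this interval.
  · rw [hB]
    refine (isBounded_closedSector_inter L.apex p (lo := r₀) (hi := r₁) (a := s₂)
      (b := u₁ + 2 * Real.pi) ls₂ (by linarith)).subset
      ((hdiff _ _ _ _).trans (Set.inter_subset_inter ?_ ?_))
    · rw [hR]; exact openSector_subset_closedSector
    · change A₁.regionᶜ ∪ B₀.region ∪ B₁.region ⊆ _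
      rw [rA₁, rB₀, rB₁, compl_openSector (by linarith) (by linarith)]
      refine Set.union_subset (Set.union_subset ?_ ?_) ?_
      · exact closedSector_mono (by linarith) (by linarith)
      · refine openSector_subset_closedSector.trans ?_
        rw [← closedSector_add_two_pi]
        exact closedSector_mono (by linarith) (by linarith)
      · exact openSector_subset_closedSector.trans (closedSector_mono (by linarith) (by linarith))

/-- A bounded region is covered by finitely many unit balls, each of which contains finitely many
sites. -/
lemma finite_pos_preimage (Q : SpinSystem k) {X : Set Plane} (hX : Bornology.IsBounded X) :
    {j | Q.pos j ∈ X}.Finite := by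
  obtain ⟨l, hl⟩ := Q.uniformlyLocallyFinite
  obtain ⟨t, ht, hcov⟩ := Metric.totallyBounded_iff.mp
    (hX.isCompact_closure.totallyBounded.subset subset_closure) 1 one_pos
  refine (ht.biUnion (t := fun x => {j | Q.pos j ∈ Metric.ball x 1}) fun x _ => ?_).subset ?_
  · exact Set.finite_of_encard_le_coe (hl x).le
  · intro j hj
    obtain ⟨x, hx, hjx⟩ := Set.mem_iUnion₂.mp (hcov hj)
    exact Set.mem_iUnion₂.mpr ⟨x, hx, hjx⟩

end Generic

namespace SpinSystem

variable {k : Statistics} {S : SpinSystem k}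

/-! ### Automorphisms associated with a partition -/

section Automorphisms

lemma aut_mul_apply (α β : S.Aut) (x : S.Obs Set.univ) : (α * β) x = α (β x) := rfl

lemma list_prod_apply_eq_self {l : List S.Aut} {x : S.Obs Set.univ} (h : ∀ β ∈ l, β x = x) :
    l.prod x = x := by
  induction l with
  | nil => rfl
  | cons β l ih =>
    rw [List.prod_cons, aut_mul_apply, ih fun γ hγ => h γ (List.mem_cons_of_mem _ hγ),
      h β List.mem_cons_self]

lemma list_prod_mem {l : List S.Aut} {J : Set S.Site}
    (h : ∀ β ∈ l, ∀ x, InAlgebra x J → InAlgebra (β x) J) {x : S.Obs Set.univ}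
    (hx : InAlgebra x J) : InAlgebra (l.prod x) J := by
  induction l with
  | nil => exact hx
  | cons β l ih =>
    rw [List.prod_cons, aut_mul_apply]
    exact h β List.mem_cons_self _ (ih fun γ hγ => h γ (List.mem_cons_of_mem _ hγ))

/-- An automorphism associated with a good conical partition preserves the algebra of a cone `A_a` on
the observables away from the cones `B_{a(a+1)}`. -/
lemma IsAssociated.apply_mem {Q R : SpinSystem k} {α : R.Aut} {P : GoodConicalPartition Q}
    (hα : IsAssociated α P) (a : Fin (P.m + 2)) {x : R.Obs Set.univ}
    (hx : InAlgebra x (R.sitesIn ((P.A a).region \ ⋃ c, (P.B c).region))) :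
    InAlgebra (α x) (R.sitesIn (P.A a).region) := by
  obtain ⟨βA, βB, hA, hB, rfl⟩ := hα
  -- The product of automorphisms is composition, so the `B` factors act first, on an observable
  -- that they fix; the `A` factors then stay inside the cone.
  rw [aut_mul_apply, list_prod_apply_eq_self (l := List.ofFn βB)]
  · refine list_prod_mem (fun β hβ y hy => ?_)
      (hx.mono (Set.preimage_mono Set.sdiff_subset))
    obtain ⟨c, rfl⟩ := (List.mem_ofFn' βA β).mp hβ
    by_cases hc : c = a
    · subst hc
      exact ((hA c).1 y).mpr hy
    · rw [(hA c).2 y (hy.mono (Set.preimage_mono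
        (Set.subset_compl_iff_disjoint_right.mpr (P.A_disjoint (Ne.symm hc)))))]
      exact hy
  · intro β hβ
    obtain ⟨c, rfl⟩ := (List.mem_ofFn' βB β).mp hβ
    refine (hB c).2 x (hx.mono (Set.preimage_mono fun z hz hz' => hz.2 ?_))
    exact Set.mem_iUnion.mpr ⟨c, hz'⟩

end Automorphisms

/-! ### Pull-back to the original system and conclusion -/

lemma State.eq_of_apply {J : Set S.Site} {φ ψ : S.State J} (h : ∀ x, φ x = ψ x) : φ = ψ := by
  obtain ⟨f, _, _⟩ := φ
  obtain ⟨g, _, _⟩ := ψ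
  obtain rfl : f = g := LinearMap.ext h
  rfl

/-- The pull-back of a state of a stack to the first system. -/
def State.compEmbL {T : SpinSystem k} (φ : (stack S T).State Set.univ) : S.State Set.univ where
  toFun := φ.toFun ∘ₗ (embL S T : S.Obs Set.univ →ₐ[ℂ] (stack S T).Obs Set.univ).toLinearMap
  nonneg a := by
    change 0 ≤ φ (embL S T (star a * a))
    rw [map_mul, map_star]
    exact φ.nonneg _
  map_one := by
    change φ (embL S T 1) = 1
    rw [_root_.map_one, φ.map_one]

lemma State.compEmbL_apply {T : SpinSystem k} (φ : (stack S T).State Set.univ)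
    (x : S.Obs Set.univ) : φ.compEmbL x = φ (embL S T x) := rfl

lemma State.AsympFactor.compEmbL {T : SpinSystem k} {φ ω : (stack S T).State Set.univ}
    {b : S.Obs Set.univ} (h : AsympFactor φ ω Set.univ (embL S T b)) :
    AsympFactor φ.compEmbL ω.compEmbL Set.univ b := by
  intro ε hε
  obtain ⟨Y, hY⟩ := h ε hε
  refine ⟨Y.preimage (siteL T) siteL_injective.injOn, fun z hz => ?_⟩
  rw [compEmbL_apply, compEmbL_apply, compEmbL_apply, map_mul]
  refine (hY _ (hz.embL.mono ?_)).trans (by gcongr; exact norm_embL_le z)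
  rintro _ ⟨j, hj, rfl⟩
  exact ⟨Set.mem_univ _, fun h => hj.2 (by simpa using h)⟩

/-- Invertible states have the split property. -/
theorem IsInvertible.hasSplitProperty {Ψ : S.State Set.univ} (hΨ : IsInvertible Ψ) :
    HasSplitProperty Ψ := by
  classical
  intro L R _ _ hap hd hb hgr
  obtain ⟨S', Ψ', Φ, hΦ, τ, hτ, hphase⟩ := hΨ
  -- The partition must be generic for the stack with the inverse system, since that is the system
  -- over which the phase is trivial.
  obtain ⟨P, a, b, hab, hL, hR⟩ := exists_goodConicalPartition (stack S S') hap hd hb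
  obtain ⟨T, τ₀, τ₁, Φ₀, Φ₁, α, hτ₀, hτ₁, hΦ₀, hΦ₁, hgα, hα, hequiv⟩ := hphase P
  have hprod := hΦ₀.isProductVector hτ hτ₀
  obtain ⟨Ω, hΩ⟩ : ∃ Ω : (stack (stack S S') T).State Set.univ, Ω = Φ₀.comp
    (α : (stack (stack S S') T).Obs Set.univ →⋆ₐ[ℂ] (stack (stack S S') T).Obs Set.univ) :=
    ⟨_, rfl⟩
  have hΩa : ∀ x, Ω x = Φ₀ (α x) := fun x => by rw [hΩ]; rfl
  have hΩg : ∀ x, Ω ((stack (stack S S') T).grading Set.univ x) = Ω x := fun x => by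
    rw [hΩa, hΩa, hgα, hprod.apply_grading]
  have hΩc : ∀ x, State.AsympFactor Φ₁ Ω Set.univ x := by
    rw [← hΩ] at hequiv
    refine hequiv.asympFactor hΩg fun x => ?_
    rw [hΩ]
    exact hprod.asympFactor_comp hgα x
  have hΨ₁ : Φ₁.compEmbL.compEmbL = Ψ := State.eq_of_apply fun x => by
    rw [State.compEmbL_apply, State.compEmbL_apply, hΦ₁.apply_embL, hΦ.apply_embL]
  -- These finitely many sites are the only ones of `L` and `R` that the partition does not handle;
  -- they form the exceptional set outside which `ω` factorizes.
  have hfin : ((S.pos ⁻¹' (L.region \ ((P.A a).region \ ⋃ c, (P.B c).region))) ∪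
      (S.pos ⁻¹' (R.region \ ((P.A b).region \ ⋃ c, (P.B c).region)))).Finite :=
    (finite_pos_preimage S hL).union (finite_pos_preimage S hR)
  have hmem : ∀ (C : Cone) (c : Fin (P.m + 2)),
      S.pos ⁻¹' (C.region \ ((P.A c).region \ ⋃ c, (P.B c).region)) ⊆ hfin.toFinset →
      ∀ x, InAlgebra x (S.sitesIn C.region \ hfin.toFinset) →
        InAlgebra (α (embL (stack S S') T (embL S S' x)))
          ((stack (stack S S') T).sitesIn (P.A c).region) := by
    intro C c hC x hx
    refine hα.apply_mem c (hx.embL.embL.mono ?_)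
    rintro _ ⟨_, ⟨j, hj, rfl⟩, rfl⟩
    by_contra h
    exact hj.2 (hC ⟨hj.1, h⟩)
  refine State.exists_isTensor_quasiEquivalent (Ψ := Ψ) (ω := Ω.compEmbL.compEmbL)
    (hd.preimage S.pos) hgr (fun x => ?_) (fun x => ?_) hfin.toFinset (fun x y hx hy => ?_)
  · simp only [State.compEmbL_apply, embL_grading, hΩg]
  · have h := (hΩc (embL (stack S S') T (embL S S' x))).compEmbL.compEmbL
    rwa [hΨ₁] at h
  · have hx' := hmem L a (fun j hj => hfin.mem_toFinset.mpr (Or.inl hj)) x hx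
    have hy' := hmem R b (fun j hj => hfin.mem_toFinset.mpr (Or.inr hj)) y hy
    have hdis : Disjoint ((stack (stack S S') T).sitesIn (P.A a).region)
        ((stack (stack S S') T).sitesIn (P.A b).region) :=
      (P.A_disjoint hab).preimage _
    simp only [State.compEmbL_apply, map_mul, hΩa]
    exact ⟨hprod.apply_mul hdis hx' hy', hprod.apply_mul hdis.symm hy' hx'⟩

end SpinSystem

end SpinLattice

end
theorem mainTheorem7 {k : SpinLattice.Statistics} (S : SpinLattice.SpinSystem k)
    (Ψ : S.State Set.univ) (hΨ : SpinLattice.SpinSystem.IsInvertible Ψ) :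
    SpinLattice.SpinSystem.HasSplitProperty Ψ :=
  hΨ.hasSplitProperty
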